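/- $\mathsf{ACA}_0$ proves that the following two principles are equivalent; in other words, in every model $(N,S)$ of $\mathsf{ACA}_0$ (with a possibly nonstandard first-order part $N$ and a collection $S$ of subsets of $N$ as the range of set quantifiers) the first principle holds if and only if the second does. (1) Pseudo $\Pi^1_1$-comprehension $\Pi^1_1\text{-}\mathsf{CA}^\varepsilon$: for every set $X\subseteq\mathbb N$ there is a coded $\omega$-model $\mathcal M$ (a set $W\subseteq\mathbb N$, regarded as a code for the model $\mathcal M$ with first-order part $\mathbb N$ whose sets are the sections $(W)_n=\{x\mid (x,n)\in W\}$, $n\in\mathbb N$) such that $X\in\mathcal M$, $\mathcal M\vDash\mathsf{ACA}_0$, and $\{x\mid\mathcal M\vDash\varphi(x,X)\}\in\mathcal M$ for every $\Pi^1_1$-formula $\varphi$ with no set parameters other than $X$ (number parameters are allowed). (2) The arithmetical leftmost path principle $\mathsf{ALPP}$: every ill-founded tree $T$ (a set of finite sequences of natural numbers that is closed under initial segments and has an infinite branch) has a branch $f:\mathbb N\to\mathbb N$ such that there is no branch $g$ of $T$ that is to the left of $f$ (i.e. $g(n)<f(n)$ for the least $n$ with $g(n)\neq f(n)$) and that is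 arithmetically reducible to $T\oplus f=\{2x\mid x\in T\}\cup\{2x+1\mid x\in f\}$, where $f$ is identified with its graph. Here $g$ is arithmetically reducible to $Z$ if its graph is definable from $Z$ by an arithmetical formula with number parameters; inside $\mathsf{ACA}_0$ this means that there are a (code of a) formula of first-order arithmetic with a predicate for $Z$ and a valuation of its subformulas, with Tarski's truth conditions, such that the formula defines the graph of $g$. -/

import Mathlib

universe u

namespace SecondOrderArithmetic

/-! ### The language of second-order arithmetic -/

/-- Number terms with number variables `v_0, …, v_(m-1)`. -/
inductive NumTerm (m : ℕ) : Type
  | var (i : Fin m) : NumTerm m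
  | zero : NumTerm m
  | one : NumTerm m
  | add (t r : NumTerm m) : NumTerm m
  | mul (t r : NumTerm m) : NumTerm m

/-- `Formula m k`: formulas of the two-sorted language of second-order arithmetic whose free
number variables are among `v_0, …, v_(m-1)` and whose free set variables are among
`X_0, …, X_(k-1)`. A quantifier binds the variable with index `0` of its body and shifts the
others. The remaining connectives and quantifiers are the usual classical abbreviations. -/
inductive Formula : ℕ → ℕ → Type
  | eq {m k : ℕ} (t r : NumTerm m) : Formula m k
  | lt {m k : ℕ} (t r : NumTerm m) : Formula m k
  | mem {m k : ℕ} (t : NumTerm m) (j : Fin k) : Formula m k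
  | neg {m k : ℕ} (φ : Formula m k) : Formula m k
  | and {m k : ℕ} (φ ψ : Formula m k) : Formula m k
  | allNum {m k : ℕ} (φ : Formula (m + 1) k) : Formula m k
  | allSet {m k : ℕ} (φ : Formula m (k + 1)) : Formula m k

/-- A formula is arithmetical if it has no set quantifiers (free set variables are allowed). -/
def Formula.IsArithmetical : {m k : ℕ} → Formula m k → Prop
  | _, _, .eq _ _ => True
  | _, _, .lt _ _ => True
  | _, _, .mem _ _ => True
  | _, _, .neg φ => φ.IsArithmetical
  | _, _, .and φ ψ => φ.IsArithmetical ∧ ψ.IsArithmetical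
  | _, _, .allNum φ => φ.IsArithmetical
  | _, _, .allSet _ => False

/-- A `Π¹₁`-formula is one of the form `∀ Y, θ` with `θ` arithmetical. -/
def Formula.IsPi11 {m k : ℕ} (φ : Formula m k) : Prop :=
  ∃ θ : Formula m (k + 1), θ.IsArithmetical ∧ φ = .allSet θ

section Semantics

/- A structure for second-order arithmetic consists of a (possibly nonstandard) first-order part
`(N, 0, 1, +, ·, <)` and a collection `S` of subsets of `N`, over which set quantifiers range. -/
variable {N : Type u} [Zero N] [One N] [Add N] [Mul N] [LT N]

/-- The value of a term. -/
def NumTerm.val {m : ℕ} (v : Fin m → N) : NumTerm m → N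
  | .var i => v i
  | .zero => 0
  | .one => 1
  | .add t r => t.val v + r.val v
  | .mul t r => t.val v * r.val v

/-- Satisfaction in the structure `(N, S)` under the number assignment `v` and the set
assignment `A`. -/
def Formula.Realize (S : Set (Set N)) :
    {m k : ℕ} → Formula m k → (Fin m → N) → (Fin k → Set N) → Prop
  | _, _, .eq t r, v, _ => t.val v = r.val v
  | _, _, .lt t r, v, _ => t.val v < r.val v
  | _, _, .mem t j, v, A => t.val v ∈ A j
  | _, _, .neg φ, v, A => ¬ φ.Realize S v A
  | _, _, .and φ ψ, v, A => φ.Realize S v A ∧ ψ.Realize S v A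
  | _, _, .allNum φ, v, A => ∀ x : N, φ.Realize S (Fin.cons x v : Fin (_ + 1) → N) A
  | _, _, .allSet φ, v, A => ∀ Y ∈ S, φ.Realize S v (Fin.cons Y A : Fin (_ + 1) → Set N)

/-- `(N, S)` is a model of `ACA₀`: the basic axioms, the induction axiom (for sets in `S`), and
comprehension for all arithmetical formulas with number and set parameters. -/
structure ModelsACA₀ (S : Set (Set N)) : Prop where
  add_one_ne_zero : ∀ n : N, n + 1 ≠ 0
  add_one_inj : ∀ m n : N, m + 1 = n + 1 → m = n
  add_zero : ∀ m : N, m + 0 = m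
  add_succ : ∀ m n : N, m + (n + 1) = (m + n) + 1
  mul_zero : ∀ m : N, m * 0 = 0
  mul_succ : ∀ m n : N, m * (n + 1) = m * n + m
  not_lt_zero : ∀ m : N, ¬ m < 0
  lt_succ : ∀ m n : N, m < n + 1 ↔ m < n ∨ m = n
  induction : ∀ X ∈ S, (0 : N) ∈ X → (∀ n ∈ X, n + 1 ∈ X) → ∀ n, n ∈ X
  comprehension : ∀ {m k : ℕ} (φ : Formula (m + 1) k), φ.IsArithmetical →
    ∀ (v : Fin m → N) (A : Fin k → Set N), (∀ j, A j ∈ S) →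
      {x : N | φ.Realize S (Fin.cons x v : Fin (m + 1) → N) A} ∈ S

/-- `(N, S) ⊨ Π¹₁-CA₀(X)`: comprehension for all `Π¹₁`-formulas, with number parameters, but with
no set parameter other than `X`. -/
def ModelsPi11CAFor (S : Set (Set N)) (X : Set N) : Prop :=
  ∀ {m : ℕ} (φ : Formula (m + 1) 1), φ.IsPi11 → ∀ v : Fin m → N,
    {x : N | φ.Realize S (Fin.cons x v : Fin (m + 1) → N) (fun _ => X)} ∈ S

/-! ### Coded ω-models -/

/-- The pairing function `(a, b) ↦ (a + b)² + a`. -/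
def pair (a b : N) : N := (a + b) * (a + b) + a

/-- The `n`-th section `(W)_n = {x | (x, n) ∈ W}`. -/
def sect (W : Set N) (n : N) : Set N := {x | pair x n ∈ W}

/-- The collection of sets of the ω-model coded by `W`. Its first-order part is all of `N`, that
is, the set of natural numbers in the sense of the ambient structure. -/
def codedModel (W : Set N) : Set (Set N) := Set.range (sect W)

/-- The principle `Π¹₁-CA^ε` holds in `(N, S)`: every set `X` belongs to a (coded) ω-model of
`ACA₀ + Π¹₁-CA₀(X)`. -/
def PseudoPi11CA (S : Set (Set N)) : Prop :=
  ∀ X ∈ S, ∃ W ∈ S, X ∈ codedModel W ∧ ModelsACA₀ (codedModel W) ∧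
    ModelsPi11CAFor (codedModel W) X

/-! ### Finite sequences, trees and branches, inside `(N, S)` -/

/-- `s` codes a finite sequence of length `l`. Sequences are coded by Gödel's β-function. A
sequence has several codes, and all notions below depend on the coded sequence only. -/
def SeqLen (s l : N) : Prop := ∃ c d : N, s = pair l (pair c d)

/-- The `i`-th entry of the sequence coded by `s` is `y`: if `s` is the triple `(l, (c, d))`, then
`i < l` and `y` is the remainder of `c` modulo `(i + 1) * d + 1`. -/
def Entry (s i y : N) : Prop :=
  ∃ l c d q : N, s = pair l (pair c d) ∧ i < l ∧
    y < (i + 1) * d + 1 ∧ c = q * ((i + 1) * d + 1) + y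

/-- The sequence coded by `t` is an initial segment of the one coded by `s` (possibly equal). -/
def InitSeg (t s : N) : Prop :=
  (∃ l, SeqLen t l) ∧ (∃ l, SeqLen s l) ∧ ∀ i y, Entry t i y → Entry s i y

/-- `T` is a tree: a set of finite sequences of numbers that is closed under initial segments. -/
def IsTree (T : Set N) : Prop :=
  (∀ s ∈ T, ∃ l, SeqLen s l) ∧ ∀ s ∈ T, ∀ t, InitSeg t s → t ∈ T

/-- `F` is (the graph of) a function from numbers to numbers. -/
def IsFunction (F : Set N) : Prop := ∀ x, ∃! y, pair x y ∈ F

/-- The function `F` is a branch of `T`: all its finite initial segments lie in `T`. -/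
def IsBranch (T F : Set N) : Prop :=
  IsFunction F ∧ ∀ n, ∃ s ∈ T, SeqLen s n ∧ ∀ i, i < n → ∃ y, Entry s i y ∧ pair i y ∈ F

/-- The function `G` is to the left of the function `F`: at the first argument where they differ,
`G` takes the smaller value. -/
def LeftOf (G F : Set N) : Prop :=
  ∃ n a b, pair n a ∈ G ∧ pair n b ∈ F ∧ a < b ∧
    ∀ i, i < n → ∀ y, pair i y ∈ G ↔ pair i y ∈ F

/-- The join `T ⊕ F = {2x | x ∈ T} ∪ {2x + 1 | x ∈ F}`. -/
def join (T F : Set N) : Set N :=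
  {z | (∃ x ∈ T, z = x + x) ∨ ∃ x ∈ F, z = x + x + 1}

/-! ### Arithmetical reducibility, inside `(N, S)`

The statement that `G` is arithmetically reducible to `Z` is one formula of second-order
arithmetic: some formula in the sense of `N`, in the language of first-order arithmetic with a
predicate for `Z`, defines `G`, where truth is given by a valuation of the subformulas. -/

/-- The standard numerals. -/
def numeral : ℕ → N
  | 0 => 0
  | n + 1 => numeral n + 1

/-- Code of `v_i = v_j`. -/
def eqCode (i j : N) : N := pair (numeral 0) (pair i j)
/-- Code of `v_i < v_j`. -/
def ltCode (i j : N) : N := pair (numeral 1) (pair i j)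
/-- Code of `v_i + v_j = v_k`. -/
def addCode (i j k : N) : N := pair (numeral 2) (pair i (pair j k))
/-- Code of `v_i * v_j = v_k`. -/
def mulCode (i j k : N) : N := pair (numeral 3) (pair i (pair j k))
/-- Code of `v_i ∈ Z`. -/
def memCode (i : N) : N := pair (numeral 4) i
/-- Code of the negation. -/
def negCode (p : N) : N := pair (numeral 5) p
/-- Code of the conjunction. -/
def andCode (p q : N) : N := pair (numeral 6) (pair p q)
/-- Code of the quantification `∀ v_i`. -/
def allCode (i p : N) : N := pair (numeral 7) (pair i p)

/-- `D` is a set of formula codes that is closed under subformulas. -/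
def SubformulaClosed (D : Set N) : Prop :=
  ∀ p ∈ D, (∃ i j, p = eqCode i j) ∨ (∃ i j, p = ltCode i j) ∨
    (∃ i j k, p = addCode i j k) ∨ (∃ i j k, p = mulCode i j k) ∨ (∃ i, p = memCode i) ∨
    (∃ q ∈ D, p = negCode q) ∨ (∃ q ∈ D, ∃ r ∈ D, p = andCode q r) ∨
    (∃ i, ∃ q ∈ D, p = allCode i q)

/-- The assignments (finite sequences) `s` and `t` have the same length and agree except possibly
at `i`. -/
def Variant (i s t : N) : Prop :=
  (∃ l, SeqLen s l ∧ SeqLen t l) ∧ ∀ j, j ≠ i → ∀ y, Entry s j y ↔ Entry t j y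

/-- `V` is a valuation for the formulas in `D`: for `p ∈ D` and any assignment `s` (a finite
sequence that gives the values of the variables), `(p, s) ∈ V` is to mean that `p` is true under
`s`, as determined by Tarski's clauses. An atomic formula with a variable beyond the length of
`s` counts as false. -/
structure IsValuation (Z D V : Set N) : Prop where
  closed : SubformulaClosed D
  eq_iff : ∀ i j, eqCode i j ∈ D → ∀ s l, SeqLen s l →
    (pair (eqCode i j) s ∈ V ↔ ∃ a, Entry s i a ∧ Entry s j a)
  lt_iff : ∀ i j, ltCode i j ∈ D → ∀ s l, SeqLen s l →
    (pair (ltCode i j) s ∈ V ↔ ∃ a b, Entry s i a ∧ Entry s j b ∧ a < b)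
  add_iff : ∀ i j k, addCode i j k ∈ D → ∀ s l, SeqLen s l →
    (pair (addCode i j k) s ∈ V ↔ ∃ a b, Entry s i a ∧ Entry s j b ∧ Entry s k (a + b))
  mul_iff : ∀ i j k, mulCode i j k ∈ D → ∀ s l, SeqLen s l →
    (pair (mulCode i j k) s ∈ V ↔ ∃ a b, Entry s i a ∧ Entry s j b ∧ Entry s k (a * b))
  mem_iff : ∀ i, memCode i ∈ D → ∀ s l, SeqLen s l →
    (pair (memCode i) s ∈ V ↔ ∃ a, Entry s i a ∧ a ∈ Z)
  neg_iff : ∀ p, negCode p ∈ D → ∀ s l, SeqLen s l →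
    (pair (negCode p) s ∈ V ↔ pair p s ∉ V)
  and_iff : ∀ p q, andCode p q ∈ D → ∀ s l, SeqLen s l →
    (pair (andCode p q) s ∈ V ↔ pair p s ∈ V ∧ pair q s ∈ V)
  all_iff : ∀ i p, allCode i p ∈ D → ∀ s l, SeqLen s l →
    (pair (allCode i p) s ∈ V ↔ ∀ t, Variant i s t → pair p t ∈ V)

/-- `G` is arithmetically reducible to `Z` in `(N, S)`: there are a formula `p`, a valuation `V` of
its subformulas and values `s` for its number parameters such that
`G = {x | p is true under s with v_0 replaced by x}`. -/
def ArithmeticalIn (S : Set (Set N)) (G Z : Set N) : Prop :=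
  ∃ D ∈ S, ∃ V ∈ S, IsValuation Z D V ∧ ∃ p ∈ D, ∃ s,
    ∀ x, x ∈ G ↔ ∃ t, Variant 0 s t ∧ Entry t 0 x ∧ pair p t ∈ V

/-- The arithmetical leftmost path principle holds in `(N, S)`: every tree `T` that has a branch
has a branch `F` such that no branch of `T` is both to the left of `F` and arithmetically
reducible to `T ⊕ F`. -/
def ALPP (S : Set (Set N)) : Prop :=
  ∀ T ∈ S, IsTree T → (∃ H ∈ S, IsBranch T H) →
    ∃ F ∈ S, IsBranch T F ∧
      ¬ ∃ G ∈ S, IsBranch T G ∧ LeftOf G F ∧ ArithmeticalIn S G (join T F)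

end Semantics

end SecondOrderArithmetic

namespace SecondOrderArithmetic
set_option linter.unusedSectionVars false

/-! From (1) to (2): let `H` be a branch of `T` and let M be an ω-model as in (1) for `T ⊕ H`. "No
branch of `T` in M passes through σ" is a `Π¹₁` property of σ, so M contains the set `B` of these σ.
Choosing least entries outside `B` again and again gives a branch `F` that is leftmost in M
(`exists_leftmost_branch`). Since M is coded by a set, induction on possibly nonstandard formula
codes shows that M is closed under arithmetical reducibility (`mem_codedModel_of_arithmeticalIn`).
Hence a competitor of `F` that is arithmetically reducible to `T ⊕ F` would lie in M, which is
impossible.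

From (2) to (1): a branch of `valuationTree R X` stores `X` and, for every `e = (p, s)`, a flag and
a column. Flag `0` claims that the formula `p` is true under `s` over some set `Z` that agrees with
`X` on `R`; the column must then code `Z` and a valuation, with witnesses for the failure of
universal formulas, so that correctness is checked on finite pieces. Setting all flags to `1` gives
a branch. The flag comes before the column, so correcting a wrong nonzero flag moves a branch to the
left. For the branch `F` provided by `ALPP`, the flags are therefore right about every model of
`ACA₀` inside `S` that contains `F` and consists of sets arithmetically reducible to `T ⊕ F`
(`ALPP.exists_leftmost`).

This is used twice. If `R` is everything, then `Z = X`, and the flags tell which valuations over `X`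
exist among the sets arithmetical in `T ⊕ F`. The sets defined by formulas with such a valuation can
then be enumerated, and they form a coded ω-model of `ACA₀` whose members are all arithmetically
reducible to `X` (`ALPP.exists_codedModel`). If `R` is the set of even numbers, then `Z` ranges over
the sets `X ⊕ Y`, and the flags decide `Σ¹₁` statements about `X`. The first use, applied to `T ⊕ F`
for this second tree, yields an ω-model M for which the flags are right. As `F` belongs to M, so
does every set that is `Π¹₁` over M in `X` (`ALPP.pseudoPi11CA`).

Standard formulas are linked to codes inside the model by `fmCode` and `fmCode_sound`. A standard
formula has only standardly many subformulas, so a valuation extends to it by adjoining one code at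
a time. -/

/-! ### Renaming of variables -/

/-- Renaming of the variables of a term. -/
def NumTerm.rename {m m' : ℕ} (f : Fin m → Fin m') : NumTerm m → NumTerm m'
  | .var i => .var (f i)
  | .zero => .zero
  | .one => .one
  | .add t r => .add (t.rename f) (r.rename f)
  | .mul t r => .mul (t.rename f) (r.rename f)

/-- The extension of a renaming under a binder. -/
def liftRen {m m' : ℕ} (f : Fin m → Fin m') : Fin (m + 1) → Fin (m' + 1) :=
  Fin.cons 0 fun i => (f i).succ

/-- Renaming of the number and set variables of a formula. -/
def Formula.rename : {m k m' k' : ℕ} → Formula m k → (Fin m → Fin m') → (Fin k → Fin k') →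
    Formula m' k'
  | _, _, _, _, .eq t r, f, _ => .eq (t.rename f) (r.rename f)
  | _, _, _, _, .lt t r, f, _ => .lt (t.rename f) (r.rename f)
  | _, _, _, _, .mem t j, f, g => .mem (t.rename f) (g j)
  | _, _, _, _, .neg φ, f, g => .neg (φ.rename f g)
  | _, _, _, _, .and φ ψ, f, g => .and (φ.rename f g) (ψ.rename f g)
  | _, _, _, _, .allNum φ, f, g => .allNum (φ.rename (liftRen f) g)
  | _, _, _, _, .allSet φ, f, g => .allSet (φ.rename f (liftRen g))

theorem Formula.IsArithmetical.rename {m k m' k' : ℕ} {φ : Formula m k} (h : φ.IsArithmetical)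
    (f : Fin m → Fin m') (g : Fin k → Fin k') : (φ.rename f g).IsArithmetical := by
  induction φ generalizing m' k' with
  | eq | lt | mem => trivial
  | neg φ ih => exact ih h f g
  | and φ ψ ih₁ ih₂ => exact ⟨ih₁ h.1 f g, ih₂ h.2 f g⟩
  | allNum φ ih => exact ih h (liftRen f) g
  | allSet φ => exact h.elim

section Definability

variable {N : Type u} [Zero N] [One N] [Add N] [Mul N] [LT N]

theorem NumTerm.val_rename {m m' : ℕ} (f : Fin m → Fin m') (t : NumTerm m) (v : Fin m' → N) :
    (t.rename f).val v = t.val (fun i => v (f i)) := by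
  induction t with
  | var | zero | one => rfl
  | add t r ih₁ ih₂ | mul t r ih₁ ih₂ => simp only [NumTerm.rename, NumTerm.val, ih₁, ih₂]

theorem cons_liftRen {α : Type*} {m m' : ℕ} (f : Fin m → Fin m') (x : α) (v : Fin m' → α) :
    (fun i => (Fin.cons x v : Fin (m' + 1) → α) (liftRen f i)) =
      (Fin.cons x (fun i => v (f i)) : Fin (m + 1) → α) := by
  funext i
  refine Fin.cases ?_ (fun i => ?_) i <;> simp [liftRen]

theorem Formula.realize_rename {S : Set (Set N)} {m k m' k' : ℕ} (φ : Formula m k)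
    (f : Fin m → Fin m') (g : Fin k → Fin k') (v : Fin m' → N) (A : Fin k' → Set N) :
    (φ.rename f g).Realize S v A ↔ φ.Realize S (fun i => v (f i)) (fun j => A (g j)) := by
  induction φ generalizing m' k' with
  | eq | lt | mem => simp only [Formula.rename, Formula.Realize, NumTerm.val_rename]
  | neg φ ih => simp only [Formula.rename, Formula.Realize, ih]
  | and φ ψ ih₁ ih₂ => simp only [Formula.rename, Formula.Realize, ih₁, ih₂]
  | allNum φ ih => simp only [Formula.rename, Formula.Realize, ih, cons_liftRen]
  | allSet φ ih => simp only [Formula.rename, Formula.Realize, ih, cons_liftRen]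

theorem Formula.IsArithmetical.realize_iff {m k : ℕ} {φ : Formula m k} (h : φ.IsArithmetical)
    (S S' : Set (Set N)) (v : Fin m → N) (A : Fin k → Set N) :
    φ.Realize S v A ↔ φ.Realize S' v A := by
  induction φ with
  | eq | lt | mem => rfl
  | neg φ ih => simp only [Formula.Realize, ih h]
  | and φ ψ ih₁ ih₂ => simp only [Formula.Realize, ih₁ h.1, ih₂ h.2]
  | allNum φ ih => simp only [Formula.Realize, ih h]
  | allSet φ => exact h.elim

/-! ### Arithmetical definability as a semantic notion -/

/-- Functions of the number variables that are given by terms with parameters. -/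
class inductive IsTerm : {m : ℕ} → ((Fin m → N) → N) → Prop
  | var {m : ℕ} (i : Fin m) : IsTerm fun v => v i
  | const {m : ℕ} (a : N) : IsTerm fun _ : Fin m → N => a
  | add {m : ℕ} {t r : (Fin m → N) → N} (ht : IsTerm t) (hr : IsTerm r) :
      IsTerm fun v => t v + r v
  | mul {m : ℕ} {t r : (Fin m → N) → N} (ht : IsTerm t) (hr : IsTerm r) :
      IsTerm fun v => t v * r v

/-- Relations between sets and numbers that are arithmetical, with number parameters and with set
parameters from `C`. -/
class inductive Ar (C : Set (Set N)) :
    {k m : ℕ} → ((Fin k → Set N) → (Fin m → N) → Prop) → Prop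
  | eq {k m : ℕ} {t r : (Fin m → N) → N} (ht : IsTerm t) (hr : IsTerm r) :
      Ar C fun (_ : Fin k → Set N) v => t v = r v
  | lt {k m : ℕ} {t r : (Fin m → N) → N} (ht : IsTerm t) (hr : IsTerm r) :
      Ar C fun (_ : Fin k → Set N) v => t v < r v
  | memVar {k m : ℕ} {t : (Fin m → N) → N} (ht : IsTerm t) (j : Fin k) :
      Ar C fun (A : Fin k → Set N) v => t v ∈ A j
  | memConst {k m : ℕ} {t : (Fin m → N) → N} (ht : IsTerm t) (X : Set N) (hX : X ∈ C) :
      Ar C fun (_ : Fin k → Set N) v => t v ∈ X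
  | not {k m : ℕ} {P : (Fin k → Set N) → (Fin m → N) → Prop} (hP : Ar C P) :
      Ar C fun A v => ¬ P A v
  | and {k m : ℕ} {P Q : (Fin k → Set N) → (Fin m → N) → Prop} (hP : Ar C P) (hQ : Ar C Q) :
      Ar C fun A v => P A v ∧ Q A v
  | allCons {k m : ℕ} {P : (Fin k → Set N) → (Fin (m + 1) → N) → Prop} (hP : Ar C P) :
      Ar C fun A v => ∀ x : N, P A (Fin.cons x v : Fin (m + 1) → N)

-- Closure properties are registered as instances, so that instance search recognises an
-- arithmetical predicate by its shape and comprehension or induction applies to predicates as they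
-- are written.
attribute [instance] IsTerm.var IsTerm.const

instance {m : ℕ} {t r : (Fin m → N) → N} [ht : IsTerm t] [hr : IsTerm r] :
    IsTerm fun v => t v + r v := .add ht hr

instance {m : ℕ} {t r : (Fin m → N) → N} [ht : IsTerm t] [hr : IsTerm r] :
    IsTerm fun v => t v * r v := .mul ht hr

section

variable {C : Set (Set N)} {k m : ℕ} {t r : (Fin m → N) → N}
  {P Q : (Fin k → Set N) → (Fin m → N) → Prop}

instance [ht : IsTerm t] [hr : IsTerm r] : Ar C fun (_ : Fin k → Set N) v => t v = r v :=
  .eq ht hr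

instance [ht : IsTerm t] [hr : IsTerm r] : Ar C fun (_ : Fin k → Set N) v => t v < r v :=
  .lt ht hr

instance [hP : Ar C P] : Ar C fun A v => ¬ P A v := .not hP

instance [hP : Ar C P] [hQ : Ar C Q] : Ar C fun A v => P A v ∧ Q A v := .and hP hQ

end

/-- Set-valued functions whose membership relation is arithmetical. -/
class ArSet (C : Set (Set N)) {k m : ℕ} (F : (Fin k → Set N) → (Fin m → N) → Set N) : Prop where
  ar : Ar C fun A (w : Fin (m + 1) → N) => w 0 ∈ F A fun i => w i.succ

theorem IsTerm.comp {m m' : ℕ} {t : (Fin m → N) → N} (ht : IsTerm t)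
    {σ : Fin m → (Fin m' → N) → N} (hσ : ∀ i, IsTerm (σ i)) :
    IsTerm fun v => t fun i => σ i v := by
  induction ht with
  | var i => exact hσ i
  | const a => exact .const a
  | add _ _ ih₁ ih₂ => exact .add ih₁ ih₂
  | mul _ _ ih₁ ih₂ => exact .mul ih₁ ih₂

theorem IsTerm.rename {m m' : ℕ} {t : (Fin m → N) → N} (ht : IsTerm t) (f : Fin m → Fin m') :
    IsTerm fun v : Fin m' → N => t fun i => v (f i) :=
  ht.comp fun i => .var (f i)

variable {C : Set (Set N)} {k m : ℕ}

theorem isTerm_cons {m' : ℕ} {σ : Fin m → (Fin m' → N) → N} (hσ : ∀ i, IsTerm (σ i)) :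
    ∀ i, IsTerm ((Fin.cons (fun w => w 0) (fun i w => σ i fun j => w j.succ) :
      Fin (m + 1) → (Fin (m' + 1) → N) → N) i) := by
  refine Fin.cases ?_ fun i => ?_
  · exact .var 0
  · exact (hσ i).rename Fin.succ

theorem apply_isTerm_cons {m' : ℕ} (σ : Fin m → (Fin m' → N) → N) (x : N) (v : Fin m' → N) :
    (fun i => (Fin.cons (fun w => w 0) (fun i w => σ i fun j => w j.succ) :
      Fin (m + 1) → (Fin (m' + 1) → N) → N) i (Fin.cons x v : Fin (m' + 1) → N)) =
      (Fin.cons x (fun i => σ i v) : Fin (m + 1) → N) := by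
  funext i
  refine Fin.cases ?_ (fun i => ?_) i <;> simp

theorem Ar.comp {m' : ℕ} {P : (Fin k → Set N) → (Fin m → N) → Prop} (hP : Ar C P)
    {σ : Fin m → (Fin m' → N) → N} (hσ : ∀ i, IsTerm (σ i)) :
    Ar C fun A v => P A fun i => σ i v := by
  induction hP generalizing m' with
  | eq ht hr => exact .eq (ht.comp hσ) (hr.comp hσ)
  | lt ht hr => exact .lt (ht.comp hσ) (hr.comp hσ)
  | memVar ht j => exact .memVar (ht.comp hσ) j
  | memConst ht X hX => exact .memConst (ht.comp hσ) X hX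
  | not _ ih => exact .not (ih hσ)
  | and _ _ ih₁ ih₂ => exact .and (ih₁ hσ) (ih₂ hσ)
  | allCons _ ih =>
    have := Ar.allCons (ih (isTerm_cons hσ))
    simpa only [apply_isTerm_cons] using this

theorem Ar.rename {m' : ℕ} {P : (Fin k → Set N) → (Fin m → N) → Prop} (hP : Ar C P)
    (f : Fin m → Fin m') : Ar C fun A (v : Fin m' → N) => P A fun i => v (f i) :=
  hP.comp fun i => .var (f i)

/-- Here the bound variable is a separate argument of `P`, so that the rule unifies with any
universally quantified predicate; the subgoal has this variable at index `0`. -/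
instance Ar.all {P : (Fin k → Set N) → (Fin m → N) → N → Prop}
    [h : Ar C fun A (w : Fin (m + 1) → N) => P A (fun i => w i.succ) (w 0)] :
    Ar C fun A v => ∀ x, P A v x := by
  simpa using Ar.allCons h

instance Ar.imp {P Q : (Fin k → Set N) → (Fin m → N) → Prop} [hP : Ar C P] [hQ : Ar C Q] :
    Ar C fun A v => P A v → Q A v := by
  have := Ar.not (Ar.and hP (Ar.not hQ))
  simpa only [not_and, not_not] using this

instance Ar.or {P Q : (Fin k → Set N) → (Fin m → N) → Prop} [hP : Ar C P] [hQ : Ar C Q] :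
    Ar C fun A v => P A v ∨ Q A v := by
  have := Ar.not (Ar.and (Ar.not hP) (Ar.not hQ))
  simpa only [not_and_or, not_not] using this

instance Ar.iff {P Q : (Fin k → Set N) → (Fin m → N) → Prop} [Ar C P] [Ar C Q] :
    Ar C fun A v => P A v ↔ Q A v := by
  simp only [iff_iff_implies_and_implies]
  infer_instance

instance Ar.ex {P : (Fin k → Set N) → (Fin m → N) → N → Prop}
    [h : Ar C fun A (w : Fin (m + 1) → N) => P A (fun i => w i.succ) (w 0)] :
    Ar C fun A v => ∃ x, P A v x := by
  have := Ar.not (Ar.all (C := C) (P := fun A v x => ¬ P A v x))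
  simpa only [not_forall, not_not] using this

instance Ar.exUnique {P : (Fin k → Set N) → (Fin m → N) → N → Prop}
    [h : Ar C fun A (w : Fin (m + 1) → N) => P A (fun i => w i.succ) (w 0)] :
    Ar C fun A v => ∃! x, P A v x := by
  have h₂ : Ar C fun A (w : Fin (m + 2) → N) => P A (fun i => w i.succ.succ) (w 0) := by
    have := h.rename (m' := m + 2) (Fin.cons 0 fun i => i.succ.succ)
    simpa using this
  unfold ExistsUnique
  infer_instance

instance Ar.ne {t r : (Fin m → N) → N} [IsTerm t] [IsTerm r] :
    Ar C fun (_ : Fin k → Set N) v => t v ≠ r v :=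
  Ar.not (Ar.eq ‹_› ‹_›)

instance Ar.true : Ar C fun (_ : Fin k → Set N) (_ : Fin m → N) => True := by
  have := Ar.eq (C := C) (k := k) (IsTerm.const (m := m) (0 : N)) (IsTerm.const 0)
  simpa using this

instance Ar.false : Ar C fun (_ : Fin k → Set N) (_ : Fin m → N) => False := by
  have := Ar.not (Ar.true (C := C) (k := k) (m := m))
  simpa using this

/-- Whatever `p` says, a proposition without variables is equivalent to `True` or to `False`. -/
instance Ar.const (p : Prop) : Ar C fun (_ : Fin k → Set N) (_ : Fin m → N) => p := by
  by_cases h : p <;> simp only [h] <;> infer_instance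

/-- Substitution of a term for the variable with index `0`. -/
theorem Ar.subst {P : (Fin k → Set N) → (Fin m → N) → N → Prop}
    (h : Ar C fun A (w : Fin (m + 1) → N) => P A (fun i => w i.succ) (w 0))
    {t : (Fin m → N) → N} (ht : IsTerm t) : Ar C fun A v => P A v (t v) := by
  have := h.comp (σ := (Fin.cons t fun i v => v i : Fin (m + 1) → (Fin m → N) → N))
    (Fin.cases ht fun i => .var i)
  simpa using this

instance Ar.mem {t : (Fin m → N) → N} {F : (Fin k → Set N) → (Fin m → N) → Set N}
    [ht : IsTerm t] [hF : ArSet C F] : Ar C fun A v => t v ∈ F A v :=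
  Ar.subst (P := fun A v x => x ∈ F A v) hF.ar ht

instance ArSet.var (j : Fin k) : ArSet C fun A (_ : Fin m → N) => A j :=
  ⟨.memVar (.var 0) j⟩

instance ArSet.const (X : Set N) [h : Fact (X ∈ C)] :
    ArSet C fun (_ : Fin k → Set N) (_ : Fin m → N) => X :=
  ⟨.memConst (.var 0) X h.out⟩

instance ArSet.setOf {P : (Fin k → Set N) → (Fin m → N) → N → Prop}
    [h : Ar C fun A (w : Fin (m + 1) → N) => P A (fun i => w i.succ) (w 0)] :
    ArSet C fun A v => {x | P A v x} :=
  ⟨h⟩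

instance ArSet.empty : ArSet C fun (_ : Fin k → Set N) (_ : Fin m → N) => (∅ : Set N) :=
  ⟨Ar.false⟩

/-- Substitution of terms and arithmetical sets in a definable relation. -/
theorem Ar.compSet {k' : ℕ} {P : (Fin k → Set N) → (Fin m → N) → Prop} (hP : Ar C P)
    {F : Fin k → (Fin k' → Set N) → (Fin m → N) → Set N} (hF : ∀ j, ArSet C (F j)) :
    Ar C fun A v => P (fun j => F j A v) v := by
  induction hP with
  | eq ht hr => exact .eq ht hr
  | lt ht hr => exact .lt ht hr
  | @memVar m t ht j =>
    have := hF j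
    exact Ar.mem
  | memConst ht X hX => exact .memConst ht X hX
  | not _ ih => exact .not (ih hF)
  | and _ _ ih₁ ih₂ => exact .and (ih₁ hF) (ih₂ hF)
  | @allCons m P hP ih =>
    have := Ar.allCons (ih (F := fun j A w => F j A fun i => w i.succ) fun j => ⟨by
      have := (hF j).ar.rename (m' := m + 2) (Fin.cons 0 fun i => i.succ.succ)
      simpa using this⟩)
    simpa using this

/-- The variables of `P` and the outer variables are placed side by side among `m + m'` variables;
the sets are substituted there, and then the terms replace the first block. -/
theorem Ar.rel {m' k' : ℕ} {P : (Fin k → Set N) → (Fin m → N) → Prop} (hP : Ar C P)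
    {F : Fin k → (Fin k' → Set N) → (Fin m' → N) → Set N} (hF : ∀ j, ArSet C (F j))
    {σ : Fin m → (Fin m' → N) → N} (hσ : ∀ i, IsTerm (σ i)) :
    Ar C fun A v => P (fun j => F j A v) (fun i => σ i v) := by
  have h₁ := hP.rename (m' := m + m') (Fin.castAdd m')
  have h₂ := h₁.compSet (k' := k')
    (F := fun j A w => F j A fun i => w (Fin.natAdd m i)) fun j => ⟨by
      have := (hF j).ar.rename (m' := m + m' + 1) (Fin.cons 0 fun i => (Fin.natAdd m i).succ)
      simpa using this⟩
  have h₃ := h₂.comp (σ := Fin.append σ fun i v => v i) (m' := m') fun i => by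
    refine Fin.addCases (fun i => ?_) (fun i => ?_) i
    · simpa using hσ i
    · simpa using IsTerm.var i
  simpa using h₃

end Definability

/-! ### From semantic definability back to formulas with parameters -/

section Extraction

variable {N : Type u} [Zero N] [One N] [Add N] [Mul N] [LT N]

theorem IsTerm.exists_numTerm {m : ℕ} {t : (Fin m → N) → N} (ht : IsTerm t) :
    ∃ (M : ℕ) (τ : NumTerm M) (ρ : Fin M → Fin m ⊕ N),
      ∀ v, τ.val (fun i => Sum.elim v id (ρ i)) = t v := by
  induction ht with
  | var i => exact ⟨1, .var 0, fun _ => .inl i, fun v => rfl⟩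
  | const a => exact ⟨1, .var 0, fun _ => .inr a, fun v => rfl⟩
  | add _ _ ih₁ ih₂ =>
    obtain ⟨M₁, τ₁, ρ₁, h₁⟩ := ih₁
    obtain ⟨M₂, τ₂, ρ₂, h₂⟩ := ih₂
    refine ⟨M₁ + M₂, .add (τ₁.rename (Fin.castAdd M₂)) (τ₂.rename (Fin.natAdd M₁)),
      Fin.append ρ₁ ρ₂, fun v => ?_⟩
    simp [NumTerm.val, NumTerm.val_rename, h₁, h₂]
  | mul _ _ ih₁ ih₂ =>
    obtain ⟨M₁, τ₁, ρ₁, h₁⟩ := ih₁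
    obtain ⟨M₂, τ₂, ρ₂, h₂⟩ := ih₂
    refine ⟨M₁ + M₂, .mul (τ₁.rename (Fin.castAdd M₂)) (τ₂.rename (Fin.natAdd M₁)),
      Fin.append ρ₁ ρ₂, fun v => ?_⟩
    simp [NumTerm.val, NumTerm.val_rename, h₁, h₂]

/-- Every arithmetical relation is given by an arithmetical formula, some of whose variables
are instantiated by parameters. -/
theorem Ar.exists_formula {C : Set (Set N)} {k m : ℕ} {P : (Fin k → Set N) → (Fin m → N) → Prop}
    (hP : Ar C P) : ∃ (M K : ℕ) (φ : Formula M K) (ρ : Fin M → Fin m ⊕ N) (κ : Fin K → Fin k ⊕ C),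
      φ.IsArithmetical ∧ ∀ A v, φ.Realize ∅ (fun i => Sum.elim v id (ρ i))
        (fun j => Sum.elim A Subtype.val (κ j)) ↔ P A v := by
  induction hP with
  | eq ht hr =>
    obtain ⟨M₁, τ₁, ρ₁, h₁⟩ := ht.exists_numTerm
    obtain ⟨M₂, τ₂, ρ₂, h₂⟩ := hr.exists_numTerm
    refine ⟨M₁ + M₂, 0, .eq (τ₁.rename (Fin.castAdd M₂)) (τ₂.rename (Fin.natAdd M₁)),
      Fin.append ρ₁ ρ₂, Fin.elim0, trivial, fun A v => ?_⟩
    simp [Formula.Realize, NumTerm.val_rename, h₁, h₂]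
  | lt ht hr =>
    obtain ⟨M₁, τ₁, ρ₁, h₁⟩ := ht.exists_numTerm
    obtain ⟨M₂, τ₂, ρ₂, h₂⟩ := hr.exists_numTerm
    refine ⟨M₁ + M₂, 0, .lt (τ₁.rename (Fin.castAdd M₂)) (τ₂.rename (Fin.natAdd M₁)),
      Fin.append ρ₁ ρ₂, Fin.elim0, trivial, fun A v => ?_⟩
    simp [Formula.Realize, NumTerm.val_rename, h₁, h₂]
  | memVar ht j =>
    obtain ⟨M, τ, ρ, h⟩ := ht.exists_numTerm
    exact ⟨M, 1, .mem τ 0, ρ, fun _ => .inl j, trivial, fun A v => by simp [Formula.Realize, h]⟩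
  | memConst ht X hX =>
    obtain ⟨M, τ, ρ, h⟩ := ht.exists_numTerm
    exact ⟨M, 1, .mem τ 0, ρ, fun _ => .inr ⟨X, hX⟩, trivial,
      fun A v => by simp [Formula.Realize, h]⟩
  | not _ ih =>
    obtain ⟨M, K, φ, ρ, κ, hφ, h⟩ := ih
    exact ⟨M, K, .neg φ, ρ, κ, hφ, fun A v => not_congr (h A v)⟩
  | and _ _ ih₁ ih₂ =>
    obtain ⟨M₁, K₁, φ₁, ρ₁, κ₁, hφ₁, h₁⟩ := ih₁
    obtain ⟨M₂, K₂, φ₂, ρ₂, κ₂, hφ₂, h₂⟩ := ih₂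
    refine ⟨M₁ + M₂, K₁ + K₂,
      .and (φ₁.rename (Fin.castAdd M₂) (Fin.castAdd K₂))
        (φ₂.rename (Fin.natAdd M₁) (Fin.natAdd K₁)),
      Fin.append ρ₁ ρ₂, Fin.append κ₁ κ₂, ⟨hφ₁.rename _ _, hφ₂.rename _ _⟩, fun A v => ?_⟩
    simp [Formula.Realize, Formula.realize_rename, h₁, h₂]
  | @allCons m P _ ih =>
    obtain ⟨M, K, φ, ρ, κ, hφ, h⟩ := ih
    -- The variables of `φ` that stand for variable `0` are captured by the new quantifier. Their
    -- old slots stay as dummies, filled with the parameter `0` by `ρ'`.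
    let f : Fin M → Fin (M + 1) :=
      fun i => Sum.elim (Fin.cases 0 fun _ => i.succ) (fun _ => i.succ) (ρ i)
    let ρ' : Fin M → Fin m ⊕ N :=
      fun i => Sum.elim (Fin.cases (.inr 0) .inl) .inr (ρ i)
    refine ⟨M, K, .allNum (φ.rename f id), ρ', κ, hφ.rename f id, fun A v => ?_⟩
    simp only [Formula.Realize, Formula.realize_rename, ← h]
    refine forall_congr' fun x => Eq.to_iff ?_
    congr 1
    funext i
    simp only [f, ρ']
    rcases hρ : ρ i with j | a
    · revert hρ
      refine Fin.cases (fun hρ => ?_) (fun j hρ => ?_) j <;> simp [hρ]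
    · simp [hρ]

theorem Formula.IsArithmetical.ar {C : Set (Set N)} {k m M K : ℕ} {φ : Formula M K}
    (hφ : φ.IsArithmetical) {F : Fin K → (Fin k → Set N) → (Fin m → N) → Set N}
    (hF : ∀ j, ArSet C (F j)) {σ : Fin M → (Fin m → N) → N} (hσ : ∀ i, IsTerm (σ i))
    (S : Set (Set N)) :
    Ar C fun A v => φ.Realize S (fun i => σ i v) fun j => F j A v := by
  have ht : ∀ (M : ℕ) (t : NumTerm M), IsTerm (N := N) (fun v => t.val v) := by
    intro M t
    induction t with
    | var i => exact .var i
    | zero => exact .const 0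
    | one => exact .const 1
    | add t r ih₁ ih₂ => exact .add ih₁ ih₂
    | mul t r ih₁ ih₂ => exact .mul ih₁ ih₂
  have key : Ar C fun (A : Fin K → Set N) (v : Fin M → N) => φ.Realize S v A := by
    clear hF hσ F σ
    induction φ with
    | eq t r => exact .eq (ht _ t) (ht _ r)
    | lt t r => exact .lt (ht _ t) (ht _ r)
    | mem t j => exact .memVar (ht _ t) j
    | neg φ ih => exact .not (ih hφ)
    | and φ ψ ih₁ ih₂ => exact .and (ih₁ hφ.1) (ih₂ hφ.2)
    | allNum φ ih => exact .allCons (ih hφ)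
    | allSet φ => exact hφ.elim
  exact key.rel hF hσ

/-- This is the shape that the comprehension axiom expects: one distinguished variable at index `0`,
everything else a parameter. -/
theorem Ar.exists_formula_of_unary {C : Set (Set N)} {P : N → Prop}
    (hP : Ar C fun (_ : Fin 0 → Set N) (v : Fin 1 → N) => P (v 0)) :
    ∃ (M K : ℕ) (φ : Formula (M + 1) K) (v : Fin M → N) (A : Fin K → Set N), φ.IsArithmetical ∧
      (∀ j, A j ∈ C) ∧ ∀ T x, φ.Realize T (Fin.cons x v : Fin (M + 1) → N) A ↔ P x := by
  obtain ⟨M, K, φ, ρ, κ, hφ, h⟩ := hP.exists_formula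
  let f : Fin M → Fin (M + 1) := fun i => Sum.elim (fun _ => 0) (fun _ => i.succ) (ρ i)
  let v : Fin M → N := fun i => Sum.elim (fun _ => 0) id (ρ i)
  refine ⟨M, K, φ.rename f id, v, fun j => Sum.elim Fin.elim0 Subtype.val (κ j), hφ.rename _ _,
    fun j => ?_, fun T x => ?_⟩
  · show Sum.elim Fin.elim0 Subtype.val (κ j) ∈ C
    rcases κ j with i | X
    · exact i.elim0
    · exact X.2
  · have h' := h Fin.elim0 fun _ => x
    simp only [Formula.realize_rename]
    rw [← h', hφ.realize_iff ∅ T]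
    refine Eq.to_iff ?_
    congr 1
    funext i
    simp only [f, v]
    rcases hρ : ρ i with j | a <;> simp [hρ]

namespace ModelsACA₀

variable {S : Set (Set N)} (hS : ModelsACA₀ S)
include hS

theorem setOf_mem (P : N → Prop) [hP : Ar S fun (_ : Fin 0 → Set N) (v : Fin 1 → N) => P (v 0)] :
    {x | P x} ∈ S := by
  obtain ⟨M, K, φ, v, A, hφ, hA, h⟩ := hP.exists_formula_of_unary
  simpa only [h] using hS.comprehension φ hφ v A hA

theorem ind {P : N → Prop} [Ar S fun (_ : Fin 0 → Set N) (v : Fin 1 → N) => P (v 0)]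
    (zero : P 0) (succ : ∀ n, P n → P (n + 1)) (n : N) : P n :=
  hS.induction {x | P x} (hS.setOf_mem P) zero succ n

end ModelsACA₀

/-- A `Π¹₁`-formula for a relation that is arithmetical in two sets. -/
theorem Ar.exists_uniform_formula {X : Set N} {P : (Fin 1 → Set N) → (Fin 1 → N) → Prop}
    (hP : Ar {X} P) : ∃ (M : ℕ) (θ : Formula (M + 1) 2) (v : Fin M → N), θ.IsArithmetical ∧
      ∀ x Y S, θ.Realize S (Fin.cons x v : Fin (M + 1) → N)
        (Fin.cons Y fun _ => X : Fin 2 → Set N) ↔ P (fun _ => Y) (fun _ => x) := by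
  obtain ⟨M, K, φ, ρ, κ, hφ, h⟩ := hP.exists_formula
  let f : Fin M → Fin (M + 1) := fun i => Sum.elim (fun _ => 0) (fun _ => i.succ) (ρ i)
  let v : Fin M → N := fun i => Sum.elim (fun _ => 0) id (ρ i)
  let g : Fin K → Fin 2 := fun j => Sum.elim (fun _ => 0) (fun _ => 1) (κ j)
  refine ⟨M, φ.rename f g, v, hφ.rename _ _, fun x Y S => ?_⟩
  rw [← h, Formula.realize_rename, hφ.realize_iff S ∅]
  refine Eq.to_iff ?_
  congr 1
  · funext i
    simp only [f, v]
    rcases hρ : ρ i with j | a <;> simp [hρ]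
  · funext j
    simp only [g]
    rcases κ j with j | ⟨Z, hZ⟩
    · simp
    · obtain rfl : Z = X := hZ
      simp

end Extraction

/-! ### Definability of the notions of the theory -/

section Instances

variable {N : Type u} [Zero N] [One N] [Add N] [Mul N] [LT N] {C : Set (Set N)} {k m : ℕ}

/-- A notion is unfolded only once, for bare variables; substitution then gives its definability for
arbitrary terms or sets as arguments. -/
theorem Ar.rel₁ {R : N → Prop} (h : Ar C fun (_ : Fin 0 → Set N) (v : Fin 1 → N) => R (v 0))
    (t : (Fin m → N) → N) [ht : IsTerm t] : Ar C fun (_ : Fin k → Set N) v => R (t v) :=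
  h.rel (F := Fin.elim0) (fun j => j.elim0) (σ := ![t]) (by simp [*])

theorem Ar.rel₂ {R : N → N → Prop}
    (h : Ar C fun (_ : Fin 0 → Set N) (v : Fin 2 → N) => R (v 0) (v 1))
    (t₀ t₁ : (Fin m → N) → N) [h₀ : IsTerm t₀] [h₁ : IsTerm t₁] :
    Ar C fun (_ : Fin k → Set N) v => R (t₀ v) (t₁ v) :=
  h.rel (F := Fin.elim0) (fun j => j.elim0) (σ := ![t₀, t₁]) (by simp [Fin.forall_fin_succ, *])

theorem Ar.rel₃ {R : N → N → N → Prop}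
    (h : Ar C fun (_ : Fin 0 → Set N) (v : Fin 3 → N) => R (v 0) (v 1) (v 2))
    (t₀ t₁ t₂ : (Fin m → N) → N) [h₀ : IsTerm t₀] [h₁ : IsTerm t₁] [h₂ : IsTerm t₂] :
    Ar C fun (_ : Fin k → Set N) v => R (t₀ v) (t₁ v) (t₂ v) :=
  h.rel (F := Fin.elim0) (fun j => j.elim0) (σ := ![t₀, t₁, t₂])
    (by simp [Fin.forall_fin_succ, *])

theorem Ar.set₁ {R : Set N → Prop} (h : Ar C fun (A : Fin 1 → Set N) (_ : Fin 0 → N) => R (A 0))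
    (F : (Fin k → Set N) → (Fin m → N) → Set N) [hF : ArSet C F] : Ar C fun A v => R (F A v) :=
  h.rel (F := ![F]) (by simp [*]) (σ := Fin.elim0) (fun i => i.elim0)

theorem Ar.set₂ {R : Set N → Set N → Prop}
    (h : Ar C fun (A : Fin 2 → Set N) (_ : Fin 0 → N) => R (A 0) (A 1))
    (F₀ F₁ : (Fin k → Set N) → (Fin m → N) → Set N) [h₀ : ArSet C F₀] [h₁ : ArSet C F₁] :
    Ar C fun A v => R (F₀ A v) (F₁ A v) :=
  h.rel (F := ![F₀, F₁]) (by simp [Fin.forall_fin_succ, *]) (σ := Fin.elim0) (fun i => i.elim0)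

variable {s t r i j l p q y : (Fin m → N) → N} {F G H : (Fin k → Set N) → (Fin m → N) → Set N}

instance [IsTerm t] [IsTerm r] : IsTerm fun v => pair (t v) (r v) := by
  unfold pair; infer_instance

instance [IsTerm s] [IsTerm l] : Ar C fun (_ : Fin k → Set N) v => SeqLen (s v) (l v) :=
  Ar.rel₂ (by unfold SeqLen; infer_instance) _ _

instance [IsTerm s] [IsTerm i] [IsTerm y] :
    Ar C fun (_ : Fin k → Set N) v => Entry (s v) (i v) (y v) :=
  Ar.rel₃ (by unfold Entry; infer_instance) _ _ _

instance [IsTerm i] [IsTerm s] [IsTerm t] :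
    Ar C fun (_ : Fin k → Set N) v => Variant (i v) (s v) (t v) :=
  Ar.rel₃ (by unfold Variant; infer_instance) _ _ _

instance [ArSet C F] : Ar C fun A v => IsFunction (F A v) :=
  Ar.set₁ (R := IsFunction) (by unfold IsFunction; infer_instance) _

instance [ArSet C F] [ArSet C G] : Ar C fun A v => IsBranch (F A v) (G A v) :=
  Ar.set₂ (R := IsBranch) (by unfold IsBranch; infer_instance) _ _

instance [h : IsTerm t] [hF : ArSet C F] : ArSet C fun A v => sect (F A v) (t v) := by
  have h₁ := h.rename Fin.succ
  have : ArSet C fun A (w : Fin (m + 1) → N) => F A fun i => w i.succ := ⟨by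
    have := hF.ar.rename (m' := m + 2) (Fin.cons 0 fun i => i.succ.succ)
    simpa using this⟩
  exact ⟨Ar.mem (F := fun A w => F A fun i => w i.succ)
    (t := fun w => pair (w 0) (t fun i => w i.succ))⟩

instance [hF : ArSet C F] [hG : ArSet C G] : ArSet C fun A v => join (F A v) (G A v) := by
  have h₁ : ArSet C fun A (w : Fin (m + 2) → N) => F A fun i => w i.succ.succ := ⟨by
    have := hF.ar.rename (m' := m + 3) (Fin.cons 0 fun i => i.succ.succ.succ)
    simpa using this⟩
  have h₂ : ArSet C fun A (w : Fin (m + 2) → N) => G A fun i => w i.succ.succ := ⟨by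
    have := hG.ar.rename (m' := m + 3) (Fin.cons 0 fun i => i.succ.succ.succ)
    simpa using this⟩
  have h : Ar C fun A (w : Fin (m + 1) → N) =>
      (∃ x, x ∈ (F A fun i => w i.succ) ∧ w 0 = x + x) ∨
        ∃ x, x ∈ (G A fun i => w i.succ) ∧ w 0 = x + x + 1 := by infer_instance
  exact ⟨h⟩

instance {n : ℕ} : IsTerm fun _ : Fin m → N => (numeral n : N) := .const _

instance [IsTerm i] [IsTerm j] : IsTerm fun v => eqCode (i v) (j v) := by
  unfold eqCode; infer_instance

instance [IsTerm i] [IsTerm j] : IsTerm fun v => ltCode (i v) (j v) := by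
  unfold ltCode; infer_instance

instance [IsTerm i] [IsTerm j] [IsTerm l] : IsTerm fun v => addCode (i v) (j v) (l v) := by
  unfold addCode; infer_instance

instance [IsTerm i] [IsTerm j] [IsTerm l] : IsTerm fun v => mulCode (i v) (j v) (l v) := by
  unfold mulCode; infer_instance

instance [IsTerm i] : IsTerm fun v => memCode (i v) := by
  unfold memCode; infer_instance

instance [IsTerm p] : IsTerm fun v => negCode (p v) := by
  unfold negCode; infer_instance

instance [IsTerm p] [IsTerm q] : IsTerm fun v => andCode (p v) (q v) := by
  unfold andCode; infer_instance

instance [IsTerm i] [IsTerm p] : IsTerm fun v => allCode (i v) (p v) := by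
  unfold allCode; infer_instance

end Instances

/-! ### Arithmetic in models of `ACA₀` -/

namespace ModelsACA₀

section Bare

variable {N : Type u} [Zero N] [One N] [Add N] [Mul N] [LT N] {S : Set (Set N)}
  (hS : ModelsACA₀ S)
include hS

theorem zero_add (a : N) : 0 + a = a :=
  hS.ind (P := fun a => 0 + a = a) (hS.add_zero 0) (fun n h => by rw [hS.add_succ, h]) a

theorem add_assoc (a b c : N) : a + b + c = a + (b + c) :=
  hS.ind (P := fun c => a + b + c = a + (b + c)) (by simp only [hS.add_zero])
    (fun n h => by simp only [hS.add_succ, h]) c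

theorem add_one_comm (a : N) : a + 1 = 1 + a :=
  hS.ind (P := fun a => a + 1 = 1 + a) (by rw [hS.zero_add, hS.add_zero])
    (fun n h => by rw [hS.add_succ, ← h]) a

theorem add_comm (a b : N) : a + b = b + a :=
  hS.ind (P := fun b => a + b = b + a) (by rw [hS.zero_add, hS.add_zero])
    (fun n h => by rw [hS.add_succ, h, hS.add_assoc, hS.add_one_comm, ← hS.add_assoc]) b

theorem zero_mul (a : N) : 0 * a = 0 :=
  hS.ind (P := fun a => 0 * a = 0) (hS.mul_zero 0)
    (fun n h => by rw [hS.mul_succ, h, hS.add_zero]) a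

theorem mul_one (a : N) : a * 1 = a := by
  rw [← hS.zero_add 1, hS.mul_succ, hS.mul_zero, hS.zero_add]

theorem left_distrib (a b c : N) : a * (b + c) = a * b + a * c :=
  hS.ind (P := fun c => a * (b + c) = a * b + a * c) (by simp only [hS.add_zero, hS.mul_zero])
    (fun n h => by rw [hS.add_succ, hS.mul_succ, hS.mul_succ, h, hS.add_assoc]) c

theorem succ_mul (a b : N) : (a + 1) * b = a * b + b :=
  hS.ind (P := fun b => (a + 1) * b = a * b + b) (by simp only [hS.mul_zero, hS.add_zero])
    (fun n h => by
      rw [hS.mul_succ, hS.mul_succ, h, hS.add_assoc, hS.add_assoc, hS.add_succ n, hS.add_comm n a,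
        ← hS.add_succ a]) b

theorem mul_comm (a b : N) : a * b = b * a :=
  hS.ind (P := fun b => a * b = b * a) (by rw [hS.zero_mul, hS.mul_zero])
    (fun n h => by rw [hS.mul_succ, hS.succ_mul, h]) b

theorem mul_assoc (a b c : N) : a * b * c = a * (b * c) :=
  hS.ind (P := fun c => a * b * c = a * (b * c)) (by simp only [hS.mul_zero])
    (fun n h => by rw [hS.mul_succ, hS.mul_succ, h, hS.left_distrib]) c

theorem add_right_cancel (a b c : N) : a + c = b + c → a = b :=
  hS.ind (P := fun c => a + c = b + c → a = b) (by simp only [hS.add_zero, imp_self])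
    (fun n h e => h (hS.add_one_inj _ _ (by rwa [hS.add_succ, hS.add_succ] at e))) c

theorem lt_iff_exists (a b : N) : a < b ↔ ∃ c, b = a + c + 1 := by
  refine hS.ind (P := fun b => a < b ↔ ∃ c, b = a + c + 1) ?_ (fun n h => ?_) b
  · simpa [hS.not_lt_zero] using fun c h => hS.add_one_ne_zero _ h.symm
  · rw [hS.lt_succ, h]
    constructor
    · rintro (⟨c, rfl⟩ | rfl)
      · exact ⟨c + 1, by rw [hS.add_succ]⟩
      · exact ⟨0, by rw [hS.add_zero]⟩
    · rintro ⟨c, e⟩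
      obtain rfl := hS.add_one_inj _ _ e
      refine hS.ind (P := fun c => (∃ d, a + c = a + d + 1) ∨ a = a + c) ?_ (fun d _ => ?_) c
      · exact Or.inr (hS.add_zero a).symm
      · exact Or.inl ⟨d, by rw [hS.add_succ]⟩

theorem lt_trichotomy (a b : N) : a < b ∨ a = b ∨ b < a := by
  refine hS.ind (P := fun a => a < b ∨ a = b ∨ b < a) ?_ (fun n h => ?_) a
  · refine hS.ind (P := fun b => (0 : N) < b ∨ 0 = b ∨ b < 0) (by simp) (fun n h => ?_) b
    simp only [hS.lt_succ]
    have := hS.not_lt_zero n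
    tauto
  · rcases h with h | rfl | h
    · obtain ⟨c, rfl⟩ := (hS.lt_iff_exists _ _).1 h
      rcases hS.ind (P := fun c => c = 0 ∨ ∃ d, c = d + 1) (by simp)
        (fun n _ => .inr ⟨n, rfl⟩) c with rfl | ⟨d, rfl⟩
      · simp [hS.add_zero]
      · refine .inl ((hS.lt_iff_exists _ _).2 ⟨d, ?_⟩)
        rw [hS.add_succ, hS.add_assoc n 1 d, ← hS.add_one_comm, hS.add_succ]
    · exact .inr (.inr ((hS.lt_succ _ _).2 (.inr rfl)))
    · exact .inr (.inr ((hS.lt_succ _ _).2 (.inl h)))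

theorem lt_irrefl (a : N) : ¬ a < a := by
  rw [hS.lt_iff_exists]
  rintro ⟨c, h⟩
  rw [hS.add_assoc] at h
  nth_rewrite 1 [← hS.add_zero a] at h
  rw [hS.add_comm a, hS.add_comm a] at h
  exact hS.add_one_ne_zero _ (hS.add_right_cancel _ _ _ h).symm

theorem lt_trans {a b c : N} : a < b → b < c → a < c := by
  simp only [hS.lt_iff_exists]
  rintro ⟨d, rfl⟩ ⟨e, rfl⟩
  refine ⟨d + 1 + e, ?_⟩
  simp only [hS.add_assoc]

/-- The first-order part of a model of `ACA₀` is a commutative semiring. -/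
@[reducible] def commSemiring : CommSemiring N where
  add := (· + ·)
  zero := 0
  mul := (· * ·)
  one := 1
  add_assoc := hS.add_assoc
  zero_add := hS.zero_add
  add_zero := hS.add_zero
  add_comm := hS.add_comm
  left_distrib := hS.left_distrib
  right_distrib a b c := by
    rw [hS.mul_comm, hS.left_distrib, hS.mul_comm c a, hS.mul_comm c b]
  zero_mul := hS.zero_mul
  mul_zero := hS.mul_zero
  mul_assoc := hS.mul_assoc
  one_mul a := by rw [hS.mul_comm, hS.mul_one]
  mul_one := hS.mul_one
  mul_comm := hS.mul_comm
  nsmul := nsmulRec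
  npow := npowRec

/-- The order of the first-order part of a model of `ACA₀`. -/
@[reducible] noncomputable def linearOrder : LinearOrder N where
  lt a b := a < b
  le a b := a < b ∨ a = b
  le_refl a := .inr rfl
  le_trans a b c := by
    rintro (h | rfl) (h' | rfl)
    · exact .inl (hS.lt_trans h h')
    · exact .inl h
    · exact .inl h'
    · exact .inr rfl
  lt_iff_le_not_ge a b := by
    constructor
    · rintro h
      refine ⟨.inl h, ?_⟩
      rintro (h' | rfl)
      · exact hS.lt_irrefl _ (hS.lt_trans h h')
      · exact hS.lt_irrefl _ h
    · rintro ⟨h | rfl, h'⟩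
      · exact h
      · exact (h' (.inr rfl)).elim
  le_antisymm a b := by
    rintro (h | rfl) (h' | h')
    · exact (hS.lt_irrefl _ (hS.lt_trans h h')).elim
    · exact h'.symm
    · rfl
    · rfl
  le_total a b := by
    rcases hS.lt_trichotomy a b with h | rfl | h
    · exact .inl (.inl h)
    · exact .inl (.inr rfl)
    · exact .inr (.inl h)
  toDecidableLE := Classical.decRel _

end Bare

end ModelsACA₀

/-! ### Compatibility of the order with the semiring structure -/

section Ordered

variable {N : Type u} [CommSemiring N] [LinearOrder N] {S : Set (Set N)}

theorem ModelsACA₀.canonicallyOrderedAdd (hS : ModelsACA₀ S) : CanonicallyOrderedAdd N where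
  exists_add_of_le {a b} h := by
    rcases h.lt_or_eq with h | rfl
    · obtain ⟨c, rfl⟩ := (hS.lt_iff_exists _ _).1 h
      exact ⟨c + 1, by ring⟩
    · exact ⟨0, by simp⟩
  le_add_self a b := by
    refine hS.ind (P := fun b => a < b + a ∨ a = b + a) (by simp) (fun n h => ?_) b
      |>.elim le_of_lt le_of_eq
    rw [show n + 1 + a = n + a + 1 by ring, hS.lt_succ]
    exact .inl h
  le_self_add a b := by
    refine hS.ind (P := fun b => a < a + b ∨ a = a + b) (by simp) (fun n h => ?_) b
      |>.elim le_of_lt le_of_eq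
    rw [show a + (n + 1) = a + n + 1 by ring, hS.lt_succ]
    exact .inl h

theorem ModelsACA₀.isStrictOrderedRing (hS : ModelsACA₀ S) : IsStrictOrderedRing N where
  add_le_add_left a b h c := by
    rcases h.lt_or_eq with h | rfl
    · obtain ⟨d, rfl⟩ := (hS.lt_iff_exists _ _).1 h
      exact le_of_lt ((hS.lt_iff_exists _ _).2 ⟨d, by ring⟩)
    · exact le_rfl
  le_of_add_le_add_left a b c h := by
    rcases h.lt_or_eq with h | h
    · obtain ⟨d, h⟩ := (hS.lt_iff_exists _ _).1 h
      refine le_of_lt ((hS.lt_iff_exists _ _).2 ⟨d, hS.add_right_cancel _ _ a ?_⟩)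
      calc c + a = a + c := by ring
        _ = a + b + d + 1 := h
        _ = b + d + 1 + a := by ring
    · refine le_of_eq (hS.add_right_cancel _ _ a ?_)
      rw [_root_.add_comm b, h, _root_.add_comm]
  zero_le_one := le_of_lt ((hS.lt_iff_exists _ _).2 ⟨0, by ring⟩)
  exists_pair_ne := ⟨0, 1, fun h => hS.add_one_ne_zero 0 (by rw [_root_.zero_add, ← h])⟩
  mul_lt_mul_of_pos_left a ha b c h := by
    obtain ⟨e, rfl⟩ := (hS.lt_iff_exists _ _).1 ha
    obtain ⟨d, rfl⟩ := (hS.lt_iff_exists _ _).1 h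
    exact (hS.lt_iff_exists _ _).2 ⟨e * d + e + d, by ring⟩
  mul_lt_mul_of_pos_right a ha b c h := by
    obtain ⟨e, rfl⟩ := (hS.lt_iff_exists _ _).1 ha
    obtain ⟨d, rfl⟩ := (hS.lt_iff_exists _ _).1 h
    exact (hS.lt_iff_exists _ _).2 ⟨e * d + e + d, by ring⟩

end Ordered

/-! ### Pairing and the coding of finite sequences -/

section Sequences

variable {N : Type u} [CommSemiring N] [LinearOrder N] [IsStrictOrderedRing N]
  [CanonicallyOrderedAdd N]

instance Ar.le {C : Set (Set N)} {k m : ℕ} {t r : (Fin m → N) → N} [IsTerm t] [IsTerm r] :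
    Ar C fun (_ : Fin k → Set N) v => t v ≤ r v := by
  simp only [le_iff_lt_or_eq]
  infer_instance

/-- The offset `a ≤ a + b` is smaller than the gap between consecutive squares, so pairs are ordered
by their sums first. -/
theorem pair_lt_pair {a b c d : N} (h : a + b + 1 ≤ c + d) : pair a b < pair c d := by
  obtain ⟨e, he⟩ := exists_add_of_le h
  have : pair a b + 1 ≤ pair c d := by
    unfold pair
    rw [he]
    have h₁ : (a + b + 1 + e) * (a + b + 1 + e) + c =
      (a + b) * (a + b) + a + 1 + (a + b + b + (2 * e * (a + b) + 2 * e + e * e) + c) := by ring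
    rw [h₁]
    exact le_self_add
  exact lt_of_lt_of_le (lt_add_one _) this

variable {S : Set (Set N)} (hS : ModelsACA₀ S)
include hS

theorem lt_add_one_iff_le {a b : N} : a < b + 1 ↔ a ≤ b := by
  rw [hS.lt_succ, le_iff_lt_or_eq]

theorem add_one_le_iff_lt {a b : N} : a + 1 ≤ b ↔ a < b := by
  rw [← not_lt, lt_add_one_iff_le hS, not_le]

theorem eq_zero_or_eq_add_one (a : N) : a = 0 ∨ ∃ b, a = b + 1 :=
  hS.ind (P := fun a => a = 0 ∨ ∃ b, a = b + 1) (.inl rfl) (fun n _ => .inr ⟨n, rfl⟩) a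

theorem strong_ind {P : N → Prop} [h : Ar S fun (_ : Fin 0 → Set N) (v : Fin 1 → N) => P (v 0)]
    (step : ∀ n, (∀ i < n, P i) → P n) (n : N) : P n := by
  have := fun m (t : (Fin m → N) → N) [IsTerm t] => Ar.rel₁ (k := 0) h t
  refine step n (hS.ind (P := fun n => ∀ i < n, P i) (fun i hi => (hS.not_lt_zero i hi).elim) ?_ n)
  intro n h i hi
  rcases (hS.lt_succ i n).1 hi with hi | rfl
  · exact h i hi
  · exact step i h

theorem exists_least {P : N → Prop} [h : Ar S fun (_ : Fin 0 → Set N) (v : Fin 1 → N) => P (v 0)]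
    {n : N} (hn : P n) : ∃ m, P m ∧ ∀ i < m, ¬ P i := by
  by_contra! h
  refine strong_ind hS (P := fun n => ¬ P n) (fun n hlt hPn => ?_) n hn
  obtain ⟨i, hi, hPi⟩ := h n hPn
  exact hlt i hi hPi

/-! #### Pairs -/

theorem pair_inj {a b c d : N} : pair a b = pair c d ↔ a = c ∧ b = d := by
  refine ⟨fun h => ?_, fun h => by rw [h.1, h.2]⟩
  rcases lt_trichotomy (a + b) (c + d) with h' | h' | h'
  · exact absurd h (pair_lt_pair ((add_one_le_iff_lt hS).2 h')).ne
  · unfold pair at h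
    rw [h'] at h
    obtain rfl := add_left_cancel h
    exact ⟨rfl, add_left_cancel h'⟩
  · exact absurd h (pair_lt_pair ((add_one_le_iff_lt hS).2 h')).ne'

theorem pair_lt_pair_right {a b c : N} (h : b < c) : pair a b < pair a c := by
  apply pair_lt_pair
  have := (add_one_le_iff_lt hS).2 h
  grind

theorem add_le_pair (a b : N) : a + b ≤ pair a b := by
  unfold pair
  rcases eq_zero_or_eq_add_one hS (a + b) with h | ⟨c, h⟩
  · rw [h]; exact zero_le
  · rw [h, show (c + 1) * (c + 1) + a = c + 1 + (c * (c + 1) + a) by ring]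
    exact le_self_add

theorem le_pair_right (a b : N) : b ≤ pair a b := le_add_self.trans (add_le_pair hS a b)

theorem le_pair_left (a b : N) : a ≤ pair a b := le_self_add.trans (add_le_pair hS a b)

theorem lt_pair_right {a : N} (b : N) (ha : 0 < a) : b < pair a b :=
  lt_of_lt_of_le (lt_add_of_pos_left b ha) (add_le_pair hS a b)

/-! #### Division and the β-function -/

theorem exists_div_mod (c : N) {m : N} (hm : 0 < m) : ∃ q y, y < m ∧ c = q * m + y := by
  refine hS.ind (P := fun c => ∃ q y, y < m ∧ c = q * m + y) ⟨0, 0, hm, by ring⟩ ?_ c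
  rintro c ⟨q, y, hy, rfl⟩
  rcases ((add_one_le_iff_lt hS).2 hy).lt_or_eq with h | h
  · exact ⟨q, y + 1, h, by ring⟩
  · exact ⟨q + 1, 0, hm, by rw [add_assoc, h]; ring⟩

theorem mod_unique {m q y q' y' : N} (hy : y < m) (hy' : y' < m) (h : q * m + y = q' * m + y') :
    y = y' := by
  have key : ∀ {q y q' y' : N}, y < m → q * m + y = q' * m + y' → ¬ q < q' := by
    intro q y q' y' hy h hq
    obtain ⟨e, rfl⟩ := (hS.lt_iff_exists _ _).1 hq
    have h' : y = e * m + m + y' := by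
      apply add_left_cancel (a := q * m)
      rw [h]; ring
    have : m ≤ y := by
      rw [h', add_assoc, add_left_comm]; exact le_self_add
    exact absurd hy this.not_gt
  have : q = q' := le_antisymm (not_lt.1 (key hy' h.symm)) (not_lt.1 (key hy h))
  subst this
  exact add_left_cancel h

/-- Invertibility of each number modulo the other expresses coprimality. If `a u = b v + 1`, then `b
v (a - 1) = (a u - 1)(a - 1) = a (u (a - 1) - 1) + 1`. To avoid subtraction, the case where `u (a -
1)` vanishes is treated separately. -/
theorem inverse_symm {a b : N} (hb : 0 < b) (h : ∃ u v, a * u = b * v + 1) :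
    ∃ u v, b * u = a * v + 1 := by
  obtain ⟨u, v, h⟩ := h
  rcases eq_zero_or_eq_add_one hS b with rfl | ⟨b, rfl⟩
  · exact absurd hb (lt_irrefl _)
  rcases eq_zero_or_eq_add_one hS a with rfl | ⟨a, rfl⟩
  · rw [zero_mul] at h
    exact absurd h.symm (hS.add_one_ne_zero _)
  rcases eq_zero_or_eq_add_one hS (u * a) with hu | ⟨w, hw⟩
  · rcases eq_zero_or_eq_add_one hS a with rfl | ⟨a, rfl⟩
    · exact ⟨1, b, by ring⟩
    · rcases mul_eq_zero.1 hu with rfl | hu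
      · rw [mul_zero] at h
        exact absurd h.symm (hS.add_one_ne_zero _)
      · exact absurd hu (hS.add_one_ne_zero _)
  · refine ⟨v * a, w, ?_⟩
    apply add_right_cancel (b := a)
    calc (b + 1) * (v * a) + a = ((b + 1) * v + 1) * a := by ring
      _ = (a + 1) * (u * a) := by rw [← h]; ring
      _ = (a + 1) * w + 1 + a := by rw [hw]; ring

theorem inverse_modulus {d i j : N} (hd : 0 < d) (hij : i < j)
    (hdvd : ∀ k, k < j → ∃ e, (k + 1) * e = d) :
    ∃ u v, ((i + 1) * d + 1) * u = ((j + 1) * d + 1) * v + 1 := by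
  refine inverse_symm hS (add_pos_of_nonneg_of_pos zero_le one_pos) ?_
  obtain ⟨k, rfl⟩ := (hS.lt_iff_exists _ _).1 hij
  obtain ⟨e, he⟩ := hdvd k (lt_of_le_of_lt le_add_self (lt_add_one _))
  rcases eq_zero_or_eq_add_one hS ((i + 1) * d) with h | ⟨w, hw⟩
  · rcases mul_eq_zero.1 h with h | h
    · exact absurd h (hS.add_one_ne_zero _)
    · exact absurd h hd.ne'
  -- Modulo `(i + 1) * d + 1` the larger modulus is `(k + 1) * d`. As `(k + 1) * e = d`, multiplying
  -- it by `e * (i + 1)²` gives `((i + 1) * d)²`, which is `(-1)² = 1`.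
  · refine ⟨e * (i + 1) * (i + 1), e * (i + 1) * (i + 1) + w, ?_⟩
    have h₁ : (i + 1) * d * ((i + 1) * d) = ((i + 1) * d + 1) * w + 1 := by
      rw [hw]; ring
    calc ((i + k + 1 + 1) * d + 1) * (e * (i + 1) * (i + 1))
        = ((i + 1) * d + 1) * (e * (i + 1) * (i + 1)) + (k + 1) * e * (i + 1) * d * (i + 1) := by
          ring
      _ = ((i + 1) * d + 1) * (e * (i + 1) * (i + 1)) + (i + 1) * d * ((i + 1) * d) := by
          rw [he]; ring
      _ = _ := by rw [h₁]; ring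

/-- A positive number that is divisible by `1, …, l` and larger than `b`. -/
theorem exists_common_multiple (l b : N) :
    ∃ d, b < d ∧ ∀ k, k < l → ∃ e, (k + 1) * e = d := by
  refine hS.ind (P := fun l => ∃ d, b < d ∧ ∀ k, k < l → ∃ e, (k + 1) * e = d)
    ⟨b + 1, lt_add_one _, fun k hk => (hS.not_lt_zero k hk).elim⟩ ?_ l
  rintro l ⟨d, hd, h⟩
  refine ⟨(l + 1) * d, hd.trans_le ?_, fun k hk => ?_⟩
  · rw [add_mul, one_mul]; exact le_add_self
  · rcases (hS.lt_succ _ _).1 hk with hk | rfl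
    · obtain ⟨e, rfl⟩ := h k hk
      exact ⟨(l + 1) * e, by ring⟩
    · exact ⟨d, rfl⟩

/-- The Chinese remainder theorem for the moduli of the β-function. -/
theorem exists_beta {R : N → N → Prop}
    [hR : Ar S fun (_ : Fin 0 → Set N) (v : Fin 2 → N) => R (v 0) (v 1)] {l : N}
    (h : ∀ i < l, ∃ y, R i y) :
    ∃ c d, ∀ i < l, ∃ y q, R i y ∧ y < (i + 1) * d + 1 ∧ c = q * ((i + 1) * d + 1) + y := by
  have := fun m (t r : (Fin m → N) → N) [IsTerm t] [IsTerm r] => Ar.rel₂ (k := 0) hR t r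
  -- A remainder stays below its modulus, so the values need a common bound before `d` is chosen.
  obtain ⟨b, hb⟩ : ∃ b, ∀ i < l, ∃ y ≤ b, R i y := by
    have : ∀ n, n ≤ l → ∃ b, ∀ i < n, ∃ y ≤ b, R i y := by
      refine hS.ind (P := fun n => n ≤ l → ∃ b, ∀ i < n, ∃ y ≤ b, R i y) ?_ fun n ih hn => ?_
      · exact fun _ => ⟨0, fun i hi => (hS.not_lt_zero i hi).elim⟩
      · rw [add_one_le_iff_lt hS] at hn
        obtain ⟨b, hb⟩ := ih hn.le
        obtain ⟨y, hy⟩ := h n hn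
        refine ⟨b + y, fun i hi => ?_⟩
        rcases (hS.lt_succ _ _).1 hi with hi | rfl
        · obtain ⟨z, hz, hR⟩ := hb i hi
          exact ⟨z, hz.trans le_self_add, hR⟩
        · exact ⟨y, le_add_self, hy⟩
    exact this l le_rfl
  obtain ⟨d, hd, hdvd⟩ := exists_common_multiple hS l b
  have hd₀ : 0 < d := lt_of_le_of_lt zero_le hd
  -- Induction on the number of congruences solved: `M` is a common multiple of the first `n` moduli
  -- and stays invertible modulo the later ones.
  have key : ∀ n, n ≤ l → ∃ c M, (∀ i < n, ∃ y ≤ b, R i y ∧ ∃ q, c = q * ((i + 1) * d + 1) + y) ∧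
      (∀ i < n, ∃ e, M = e * ((i + 1) * d + 1)) ∧
      ∀ j, n ≤ j → j < l → ∃ u v, M * u = ((j + 1) * d + 1) * v + 1 := by
    refine hS.ind (P := fun n => n ≤ l → ∃ c M,
      (∀ i < n, ∃ y ≤ b, R i y ∧ ∃ q, c = q * ((i + 1) * d + 1) + y) ∧
      (∀ i < n, ∃ e, M = e * ((i + 1) * d + 1)) ∧
      ∀ j, n ≤ j → j < l → ∃ u v, M * u = ((j + 1) * d + 1) * v + 1) ?_ fun n ih hn => ?_
    · exact fun _ => ⟨0, 1, fun i hi => (hS.not_lt_zero i hi).elim,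
        fun i hi => (hS.not_lt_zero i hi).elim, fun j _ _ => ⟨1, 0, by ring⟩⟩
    · rw [add_one_le_iff_lt hS] at hn
      obtain ⟨c, M, hc, hM, hinv⟩ := ih hn.le
      obtain ⟨y, hy, hRy⟩ := hb n hn
      obtain ⟨u, v, huv⟩ := hinv n le_rfl hn
      -- Modulo the new modulus, `M * u` is `1` and `(n + 1) * d` is `-1`, so the added term is `y -
      -- c`. Modulo the earlier moduli it vanishes with `M`.
      refine ⟨c + M * u * (y + (n + 1) * d * c), M * ((n + 1) * d + 1), fun i hi => ?_,
        fun i hi => ?_, fun j hj hjl => ?_⟩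
      · rcases (hS.lt_succ _ _).1 hi with hi | rfl
        · obtain ⟨z, hz, hRz, q, hq⟩ := hc i hi
          obtain ⟨e, he⟩ := hM i hi
          refine ⟨z, hz, hRz, q + e * u * (y + (n + 1) * d * c), ?_⟩
          nth_rewrite 1 [hq]
          rw [he]
          ring
        · refine ⟨y, hy, hRy, c + v * (y + (i + 1) * d * c), ?_⟩
          rw [huv]
          ring
      · rcases (hS.lt_succ _ _).1 hi with hi | rfl
        · obtain ⟨e, rfl⟩ := hM i hi
          exact ⟨e * ((n + 1) * d + 1), by ring⟩
        · exact ⟨M, rfl⟩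
      · rw [add_one_le_iff_lt hS] at hj
        obtain ⟨u₁, v₁, h₁⟩ := hinv j hj.le hjl
        obtain ⟨u₂, v₂, h₂⟩ := inverse_modulus hS hd₀ hj fun k hk => hdvd k (hk.trans hjl)
        refine ⟨u₁ * u₂, v₁ * (((j + 1) * d + 1) * v₂ + 1) + v₂, ?_⟩
        calc M * ((n + 1) * d + 1) * (u₁ * u₂) = M * u₁ * (((n + 1) * d + 1) * u₂) := by ring
          _ = _ := by rw [h₁, h₂]; ring
  obtain ⟨c, M, hc, -⟩ := key l le_rfl
  refine ⟨c, d, fun i hi => ?_⟩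
  obtain ⟨y, hy, hRy, q, hq⟩ := hc i hi
  refine ⟨y, q, hRy, (hy.trans_lt hd).trans_le ?_, hq⟩
  rw [show (i + 1) * d + 1 = d + (i * d + 1) by ring]
  exact le_self_add

/-! #### Finite sequences -/

theorem seqLen_pair {l l' c d : N} : SeqLen (pair l (pair c d)) l' ↔ l = l' := by
  refine ⟨fun ⟨c', d', h⟩ => ((pair_inj hS).1 h).1, ?_⟩
  rintro rfl
  exact ⟨c, d, rfl⟩

theorem SeqLen.unique {s l l' : N} (h : SeqLen s l) (h' : SeqLen s l') : l = l' := by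
  obtain ⟨c, d, rfl⟩ := h
  exact (seqLen_pair hS).1 h'

theorem entry_pair {l c d i y : N} : Entry (pair l (pair c d)) i y ↔
    i < l ∧ y < (i + 1) * d + 1 ∧ ∃ q, c = q * ((i + 1) * d + 1) + y := by
  constructor
  · rintro ⟨l', c', d', q, e, hi, hy, h⟩
    obtain ⟨rfl, e₂⟩ := (pair_inj hS).1 e
    obtain ⟨rfl, rfl⟩ := (pair_inj hS).1 e₂
    exact ⟨hi, hy, q, h⟩
  · rintro ⟨hi, hy, q, h⟩
    exact ⟨l, c, d, q, rfl, hi, hy, h⟩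

theorem Entry.unique {s i y y' : N} (h : Entry s i y) (h' : Entry s i y') : y = y' := by
  obtain ⟨l, c, d, q, rfl, hi, hy, rfl⟩ := h
  obtain ⟨-, hy', q', h'⟩ := (entry_pair hS).1 h'
  exact mod_unique hS hy hy' h'

theorem Entry.lt {s l i y : N} (h : Entry s i y) (hl : SeqLen s l) : i < l := by
  obtain ⟨c, d, rfl⟩ := hl
  exact ((entry_pair hS).1 h).1

theorem exists_entry {s l i : N} (hl : SeqLen s l) (hi : i < l) : ∃ y, Entry s i y := by
  obtain ⟨c, d, rfl⟩ := hl
  obtain ⟨q, y, hy, h⟩ := exists_div_mod hS c (m := (i + 1) * d + 1)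
    (add_pos_of_nonneg_of_pos zero_le one_pos)
  exact ⟨y, (entry_pair hS).2 ⟨hi, hy, q, h⟩⟩

/-- Every arithmetical function on an initial segment is coded by a finite sequence. -/
theorem exists_seq (R : N → N → Prop)
    [hR : Ar S fun (_ : Fin 0 → Set N) (v : Fin 2 → N) => R (v 0) (v 1)] {l : N}
    (h : ∀ i < l, ∃ y, R i y) (hu : ∀ i < l, ∀ y y', R i y → R i y' → y = y') :
    ∃ s, SeqLen s l ∧ ∀ i y, Entry s i y ↔ i < l ∧ R i y := by
  obtain ⟨c, d, hcd⟩ := exists_beta hS h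
  refine ⟨pair l (pair c d), ⟨c, d, rfl⟩, fun i y => ?_⟩
  have key : ∀ i < l, ∃ y, R i y ∧ Entry (pair l (pair c d)) i y := fun i hi => by
    obtain ⟨y, q, hRy, hy, hq⟩ := hcd i hi
    exact ⟨y, hRy, (entry_pair hS).2 ⟨hi, hy, q, hq⟩⟩
  constructor
  · intro hy
    have hi := hy.lt hS ⟨c, d, rfl⟩
    obtain ⟨z, hz, hz'⟩ := key i hi
    obtain rfl := hy.unique hS hz'
    exact ⟨hi, hz⟩
  · rintro ⟨hi, hy⟩
    obtain ⟨z, hz, hz'⟩ := key i hi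
    obtain rfl := hu i hi _ _ hy hz
    exact hz'

theorem exists_seq_of_isFunction {F : Set N} (hF : F ∈ S) (h : IsFunction F) (l : N) :
    ∃ s, SeqLen s l ∧ ∀ i y, Entry s i y ↔ i < l ∧ pair i y ∈ F := by
  have := Fact.mk hF
  exact exists_seq hS (fun i y => pair i y ∈ F) (fun i _ => (h i).exists)
    fun i _ y y' h₁ h₂ => (h i).unique h₁ h₂

theorem exists_seq_const (l : N) : ∃ s, SeqLen s l := by
  obtain ⟨s, hs, -⟩ := exists_seq hS (fun _ y => y = 0) (l := l) (fun _ _ => ⟨0, rfl⟩)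
    (fun _ _ y y' h h' => by rw [h, h'])
  exact ⟨s, hs⟩

theorem exists_variant {s l i : N} (hs : SeqLen s l) (hi : i < l) (x : N) :
    ∃ t, Variant i s t ∧ Entry t i x := by
  obtain ⟨t, ht, h⟩ := exists_seq hS (fun j y => (j = i ∧ y = x) ∨ (j ≠ i ∧ Entry s j y)) (l := l)
    (fun j hj => by
      by_cases h : j = i
      · exact ⟨x, .inl ⟨h, rfl⟩⟩
      · obtain ⟨y, hy⟩ := exists_entry hS hs hj
        exact ⟨y, .inr ⟨h, hy⟩⟩)
    (fun j hj y y' => by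
      rintro (⟨h₁, rfl⟩ | ⟨h₁, h₂⟩) (⟨h₃, rfl⟩ | ⟨h₃, h₄⟩)
      · rfl
      · exact (h₃ h₁).elim
      · exact (h₁ h₃).elim
      · exact h₂.unique hS h₄)
  refine ⟨t, ⟨⟨l, hs, ht⟩, fun j hj y => ?_⟩, (h i x).2 ⟨hi, .inl ⟨rfl, rfl⟩⟩⟩
  rw [h]
  constructor
  · exact fun h' => ⟨h'.lt hS hs, .inr ⟨hj, h'⟩⟩
  · rintro ⟨-, ⟨h', -⟩ | ⟨-, h'⟩⟩
    · exact (hj h').elim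
    · exact h'

end Sequences

/-! ### Valuations -/

section Defs

variable {N : Type u} [Zero N] [One N] [Add N] [Mul N] [LT N]

/-- `p` is the code of a formula whose immediate subformulas are in `D`. -/
def Shape (D : Set N) (p : N) : Prop :=
  (∃ i j, p = eqCode i j) ∨ (∃ i j, p = ltCode i j) ∨
    (∃ i j k, p = addCode i j k) ∨ (∃ i j k, p = mulCode i j k) ∨ (∃ i, p = memCode i) ∨
    (∃ q ∈ D, p = negCode q) ∨ (∃ q ∈ D, ∃ r ∈ D, p = andCode q r) ∨
    (∃ i, ∃ q ∈ D, p = allCode i q)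

/-- The truth value that Tarski's clauses assign to `p` under `s`, if `V` gives the truth values
of the immediate subformulas of `p`. -/
def Tarski (Z V : Set N) (p s : N) : Prop :=
  (∃ i j, p = eqCode i j ∧ ∃ a, Entry s i a ∧ Entry s j a) ∨
  (∃ i j, p = ltCode i j ∧ ∃ a b, Entry s i a ∧ Entry s j b ∧ a < b) ∨
  (∃ i j k, p = addCode i j k ∧ ∃ a b, Entry s i a ∧ Entry s j b ∧ Entry s k (a + b)) ∨
  (∃ i j k, p = mulCode i j k ∧ ∃ a b, Entry s i a ∧ Entry s j b ∧ Entry s k (a * b)) ∨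
  (∃ i, p = memCode i ∧ ∃ a, Entry s i a ∧ a ∈ Z) ∨
  (∃ q, p = negCode q ∧ pair q s ∉ V) ∨
  (∃ q r, p = andCode q r ∧ pair q s ∈ V ∧ pair r s ∈ V) ∨
  (∃ i q, p = allCode i q ∧ ∀ t, Variant i s t → pair q t ∈ V)

/-- Two valuations agree on the formulas in `D`. -/
def AgreeOn (D V V' : Set N) : Prop :=
  ∀ p ∈ D, ∀ s l, SeqLen s l → (pair p s ∈ V ↔ pair p s ∈ V')

set_option synthInstance.maxSize 1000 in
instance {C : Set (Set N)} {k m : ℕ} {Z V : Set N} [Fact (Z ∈ C)] [Fact (V ∈ C)]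
    {p s : (Fin m → N) → N} [IsTerm p] [IsTerm s] :
    Ar C fun (_ : Fin k → Set N) v => Tarski Z V (p v) (s v) :=
  Ar.rel₂ (by unfold Tarski; infer_instance) _ _

/-- Code of the quantification `∃ v_i`. -/
def exCode (i p : N) : N := negCode (allCode i (negCode p))

end Defs

section Valuations

variable {N : Type u} [CommSemiring N] [LinearOrder N] [IsStrictOrderedRing N]
  [CanonicallyOrderedAdd N]

theorem numeral_eq_natCast (n : ℕ) : (numeral n : N) = n := by
  induction n with
  | zero => simp [numeral]
  | succ n ih => simp [numeral, ih]

theorem numeral_lt_numeral {a b : ℕ} : (numeral a : N) < numeral b ↔ a < b := by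
  simp [numeral_eq_natCast]

theorem numeral_le_numeral {a b : ℕ} : (numeral a : N) ≤ numeral b ↔ a ≤ b := by
  simp [numeral_eq_natCast]

theorem numeral_inj {a b : ℕ} : (numeral a : N) = numeral b ↔ a = b := by
  simp [numeral_eq_natCast]

variable {S : Set (Set N)} (hS : ModelsACA₀ S) {Z D V D' V' : Set N}
include hS

theorem tarski_eqCode {i j s : N} :
    Tarski Z V (eqCode i j) s ↔ ∃ a, Entry s i a ∧ Entry s j a := by
  simp [Tarski, eqCode, ltCode, addCode, mulCode, memCode, negCode, andCode, allCode, pair_inj hS,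
    numeral_inj, and_assoc]

theorem tarski_ltCode {i j s : N} :
    Tarski Z V (ltCode i j) s ↔ ∃ a b, Entry s i a ∧ Entry s j b ∧ a < b := by
  simp [Tarski, eqCode, ltCode, addCode, mulCode, memCode, negCode, andCode, allCode, pair_inj hS,
    numeral_inj, and_assoc]

theorem tarski_addCode {i j k s : N} :
    Tarski Z V (addCode i j k) s ↔ ∃ a b, Entry s i a ∧ Entry s j b ∧ Entry s k (a + b) := by
  simp [Tarski, eqCode, ltCode, addCode, mulCode, memCode, negCode, andCode, allCode, pair_inj hS,
    numeral_inj, and_assoc]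

theorem tarski_mulCode {i j k s : N} :
    Tarski Z V (mulCode i j k) s ↔ ∃ a b, Entry s i a ∧ Entry s j b ∧ Entry s k (a * b) := by
  simp [Tarski, eqCode, ltCode, addCode, mulCode, memCode, negCode, andCode, allCode, pair_inj hS,
    numeral_inj, and_assoc]

theorem tarski_memCode {i s : N} :
    Tarski Z V (memCode i) s ↔ ∃ a, Entry s i a ∧ a ∈ Z := by
  simp [Tarski, eqCode, ltCode, addCode, mulCode, memCode, negCode, andCode, allCode, pair_inj hS,
    numeral_inj]

theorem tarski_negCode {p s : N} : Tarski Z V (negCode p) s ↔ pair p s ∉ V := by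
  simp [Tarski, eqCode, ltCode, addCode, mulCode, memCode, negCode, andCode, allCode, pair_inj hS,
    numeral_inj]

theorem tarski_andCode {p q s : N} :
    Tarski Z V (andCode p q) s ↔ pair p s ∈ V ∧ pair q s ∈ V := by
  simp [Tarski, eqCode, ltCode, addCode, mulCode, memCode, negCode, andCode, allCode, pair_inj hS,
    numeral_inj, and_assoc]

theorem tarski_allCode {i p s : N} :
    Tarski Z V (allCode i p) s ↔ ∀ t, Variant i s t → pair p t ∈ V := by
  simp [Tarski, eqCode, ltCode, addCode, mulCode, memCode, negCode, andCode, allCode, pair_inj hS,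
    numeral_inj, and_assoc]

theorem shape_negCode {p : N} : Shape D (negCode p) ↔ p ∈ D := by
  simp [Shape, eqCode, ltCode, addCode, mulCode, memCode, negCode, andCode, allCode, pair_inj hS,
    numeral_inj]

theorem shape_andCode {p q : N} : Shape D (andCode p q) ↔ p ∈ D ∧ q ∈ D := by
  simp [Shape, eqCode, ltCode, addCode, mulCode, memCode, negCode, andCode, allCode, pair_inj hS,
    numeral_inj]

theorem shape_allCode {i p : N} : Shape D (allCode i p) ↔ p ∈ D := by
  simp [Shape, eqCode, ltCode, addCode, mulCode, memCode, negCode, andCode, allCode, pair_inj hS,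
    numeral_inj]

/-- With a single equivalence in place of eight clauses, gluing and extending valuations treats all
connectives at once. -/
theorem isValuation_iff : IsValuation Z D V ↔ (∀ p ∈ D, Shape D p) ∧
    ∀ p ∈ D, ∀ s l, SeqLen s l → (pair p s ∈ V ↔ Tarski Z V p s) := by
  constructor
  · intro h
    refine ⟨h.closed, fun p hp s l hs => ?_⟩
    rcases h.closed p hp with ⟨i, j, rfl⟩ | ⟨i, j, rfl⟩ | ⟨i, j, k, rfl⟩ | ⟨i, j, k, rfl⟩ | ⟨i, rfl⟩ |
      ⟨q, -, rfl⟩ | ⟨q, -, r, -, rfl⟩ | ⟨i, q, -, rfl⟩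
    · rw [tarski_eqCode hS, h.eq_iff i j hp s l hs]
    · rw [tarski_ltCode hS, h.lt_iff i j hp s l hs]
    · rw [tarski_addCode hS, h.add_iff i j k hp s l hs]
    · rw [tarski_mulCode hS, h.mul_iff i j k hp s l hs]
    · rw [tarski_memCode hS, h.mem_iff i hp s l hs]
    · rw [tarski_negCode hS, h.neg_iff q hp s l hs]
    · rw [tarski_andCode hS, h.and_iff q r hp s l hs]
    · rw [tarski_allCode hS, h.all_iff i q hp s l hs]
  · rintro ⟨h₁, h₂⟩
    refine ⟨h₁, fun i j hp s l hs => ?_, fun i j hp s l hs => ?_, fun i j k hp s l hs => ?_,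
      fun i j k hp s l hs => ?_, fun i hp s l hs => ?_, fun p hp s l hs => ?_,
      fun p q hp s l hs => ?_, fun i p hp s l hs => ?_⟩
    · rw [← tarski_eqCode hS, h₂ _ hp s l hs]
    · rw [← tarski_ltCode hS, h₂ _ hp s l hs]
    · rw [← tarski_addCode hS, h₂ _ hp s l hs]
    · rw [← tarski_mulCode hS, h₂ _ hp s l hs]
    · rw [← tarski_memCode hS, h₂ _ hp s l hs]
    · rw [← tarski_negCode hS, h₂ _ hp s l hs]
    · rw [← tarski_andCode hS, h₂ _ hp s l hs]
    · rw [← tarski_allCode hS, h₂ _ hp s l hs]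

omit hS in
theorem Shape.mono {p : N} (h : Shape D p) (hD : D ⊆ D') : Shape D' p := by
  rcases h with h | h | h | h | h | ⟨q, hq, rfl⟩ | ⟨q, hq, r, hr, rfl⟩ | ⟨i, q, hq, rfl⟩
  · exact .inl h
  · exact .inr (.inl h)
  · exact .inr (.inr (.inl h))
  · exact .inr (.inr (.inr (.inl h)))
  · exact .inr (.inr (.inr (.inr (.inl h))))
  · exact .inr (.inr (.inr (.inr (.inr (.inl ⟨q, hD hq, rfl⟩)))))
  · exact .inr (.inr (.inr (.inr (.inr (.inr (.inl ⟨q, hD hq, r, hD hr, rfl⟩))))))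
  · exact .inr (.inr (.inr (.inr (.inr (.inr (.inr ⟨i, q, hD hq, rfl⟩))))))

/-- Immediate subformulas have smaller codes. -/
theorem Shape.below {p : N} (h : Shape D p) : Shape {q ∈ D | q < p} p := by
  have h₅ : (0 : N) < numeral 5 := by simp [numeral_eq_natCast]
  have h₆ : (0 : N) < numeral 6 := by simp [numeral_eq_natCast]
  have h₇ : (0 : N) < numeral 7 := by simp [numeral_eq_natCast]
  rcases h with h | h | h | h | h | ⟨q, hq, rfl⟩ | ⟨q, hq, r, hr, rfl⟩ | ⟨i, q, hq, rfl⟩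
  · exact .inl h
  · exact .inr (.inl h)
  · exact .inr (.inr (.inl h))
  · exact .inr (.inr (.inr (.inl h)))
  · exact .inr (.inr (.inr (.inr (.inl h))))
  · exact .inr (.inr (.inr (.inr (.inr (.inl ⟨q, ⟨hq, lt_pair_right hS _ h₅⟩, rfl⟩)))))
  · exact .inr (.inr (.inr (.inr (.inr (.inr (.inl ⟨q, ⟨hq, (le_pair_left hS q r).trans_lt
      (lt_pair_right hS _ h₆)⟩, r, ⟨hr, (le_pair_right hS q r).trans_lt
      (lt_pair_right hS _ h₆)⟩, rfl⟩))))))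
  · exact .inr (.inr (.inr (.inr (.inr (.inr (.inr ⟨i, q, ⟨hq, (le_pair_right hS i q).trans_lt
      (lt_pair_right hS _ h₇)⟩, rfl⟩))))))

/-- Tarski's clauses consult the valuation only at immediate subformulas, under `s` or a variant of
`s`. -/
theorem tarski_congr {p s l : N} (hp : Shape D p) (hV : AgreeOn D V V') (hs : SeqLen s l) :
    Tarski Z V p s ↔ Tarski Z V' p s := by
  rcases hp with ⟨i, j, rfl⟩ | ⟨i, j, rfl⟩ | ⟨i, j, k, rfl⟩ | ⟨i, j, k, rfl⟩ | ⟨i, rfl⟩ |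
      ⟨q, hq, rfl⟩ | ⟨q, hq, r, hr, rfl⟩ | ⟨i, q, hq, rfl⟩
  · rw [tarski_eqCode hS, tarski_eqCode hS]
  · rw [tarski_ltCode hS, tarski_ltCode hS]
  · rw [tarski_addCode hS, tarski_addCode hS]
  · rw [tarski_mulCode hS, tarski_mulCode hS]
  · rw [tarski_memCode hS, tarski_memCode hS]
  · rw [tarski_negCode hS, tarski_negCode hS, hV q hq s l hs]
  · rw [tarski_andCode hS, tarski_andCode hS, hV q hq s l hs, hV r hr s l hs]
  · rw [tarski_allCode hS, tarski_allCode hS]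
    refine forall_congr' fun t => forall_congr' fun ht => ?_
    obtain ⟨⟨l', -, hl'⟩, -⟩ := ht
    exact hV q hq t l' hl'

/-- Two valuations in the model agree on the formulas that they have in common. -/
theorem IsValuation.agree (h : IsValuation Z D V) (h' : IsValuation Z D' V') (hD : D ∈ S)
    (hV : V ∈ S) (hD' : D' ∈ S) (hV' : V' ∈ S) : AgreeOn (D ∩ D') V V' := by
  rw [isValuation_iff hS] at h h'
  have := Fact.mk hD
  have := Fact.mk hD'
  have := Fact.mk hV
  have := Fact.mk hV'
  suffices ∀ p, p ∈ D → p ∈ D' → ∀ s l, SeqLen s l → (pair p s ∈ V ↔ pair p s ∈ V') from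
    fun p hp => this p hp.1 hp.2
  -- Subformulas have smaller codes, and the claim is arithmetical in four sets of `S`, so induction
  -- inside the model covers nonstandard formulas too.
  refine strong_ind hS (P := fun p => p ∈ D → p ∈ D' → ∀ s l, SeqLen s l →
    (pair p s ∈ V ↔ pair p s ∈ V')) fun p ih hp hp' s l hs => ?_
  rw [h.2 p hp s l hs, h'.2 p hp' s l hs]
  have hp₁ := (h.1 p hp).below hS
  have hp₂ := (h'.1 p hp').below hS
  -- Codes determine the immediate subformulas, so those found in `D` and those found in `D'` are
  -- the same.
  have hp₃ : Shape ({q ∈ D | q < p} ∩ D') p := by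
    rcases hp₁ with h | h | h | h | h | ⟨q, hq, rfl⟩ | ⟨q, hq, r, hr, rfl⟩ | ⟨i, q, hq, rfl⟩
    · exact .inl h
    · exact .inr (.inl h)
    · exact .inr (.inr (.inl h))
    · exact .inr (.inr (.inr (.inl h)))
    · exact .inr (.inr (.inr (.inr (.inl h))))
    · rw [shape_negCode hS] at hp₂ ⊢
      exact ⟨hq, hp₂.1⟩
    · rw [shape_andCode hS] at hp₂ ⊢
      exact ⟨⟨hq, hp₂.1.1⟩, ⟨hr, hp₂.2.1⟩⟩
    · rw [shape_allCode hS] at hp₂ ⊢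
      exact ⟨hq, hp₂.1⟩
  exact tarski_congr hS hp₃ (fun q hq => ih q hq.1.2 hq.1.1 hq.2) hs

/-- Two valuations have a common extension. -/
theorem IsValuation.merge (h : IsValuation Z D V) (h' : IsValuation Z D' V') (hD : D ∈ S)
    (hV : V ∈ S) (hD' : D' ∈ S) (hV' : V' ∈ S) :
    ∃ E ∈ S, ∃ U ∈ S, IsValuation Z E U ∧ D ⊆ E ∧ D' ⊆ E := by
  have hag := h.agree hS h' hD hV hD' hV'
  have := Fact.mk hD
  have := Fact.mk hD'
  have := Fact.mk hV
  have := Fact.mk hV'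
  -- A plain union would fail: off its own domain a valuation may contain anything.
  let U : Set N := {z | ∃ p s, z = pair p s ∧ ((p ∈ D ∧ z ∈ V) ∨ (p ∈ D' ∧ z ∈ V'))}
  have hU : ∀ p s, pair p s ∈ U ↔ (p ∈ D ∧ pair p s ∈ V) ∨ (p ∈ D' ∧ pair p s ∈ V') := by
    intro p s
    constructor
    · rintro ⟨p', s', e, h⟩
      obtain ⟨rfl, rfl⟩ := (pair_inj hS).1 e
      exact h
    · exact fun h => ⟨p, s, rfl, h⟩
  have h₁ : AgreeOn D V U := by
    intro p hp s l hs
    rw [hU]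
    have := fun hp' => hag p ⟨hp, hp'⟩ s l hs
    tauto
  have h₂ : AgreeOn D' V' U := by
    intro p hp s l hs
    rw [hU]
    have := fun hp' => hag p ⟨hp', hp⟩ s l hs
    tauto
  refine ⟨{x | x ∈ D ∨ x ∈ D'}, hS.setOf_mem _, U, hS.setOf_mem _, ?_, fun _ => .inl, fun _ => .inr⟩
  rw [isValuation_iff hS] at h h' ⊢
  refine ⟨?_, ?_⟩
  · rintro p (hp | hp)
    · exact (h.1 p hp).mono fun _ => .inl
    · exact (h'.1 p hp).mono fun _ => .inr
  · rintro p (hp | hp) s l hs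
    · rw [← h₁ p hp s l hs, h.2 p hp s l hs, tarski_congr hS (h.1 p hp) h₁ hs]
    · rw [← h₂ p hp s l hs, h'.2 p hp s l hs, tarski_congr hS (h'.1 p hp) h₂ hs]

/-- A valuation can be extended by one formula. -/
theorem IsValuation.adjoin (h : IsValuation Z D V) (hZ : Z ∈ S) (hD : D ∈ S) (hV : V ∈ S) {q : N}
    (hq : Shape D q) : ∃ E ∈ S, ∃ U ∈ S, IsValuation Z E U ∧ D ⊆ E ∧ q ∈ E := by
  by_cases hqD : q ∈ D
  · exact ⟨D, hD, V, hV, h, subset_rfl, hqD⟩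
  have := Fact.mk hZ
  have := Fact.mk hD
  have := Fact.mk hV
  let U : Set N := {z | ∃ p s, z = pair p s ∧ ((p ∈ D ∧ z ∈ V) ∨ (p = q ∧ Tarski Z V q s))}
  have hU : ∀ p s, pair p s ∈ U ↔ (p ∈ D ∧ pair p s ∈ V) ∨ (p = q ∧ Tarski Z V q s) := by
    intro p s
    constructor
    · rintro ⟨p', s', e, h⟩
      obtain ⟨rfl, rfl⟩ := (pair_inj hS).1 e
      exact h
    · exact fun h => ⟨p, s, rfl, h⟩
  have h₁ : AgreeOn D V U := by
    intro p hp s l hs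
    have : p ≠ q := by rintro rfl; exact hqD hp
    rw [hU]
    tauto
  refine ⟨{x | x ∈ D ∨ x = q}, hS.setOf_mem _, U, hS.setOf_mem _, ?_, fun _ => .inl, .inr rfl⟩
  rw [isValuation_iff hS] at h ⊢
  refine ⟨?_, ?_⟩
  · rintro p (hp | rfl)
    · exact (h.1 p hp).mono fun _ => .inl
    · exact hq.mono fun _ => .inl
  · rintro p (hp | rfl) s l hs
    · rw [← h₁ p hp s l hs, h.2 p hp s l hs, tarski_congr hS (h.1 p hp) h₁ hs]
    · rw [hU, ← tarski_congr hS hq h₁ hs]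
      simp [hqD]

/-! #### Extending valuations -/

/-- In the model, every valuation for a set of formulas that includes `B` extends to one for a
set of formulas that contains `c`. -/
def Extends (S : Set (Set N)) (Z B : Set N) (c : N) : Prop :=
  ∀ D ∈ S, ∀ V ∈ S, IsValuation Z D V → B ⊆ D →
    ∃ E ∈ S, ∃ U ∈ S, IsValuation Z E U ∧ D ⊆ E ∧ c ∈ E

variable {B : Set N}

omit hS in
theorem Extends.of_mem {c : N} (hc : c ∈ B) : Extends S Z B c :=
  fun D hD V hV h hB => ⟨D, hD, V, hV, h, subset_rfl, hB hc⟩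

theorem Extends.atom (hZ : Z ∈ S) {c : N} (hc : Shape ∅ c) : Extends S Z B c :=
  fun _ hD _ hV h _ => h.adjoin hS hZ hD hV (hc.mono (Set.empty_subset _))

theorem Extends.neg (hZ : Z ∈ S) {p : N} (hp : Extends S Z B p) : Extends S Z B (negCode p) := by
  intro D hD V hV h hB
  obtain ⟨E, hE, U, hU, h', hDE, hpE⟩ := hp D hD V hV h hB
  obtain ⟨E', hE', U', hU', h'', hEE, hq⟩ := h'.adjoin hS hZ hE hU ((shape_negCode hS).2 hpE)
  exact ⟨E', hE', U', hU', h'', hDE.trans hEE, hq⟩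

theorem Extends.and (hZ : Z ∈ S) {p q : N} (hp : Extends S Z B p) (hq : Extends S Z B q) :
    Extends S Z B (andCode p q) := by
  intro D hD V hV h hB
  obtain ⟨E, hE, U, hU, h, hDE, hpE⟩ := hp D hD V hV h hB
  obtain ⟨E', hE', U', hU', h, hEE, hqE⟩ := hq E hE U hU h (hB.trans hDE)
  obtain ⟨E'', hE'', U'', hU'', h, hEE', hq⟩ := h.adjoin hS hZ hE' hU'
    ((shape_andCode hS).2 ⟨hEE hpE, hqE⟩)
  exact ⟨E'', hE'', U'', hU'', h, hDE.trans (hEE.trans hEE'), hq⟩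

theorem Extends.all (hZ : Z ∈ S) {i p : N} (hp : Extends S Z B p) :
    Extends S Z B (allCode i p) := by
  intro D hD V hV h hB
  obtain ⟨E, hE, U, hU, h', hDE, hpE⟩ := hp D hD V hV h hB
  obtain ⟨E', hE', U', hU', h'', hEE, hq⟩ := h'.adjoin hS hZ hE hU ((shape_allCode hS).2 hpE)
  exact ⟨E', hE', U', hU', h'', hDE.trans hEE, hq⟩

theorem Extends.ex (hZ : Z ∈ S) {i p : N} (hp : Extends S Z B p) : Extends S Z B (exCode i p) :=
  .neg hS hZ (.all hS hZ (.neg hS hZ hp))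

/-! #### Truth of compound formulas -/

theorem IsValuation.of_negCode (h : IsValuation Z D V) {p : N} (hp : negCode p ∈ D) : p ∈ D :=
  (shape_negCode hS).1 (h.closed _ hp)

theorem IsValuation.of_andCode (h : IsValuation Z D V) {p q : N} (hp : andCode p q ∈ D) :
    p ∈ D ∧ q ∈ D :=
  (shape_andCode hS).1 (h.closed _ hp)

theorem IsValuation.of_allCode (h : IsValuation Z D V) {i p : N} (hp : allCode i p ∈ D) : p ∈ D :=
  (shape_allCode hS).1 (h.closed _ hp)

theorem IsValuation.of_exCode (h : IsValuation Z D V) {i p : N} (hp : exCode i p ∈ D) : p ∈ D :=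
  h.of_negCode hS (h.of_allCode hS (h.of_negCode hS hp))

/-- Since `i < l`, every value is taken at `i` by some variant of `s`, and every variant has a value
there. Beyond the length of `s` the quantifier would be idle. -/
theorem IsValuation.all_iff_forall (h : IsValuation Z D V) {i p s l : N} (hp : allCode i p ∈ D)
    (hs : SeqLen s l) (hi : i < l) {Q : N → Prop}
    (hQ : ∀ t x, Variant i s t → Entry t i x → (pair p t ∈ V ↔ Q x)) :
    pair (allCode i p) s ∈ V ↔ ∀ x, Q x := by
  rw [h.all_iff i p hp s l hs]
  constructor
  · intro h x
    obtain ⟨t, ht, hx⟩ := exists_variant hS hs hi x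
    exact (hQ t x ht hx).1 (h t ht)
  · intro h t ht
    obtain ⟨l', hl, hl'⟩ := ht.1
    obtain ⟨x, hx⟩ := exists_entry hS hl' (hi.trans_eq (hs.unique hS hl))
    exact (hQ t x ht hx).2 (h x)

theorem IsValuation.ex_iff_exists (h : IsValuation Z D V) {i p s l : N} (hp : exCode i p ∈ D)
    (hs : SeqLen s l) (hi : i < l) {Q : N → Prop}
    (hQ : ∀ t x, Variant i s t → Entry t i x → (pair p t ∈ V ↔ Q x)) :
    pair (exCode i p) s ∈ V ↔ ∃ x, Q x := by
  have h₁ := h.of_negCode hS hp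
  have h₂ := h.of_allCode hS h₁
  rw [exCode, h.neg_iff _ hp s l hs, h.all_iff_forall hS h₁ hs hi (Q := fun x => ¬ Q x)]
  · simp
  · intro t x ht hx
    obtain ⟨l', -, hl'⟩ := ht.1
    rw [h.neg_iff _ h₂ t l' hl', hQ t x ht hx]

end Valuations

/-! ### Translation of formulas into codes -/

section Codes

variable {N : Type u} [Zero N] [One N] [Add N] [Mul N] [LT N]

/-- Code of `v_z = t`, where the `i`-th variable of `t` is named `ν i` and names from `c` on are
used for bound variables. -/
def tmCode {m : ℕ} (ν : Fin m → ℕ) : NumTerm m → ℕ → ℕ → N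
  | .var i, z, _ => eqCode (numeral z) (numeral (ν i))
  -- The language of codes has no constants: `0` is the only `x` with `x + x = x`, and `1` is the
  -- only other `x` with `x * x = x`.
  | .zero, z, _ => addCode (numeral z) (numeral z) (numeral z)
  | .one, z, _ => andCode (mulCode (numeral z) (numeral z) (numeral z))
      (negCode (addCode (numeral z) (numeral z) (numeral z)))
  | .add t r, z, c => exCode (numeral c) (andCode (tmCode ν t c (c + 1))
      (exCode (numeral (c + 1)) (andCode (tmCode ν r (c + 1) (c + 2))
        (addCode (numeral c) (numeral (c + 1)) (numeral z)))))
  | .mul t r, z, c => exCode (numeral c) (andCode (tmCode ν t c (c + 1))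
      (exCode (numeral (c + 1)) (andCode (tmCode ν r (c + 1) (c + 2))
        (mulCode (numeral c) (numeral (c + 1)) (numeral z)))))

/-- Code of an arithmetical formula, where the `i`-th variable is named `ν i`, names from `c` on
are used for bound variables, and the `j`-th set variable is replaced by the formula coded by
`P j`, whose free variable is `v_0`. -/
def fmCode : {m k : ℕ} → Formula m k → (Fin k → N) → (Fin m → ℕ) → ℕ → N
  | _, _, .eq t r, _, ν, c => exCode (numeral c) (andCode (tmCode ν t c (c + 1))
      (exCode (numeral (c + 1)) (andCode (tmCode ν r (c + 1) (c + 2))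
        (eqCode (numeral c) (numeral (c + 1))))))
  | _, _, .lt t r, _, ν, c => exCode (numeral c) (andCode (tmCode ν t c (c + 1))
      (exCode (numeral (c + 1)) (andCode (tmCode ν r (c + 1) (c + 2))
        (ltCode (numeral c) (numeral (c + 1))))))
  -- The value of `t` passes through `v_c` to `v_0`, where `P j` reads it. Overwriting `v_0` is
  -- harmless, since `t` has been evaluated by then.
  | _, _, .mem t j, P, ν, c => exCode (numeral c) (andCode (tmCode ν t c (c + 1))
      (exCode (numeral 0) (andCode (eqCode (numeral 0) (numeral c)) (P j))))
  | _, _, .neg φ, P, ν, c => negCode (fmCode φ P ν c)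
  | _, _, .and φ ψ, P, ν, c => andCode (fmCode φ P ν c) (fmCode ψ P ν c)
  | _, _, .allNum φ, P, ν, c => allCode (numeral c) (fmCode φ P (Fin.cons c ν) (c + 1))
  -- A junk value: arithmetical formulas have no set quantifiers.
  | _, _, .allSet _, _, _, _ => numeral 0

/-- The assignment `s` gives the value `v i` to the variable named `ν i`. -/
def Reads {m : ℕ} (s : N) (ν : Fin m → ℕ) (v : Fin m → N) : Prop :=
  ∀ i, Entry s (numeral (ν i)) (v i)

end Codes

/-! ### Correctness of the translation -/

section Truth

variable {N : Type u} [CommSemiring N] [LinearOrder N] [IsStrictOrderedRing N]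
  [CanonicallyOrderedAdd N]

/-- The formula `p` defines the set `A`, for assignments of length at least `b`. -/
def Defines (V : Set N) (p b : N) (A : Set N) : Prop :=
  ∀ s l x, SeqLen s l → b ≤ l → Entry s 0 x → (pair p s ∈ V ↔ x ∈ A)

variable {S : Set (Set N)} (hS : ModelsACA₀ S) {Z D V : Set N}
include hS

theorem extends_tmCode (hZ : Z ∈ S) (B : Set N) {m : ℕ} (ν : Fin m → ℕ) (t : NumTerm m)
    (z c : ℕ) : Extends S Z B (tmCode ν t z c) := by
  have eq : ∀ i j, Extends S Z B (eqCode i j) := fun i j => .atom hS hZ (.inl ⟨_, _, rfl⟩)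
  have add : ∀ i j k, Extends S Z B (addCode i j k) := fun i j k =>
    .atom hS hZ (.inr (.inr (.inl ⟨_, _, _, rfl⟩)))
  have mul : ∀ i j k, Extends S Z B (mulCode i j k) := fun i j k =>
    .atom hS hZ (.inr (.inr (.inr (.inl ⟨_, _, _, rfl⟩))))
  induction t generalizing z c with
  | var i => exact eq _ _
  | zero => exact add _ _ _
  | one => exact .and hS hZ (mul _ _ _) (.neg hS hZ (add _ _ _))
  | add t r ih₁ ih₂ =>
    exact .ex hS hZ (.and hS hZ (ih₁ _ _) (.ex hS hZ (.and hS hZ (ih₂ _ _) (add _ _ _))))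
  | mul t r ih₁ ih₂ =>
    exact .ex hS hZ (.and hS hZ (ih₁ _ _) (.ex hS hZ (.and hS hZ (ih₂ _ _) (mul _ _ _))))

/-- The induction is on the standard formula, outside the model, so standardly many adjunctions
suffice. The codes `P j` may be nonstandard and have to be in the domain already. -/
theorem extends_fmCode (hZ : Z ∈ S) {B : Set N} {m k : ℕ} (φ : Formula m k)
    (hφ : φ.IsArithmetical) (P : Fin k → N) (hP : ∀ j, P j ∈ B) (ν : Fin m → ℕ) (c : ℕ) :
    Extends S Z B (fmCode φ P ν c) := by
  have eq : ∀ i j, Extends S Z B (eqCode i j) := fun i j => .atom hS hZ (.inl ⟨_, _, rfl⟩)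
  have lt : ∀ i j, Extends S Z B (ltCode i j) := fun i j => .atom hS hZ (.inr (.inl ⟨_, _, rfl⟩))
  have tm := @extends_tmCode _ _ _ _ _ _ hS _ hZ B
  induction φ generalizing c with
  | eq t r =>
    exact .ex hS hZ (.and hS hZ (tm _ _ _ _) (.ex hS hZ (.and hS hZ (tm _ _ _ _) (eq _ _))))
  | lt t r =>
    exact .ex hS hZ (.and hS hZ (tm _ _ _ _) (.ex hS hZ (.and hS hZ (tm _ _ _ _) (lt _ _))))
  | mem t j =>
    exact .ex hS hZ (.and hS hZ (tm _ _ _ _)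
      (.ex hS hZ (.and hS hZ (eq _ _) (.of_mem (hP j)))))
  | neg φ ih => exact .neg hS hZ (ih hφ P hP ν c)
  | and φ ψ ih₁ ih₂ => exact .and hS hZ (ih₁ hφ.1 P hP ν c) (ih₂ hφ.2 P hP ν c)
  | allNum φ ih => exact .all hS hZ (ih hφ P hP _ _)
  | allSet φ => exact hφ.elim

theorem Variant.seqLen {i s t l : N} (h : Variant i s t) (hs : SeqLen s l) : SeqLen t l := by
  obtain ⟨l', h₁, h₂⟩ := h.1
  rwa [hs.unique hS h₁]

omit hS in
theorem Variant.reads {i : ℕ} {s t : N} (h : Variant (numeral i) s t) {m : ℕ} {ν : Fin m → ℕ}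
    {v : Fin m → N} (hi : ∀ j, ν j < i) (hs : Reads s ν v) : Reads t ν v := fun j =>
  (h.2 _ (numeral_lt_numeral.2 (hi j)).ne _).1 (hs j)

omit hS in
theorem Variant.entry {i j : ℕ} {s t x : N} (h : Variant (numeral i) s t) (hi : j < i)
    (hs : Entry s (numeral j) x) : Entry t (numeral j) x :=
  (h.2 _ (numeral_lt_numeral.2 hi).ne _).1 hs

theorem IsValuation.eq_of_entry (h : IsValuation Z D V) {i j s a b : N} (hp : eqCode i j ∈ D)
    (hi : Entry s i a) (hj : Entry s j b) : pair (eqCode i j) s ∈ V ↔ a = b := by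
  obtain ⟨l, c, d, q, rfl, -⟩ := id hi
  rw [h.eq_iff i j hp _ l ⟨c, d, rfl⟩]
  constructor
  · rintro ⟨a', hi', hj'⟩
    rw [hi.unique hS hi', hj.unique hS hj']
  · rintro rfl
    exact ⟨a, hi, hj⟩

theorem IsValuation.lt_of_entry (h : IsValuation Z D V) {i j s a b : N} (hp : ltCode i j ∈ D)
    (hi : Entry s i a) (hj : Entry s j b) : pair (ltCode i j) s ∈ V ↔ a < b := by
  obtain ⟨l, c, d, q, rfl, -⟩ := id hi
  rw [h.lt_iff i j hp _ l ⟨c, d, rfl⟩]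
  constructor
  · rintro ⟨a', b', hi', hj', hab⟩
    rwa [hi.unique hS hi', hj.unique hS hj']
  · exact fun hab => ⟨a, b, hi, hj, hab⟩

theorem IsValuation.add_of_entry (h : IsValuation Z D V) {i j k s a b x : N}
    (hp : addCode i j k ∈ D) (hi : Entry s i a) (hj : Entry s j b) (hk : Entry s k x) :
    pair (addCode i j k) s ∈ V ↔ x = a + b := by
  obtain ⟨l, c, d, q, rfl, -⟩ := id hi
  rw [h.add_iff i j k hp _ l ⟨c, d, rfl⟩]
  constructor
  · rintro ⟨a', b', hi', hj', hk'⟩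
    rw [hi.unique hS hi', hj.unique hS hj', hk.unique hS hk']
  · rintro rfl
    exact ⟨a, b, hi, hj, hk⟩

theorem IsValuation.mul_of_entry (h : IsValuation Z D V) {i j k s a b x : N}
    (hp : mulCode i j k ∈ D) (hi : Entry s i a) (hj : Entry s j b) (hk : Entry s k x) :
    pair (mulCode i j k) s ∈ V ↔ x = a * b := by
  obtain ⟨l, c, d, q, rfl, -⟩ := id hi
  rw [h.mul_iff i j k hp _ l ⟨c, d, rfl⟩]
  constructor
  · rintro ⟨a', b', hi', hj', hk'⟩
    rw [hi.unique hS hi', hj.unique hS hj', hk.unique hS hk']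
  · rintro rfl
    exact ⟨a, b, hi, hj, hk⟩

theorem IsValuation.mem_of_entry (h : IsValuation Z D V) {i s a : N}
    (hp : memCode i ∈ D) (hi : Entry s i a) : pair (memCode i) s ∈ V ↔ a ∈ Z := by
  obtain ⟨l, c, d, q, rfl, -⟩ := id hi
  rw [h.mem_iff i hp _ l ⟨c, d, rfl⟩]
  constructor
  · rintro ⟨a', hi', ha⟩
    rwa [hi.unique hS hi']
  · exact fun ha => ⟨a, hi, ha⟩

/-- Truth of a formula `∃ v_c, (v_c = t ∧ p)`. -/
theorem IsValuation.let_iff (h : IsValuation Z D V) {c : ℕ} {e p a : N}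
    (hp : exCode (numeral c) (andCode e p) ∈ D) {s l : N} (hs : SeqLen s l)
    (hc : numeral c < l) (he : ∀ t x, Variant (numeral c) s t → Entry t (numeral c) x →
      (pair e t ∈ V ↔ x = a)) {Q : Prop}
    (hQ : ∀ t, Variant (numeral c) s t → Entry t (numeral c) a → (pair p t ∈ V ↔ Q)) :
    pair (exCode (numeral c) (andCode e p)) s ∈ V ↔ Q := by
  have h₁ := h.of_exCode hS hp
  rw [h.ex_iff_exists hS hp hs hc (Q := fun x => x = a ∧ Q)]
  · simp
  · intro t x ht hx
    rw [h.and_iff _ _ h₁ t l (ht.seqLen hS hs), he t x ht hx]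
    refine and_congr_right ?_
    rintro rfl
    exact hQ t ht hx

/-- The assignment must be long enough to hold the auxiliary bound variables. A standard bound `b`
suffices, and it is fixed before the valuation and the assignment. -/
theorem tmCode_sound {m : ℕ} (ν : Fin m → ℕ) (t : NumTerm m) : ∀ z c : ℕ, (∀ i, ν i < c) → z < c →
    ∃ b : ℕ, ∀ (Z D V : Set N) (s l : N) (v : Fin m → N) (x : N), IsValuation Z D V →
      tmCode ν t z c ∈ D → SeqLen s l → numeral b ≤ l → Reads s ν v → Entry s (numeral z) x →
      (pair (tmCode ν t z c) s ∈ V ↔ x = t.val v) := by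
  induction t with
  | var i =>
    intro z c hν hz
    exact ⟨0, fun Z D V s l v x h hp hs _ hv hx => h.eq_of_entry hS hp hx (hv i)⟩
  | zero =>
    intro z c hν hz
    refine ⟨0, fun Z D V s l v x h hp hs _ hv hx => ?_⟩
    rw [tmCode, h.add_of_entry hS hp hx hx hx]
    simp [NumTerm.val]
  | one =>
    intro z c hν hz
    refine ⟨0, fun Z D V s l v x h hp hs _ hv hx => ?_⟩
    obtain ⟨h₁, h₂⟩ := h.of_andCode hS hp
    have h₃ := h.of_negCode hS h₂
    rw [tmCode, h.and_iff _ _ hp s l hs, h.neg_iff _ h₂ s l hs, h.add_of_entry hS h₃ hx hx hx,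
      h.mul_of_entry hS h₁ hx hx hx]
    simp only [NumTerm.val]
    rcases eq_zero_or_eq_add_one hS x with rfl | ⟨y, rfl⟩
    · simp
    · have : y + 1 = (y + 1) * (y + 1) ↔ y + 1 = 1 := by
        constructor
        · intro h
          have : y * (y + 1) = 0 := by
            apply add_left_cancel (a := y + 1)
            rw [add_zero]
            nth_rewrite 3 [h]
            ring
          rcases mul_eq_zero.1 this with rfl | h
          · simp
          · exact absurd h (hS.add_one_ne_zero _)
        · intro h
          rw [h, mul_one]
      rw [this]
      refine and_iff_left_of_imp fun h => ?_
      rw [h]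
      simp
  | add t r ih₁ ih₂ =>
    intro z c hν hz
    obtain ⟨b₁, h₁⟩ := ih₁ c (c + 1) (fun i => (hν i).trans (by omega)) (by omega)
    obtain ⟨b₂, h₂⟩ := ih₂ (c + 1) (c + 2) (fun i => (hν i).trans (by omega)) (by omega)
    refine ⟨max (max b₁ b₂) (c + 2), fun Z D V s l v x h hp hs hb hv hx => ?_⟩
    have hd₁ := h.of_andCode hS (h.of_exCode hS hp)
    have hd₂ := h.of_andCode hS (h.of_exCode hS hd₁.2)
    have hb' : ∀ n ≤ max (max b₁ b₂) (c + 2), numeral n ≤ l := fun n hn =>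
      (numeral_le_numeral.2 hn).trans hb
    have hb₁ : ∀ n < max (max b₁ b₂) (c + 2), numeral n < l := fun n hn =>
      (numeral_lt_numeral.2 hn).trans_le hb
    refine h.let_iff hS (a := t.val v) hp hs (hb₁ _ (by omega))
      (fun s' y hs' hy => h₁ Z D V s' l v y h hd₁.1 (hs'.seqLen hS hs) (hb' _ (by omega))
        (hs'.reads hν hv) hy) fun s₁ hs₁ ha => ?_
    refine h.let_iff hS (a := r.val v) hd₁.2 (hs₁.seqLen hS hs)
      (hb₁ _ (by omega))
      (fun s' y hs' hy => h₂ Z D V s' l v y h hd₂.1 (hs'.seqLen hS (hs₁.seqLen hS hs))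
        (hb' _ (by omega))
        (hs'.reads (fun i => (hν i).trans (by omega)) (hs₁.reads hν hv)) hy) fun s₂ hs₂ hb => ?_
    exact h.add_of_entry hS hd₂.2 (hs₂.entry (by omega) ha) hb
      (hs₂.entry (by omega) (hs₁.entry hz hx))
  | mul t r ih₁ ih₂ =>
    intro z c hν hz
    obtain ⟨b₁, h₁⟩ := ih₁ c (c + 1) (fun i => (hν i).trans (by omega)) (by omega)
    obtain ⟨b₂, h₂⟩ := ih₂ (c + 1) (c + 2) (fun i => (hν i).trans (by omega)) (by omega)
    refine ⟨max (max b₁ b₂) (c + 2), fun Z D V s l v x h hp hs hb hv hx => ?_⟩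
    have hd₁ := h.of_andCode hS (h.of_exCode hS hp)
    have hd₂ := h.of_andCode hS (h.of_exCode hS hd₁.2)
    have hb' : ∀ n ≤ max (max b₁ b₂) (c + 2), numeral n ≤ l := fun n hn =>
      (numeral_le_numeral.2 hn).trans hb
    have hb₁ : ∀ n < max (max b₁ b₂) (c + 2), numeral n < l := fun n hn =>
      (numeral_lt_numeral.2 hn).trans_le hb
    refine h.let_iff hS (a := t.val v) hp hs (hb₁ _ (by omega))
      (fun s' y hs' hy => h₁ Z D V s' l v y h hd₁.1 (hs'.seqLen hS hs) (hb' _ (by omega))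
        (hs'.reads hν hv) hy) fun s₁ hs₁ ha => ?_
    refine h.let_iff hS (a := r.val v) hd₁.2 (hs₁.seqLen hS hs)
      (hb₁ _ (by omega))
      (fun s' y hs' hy => h₂ Z D V s' l v y h hd₂.1 (hs'.seqLen hS (hs₁.seqLen hS hs))
        (hb' _ (by omega))
        (hs'.reads (fun i => (hν i).trans (by omega)) (hs₁.reads hν hv)) hy) fun s₂ hs₂ hb => ?_
    exact h.mul_of_entry hS hd₂.2 (hs₂.entry (by omega) ha) hb
      (hs₂.entry (by omega) (hs₁.entry hz hx))

/-- Two length bounds appear: the standard `b` for the variables of `φ`, and `b₀` in `N` for the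
formulas `P j`, which may be nonstandard. -/
theorem fmCode_sound {m k : ℕ} (φ : Formula m k) (hφ : φ.IsArithmetical) (P : Fin k → N)
    (ν : Fin m → ℕ) (c : ℕ) (hν : ∀ i, ν i < c) (hc : 0 < c) : ∃ b : ℕ, ∀ (Z D V : Set N)
      (A : Fin k → Set N) (b₀ s l : N) (v : Fin m → N) (T : Set (Set N)), IsValuation Z D V →
      fmCode φ P ν c ∈ D → (∀ j, Defines V (P j) b₀ (A j)) → SeqLen s l → numeral b ≤ l →
      b₀ ≤ l → Reads s ν v → (pair (fmCode φ P ν c) s ∈ V ↔ φ.Realize T v A) := by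
  induction φ generalizing c with
  | @eq m k t r =>
    obtain ⟨b₁, h₁⟩ := tmCode_sound hS ν t c (c + 1) (fun i => (hν i).trans (by omega)) (by omega)
    obtain ⟨b₂, h₂⟩ := tmCode_sound hS ν r (c + 1) (c + 2) (fun i => (hν i).trans (by omega))
      (by omega)
    refine ⟨max (max b₁ b₂) (c + 2), fun Z D V A b₀ s l v T h hp _ hs hb _ hv => ?_⟩
    have hd₁ := h.of_andCode hS (h.of_exCode hS hp)
    have hd₂ := h.of_andCode hS (h.of_exCode hS hd₁.2)
    have hb' : ∀ n ≤ max (max b₁ b₂) (c + 2), numeral n ≤ l := fun n hn =>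
      (numeral_le_numeral.2 hn).trans hb
    have hb₁ : ∀ n < max (max b₁ b₂) (c + 2), numeral n < l := fun n hn =>
      (numeral_lt_numeral.2 hn).trans_le hb
    refine h.let_iff hS (a := t.val v) hp hs (hb₁ _ (by omega))
      (fun s' y hs' hy => h₁ Z D V s' l v y h hd₁.1 (hs'.seqLen hS hs) (hb' _ (by omega))
        (hs'.reads hν hv) hy) fun s₁ hs₁ ha => ?_
    refine h.let_iff hS (a := r.val v) hd₁.2 (hs₁.seqLen hS hs)
      (hb₁ _ (by omega))
      (fun s' y hs' hy => h₂ Z D V s' l v y h hd₂.1 (hs'.seqLen hS (hs₁.seqLen hS hs))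
        (hb' _ (by omega))
        (hs'.reads (fun i => (hν i).trans (by omega)) (hs₁.reads hν hv)) hy) fun s₂ hs₂ hb => ?_
    exact h.eq_of_entry hS hd₂.2 (hs₂.entry (by omega) ha) hb
  | @lt m k t r =>
    obtain ⟨b₁, h₁⟩ := tmCode_sound hS ν t c (c + 1) (fun i => (hν i).trans (by omega)) (by omega)
    obtain ⟨b₂, h₂⟩ := tmCode_sound hS ν r (c + 1) (c + 2) (fun i => (hν i).trans (by omega))
      (by omega)
    refine ⟨max (max b₁ b₂) (c + 2), fun Z D V A b₀ s l v T h hp _ hs hb _ hv => ?_⟩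
    have hd₁ := h.of_andCode hS (h.of_exCode hS hp)
    have hd₂ := h.of_andCode hS (h.of_exCode hS hd₁.2)
    have hb' : ∀ n ≤ max (max b₁ b₂) (c + 2), numeral n ≤ l := fun n hn =>
      (numeral_le_numeral.2 hn).trans hb
    have hb₁ : ∀ n < max (max b₁ b₂) (c + 2), numeral n < l := fun n hn =>
      (numeral_lt_numeral.2 hn).trans_le hb
    refine h.let_iff hS (a := t.val v) hp hs (hb₁ _ (by omega))
      (fun s' y hs' hy => h₁ Z D V s' l v y h hd₁.1 (hs'.seqLen hS hs) (hb' _ (by omega))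
        (hs'.reads hν hv) hy) fun s₁ hs₁ ha => ?_
    refine h.let_iff hS (a := r.val v) hd₁.2 (hs₁.seqLen hS hs)
      (hb₁ _ (by omega))
      (fun s' y hs' hy => h₂ Z D V s' l v y h hd₂.1 (hs'.seqLen hS (hs₁.seqLen hS hs))
        (hb' _ (by omega))
        (hs'.reads (fun i => (hν i).trans (by omega)) (hs₁.reads hν hv)) hy) fun s₂ hs₂ hb => ?_
    exact h.lt_of_entry hS hd₂.2 (hs₂.entry (by omega) ha) hb
  | @mem m k t j =>
    obtain ⟨b₁, h₁⟩ := tmCode_sound hS ν t c (c + 1) (fun i => (hν i).trans (by omega)) (by omega)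
    refine ⟨max b₁ (c + 1), fun Z D V A b₀ s l v T h hp hA hs hb hb₀ hv => ?_⟩
    have hd₁ := h.of_andCode hS (h.of_exCode hS hp)
    have hd₂ := h.of_andCode hS (h.of_exCode hS hd₁.2)
    have hb' : ∀ n ≤ max b₁ (c + 1), numeral n ≤ l := fun n hn =>
      (numeral_le_numeral.2 hn).trans hb
    have hb₁ : ∀ n < max b₁ (c + 1), numeral n < l := fun n hn =>
      (numeral_lt_numeral.2 hn).trans_le hb
    refine h.let_iff hS (a := t.val v) hp hs (hb₁ _ (by omega))
      (fun s' y hs' hy => h₁ Z D V s' l v y h hd₁.1 (hs'.seqLen hS hs) (hb' _ (by omega))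
        (hs'.reads hν hv) hy) fun s₁ hs₁ ha => ?_
    refine h.let_iff hS (a := t.val v) hd₁.2 (hs₁.seqLen hS hs)
      (hb₁ _ (by omega)) (fun s' y hs' hy => ?_) fun s₂ hs₂ hb => ?_
    · exact h.eq_of_entry hS hd₂.1 hy ((hs'.2 _ (numeral_lt_numeral.2 hc).ne' _).1 ha)
    · exact hA j s₂ l _ (hs₂.seqLen hS (hs₁.seqLen hS hs)) hb₀ hb
  | neg φ ih =>
    obtain ⟨b, hb⟩ := ih hφ P ν c hν hc
    refine ⟨b, fun Z D V A b₀ s l v T h hp hA hs hbl hb₀ hv => ?_⟩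
    rw [fmCode, h.neg_iff _ hp s l hs, hb Z D V A b₀ s l v T h (h.of_negCode hS hp) hA hs hbl hb₀ hv]
    rfl
  | and φ ψ ih₁ ih₂ =>
    obtain ⟨b₁, hb₁⟩ := ih₁ hφ.1 P ν c hν hc
    obtain ⟨b₂, hb₂⟩ := ih₂ hφ.2 P ν c hν hc
    refine ⟨max b₁ b₂, fun Z D V A b₀ s l v T h hp hA hs hbl hb₀ hv => ?_⟩
    have hd := h.of_andCode hS hp
    rw [fmCode, h.and_iff _ _ hp s l hs,
      hb₁ Z D V A b₀ s l v T h hd.1 hA hs ((numeral_le_numeral.2 (by omega)).trans hbl) hb₀ hv,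
      hb₂ Z D V A b₀ s l v T h hd.2 hA hs ((numeral_le_numeral.2 (by omega)).trans hbl) hb₀ hv]
    rfl
  | allNum φ ih =>
    obtain ⟨b, hb⟩ := ih hφ P (Fin.cons c ν) (c + 1)
      (Fin.cases (by simp) fun i => by simpa using Nat.lt_succ_of_lt (hν i)) (by omega)
    refine ⟨max b (c + 1), fun Z D V A b₀ s l v T h hp hA hs hbl hb₀ hv => ?_⟩
    rw [fmCode, h.all_iff_forall hS hp hs
      ((numeral_lt_numeral.2 (by omega)).trans_le hbl)
      (Q := fun x => φ.Realize T (Fin.cons x v) A)]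
    · rfl
    · intro t x ht hx
      refine hb Z D V A b₀ t l _ T h (h.of_allCode hS hp) hA (ht.seqLen hS hs)
        ((numeral_le_numeral.2 (by omega)).trans hbl) hb₀ ?_
      refine Fin.cases ?_ fun i => ?_
      · simpa using hx
      · simpa using ht.reads hν hv i
  | allSet φ => exact hφ.elim

end Truth

/-! ### Arithmetical sets -/

section Closure

variable {N : Type u} [Zero N] [One N] [Add N] [Mul N] [LT N]

/-- The sets that are arithmetical in members of `C`. -/
def arClosure (C : Set (Set N)) : Set (Set N) :=
  {G | Ar C fun (_ : Fin 0 → Set N) (v : Fin 1 → N) => v 0 ∈ G}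

variable {S C : Set (Set N)} (hS : ModelsACA₀ S)

theorem subset_arClosure : C ⊆ arClosure C := fun _ hX => .memConst (.var 0) _ hX

theorem arSet_of_mem_arClosure {G : Set N} (hG : G ∈ arClosure C) {k m : ℕ} :
    ArSet C fun (_ : Fin k → Set N) (_ : Fin m → N) => G :=
  ⟨Ar.rel (P := fun _ (v : Fin 1 → N) => v 0 ∈ G) hG (F := Fin.elim0) (fun j => j.elim0)
    (σ := fun _ w => w 0) fun _ => .var 0⟩

include hS

theorem arClosure_subset (hC : C ⊆ S) : arClosure C ⊆ S := by
  intro G hG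
  obtain ⟨M, K, φ, v, A, hφ, hA, h⟩ := Ar.exists_formula_of_unary (P := fun x => x ∈ G) hG
  convert hS.comprehension φ hφ v A fun j => hC (hA j) using 1
  ext x
  exact (h S x).symm

/-- Induction is inherited because the closure is contained in `S`; comprehension holds because sets
arithmetical in arithmetical sets are arithmetical. -/
theorem modelsACA₀_arClosure (hC : C ⊆ S) : ModelsACA₀ (arClosure C) where
  add_one_ne_zero := hS.add_one_ne_zero
  add_one_inj := hS.add_one_inj
  add_zero := hS.add_zero
  add_succ := hS.add_succ
  mul_zero := hS.mul_zero
  mul_succ := hS.mul_succ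
  not_lt_zero := hS.not_lt_zero
  lt_succ := hS.lt_succ
  induction X hX := hS.induction X (arClosure_subset hS hC hX)
  comprehension φ hφ v A hA := by
    have := hφ.ar (C := C) (k := 0) (F := fun j _ _ => A j)
      (fun j => arSet_of_mem_arClosure (hA j))
      (σ := Fin.cons (fun w : Fin 1 → N => w 0) fun i _ => v i)
      (Fin.cases (.var 0) fun i => .const _) (arClosure C)
    refine cast (congrArg (Ar C) ?_) this
    funext B w
    refine congrArg (fun u => Formula.Realize (arClosure C) φ u A) ?_
    funext i
    refine Fin.cases ?_ (fun i => ?_) i <;> simp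

end Closure

/-! ### Arithmetical reducibility inside the model -/

section Reducibility

variable {N : Type u} [CommSemiring N] [LinearOrder N] [IsStrictOrderedRing N]
  [CanonicallyOrderedAdd N] {S : Set (Set N)} (hS : ModelsACA₀ S) {Z D V : Set N}
include hS

/-- Standardly many values can be collected in one assignment. -/
theorem exists_reads {m : ℕ} (v : Fin m → N) {L : N} (hL : numeral m ≤ L) :
    ∃ s, SeqLen s L ∧ Reads s (fun i : Fin m => (i : ℕ)) v := by
  suffices ∀ n ≤ m, ∃ s, SeqLen s L ∧ ∀ i : Fin m, (i : ℕ) < n → Entry s (numeral i) (v i) by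
    obtain ⟨s, hs, h⟩ := this m le_rfl
    exact ⟨s, hs, fun i => h i i.2⟩
  intro n
  induction n with
  | zero =>
    intro _
    obtain ⟨s, hs⟩ := exists_seq_const hS L
    exact ⟨s, hs, fun i hi => by omega⟩
  | succ n ih =>
    intro hn
    obtain ⟨s, hs, h⟩ := ih (by omega)
    obtain ⟨t, ht, htn⟩ := exists_variant hS hs ((numeral_lt_numeral.2 hn).trans_le hL)
      (v ⟨n, hn⟩)
    refine ⟨t, ht.seqLen hS hs, fun i hi => ?_⟩
    rcases Nat.lt_succ_iff_lt_or_eq.1 hi with hi | hi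
    · exact (ht.2 _ (numeral_lt_numeral.2 hi).ne _).1 (h i hi)
    · obtain rfl : i = ⟨n, hn⟩ := Fin.ext hi
      exact htn

theorem Reads.variant_zero {m : ℕ} {v : Fin m → N} {s t x y : N}
    (h : Reads s (fun i : Fin (m + 1) => (i : ℕ)) (Fin.cons y v : Fin (m + 1) → N))
    (ht : Variant 0 s t) (hx : Entry t 0 x) :
    Reads t (fun i : Fin (m + 1) => (i : ℕ)) (Fin.cons x v : Fin (m + 1) → N) := by
  refine Fin.cases ?_ fun i => ?_
  · simpa [numeral] using hx
  · have := (ht.2 _ (numeral_lt_numeral.2 (Nat.succ_pos i)).ne' _).1 (h i.succ)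
    simpa using this

omit hS in
theorem isValuation_empty : IsValuation Z (∅ : Set N) ∅ :=
  ⟨fun _ h => h.elim, fun _ _ h => h.elim, fun _ _ h => h.elim, fun _ _ _ h => h.elim,
    fun _ _ _ h => h.elim, fun _ h => h.elim, fun _ h => h.elim, fun _ _ h => h.elim,
    fun _ _ h => h.elim⟩

theorem empty_mem : (∅ : Set N) ∈ S := hS.setOf_mem fun _ => False

theorem IsValuation.defines_memCode (h : IsValuation Z D V) (hp : memCode 0 ∈ D) :
    Defines V (memCode 0) 0 Z := fun _ _ _ _ _ hx => h.mem_of_entry hS hp hx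

/-- There is a valuation for the atomic formula `v_0 ∈ Z`. -/
theorem exists_isValuation_memCode (hZ : Z ∈ S) :
    ∃ D ∈ S, ∃ V ∈ S, IsValuation Z D V ∧ memCode 0 ∈ D ∧ Defines V (memCode 0) 0 Z := by
  obtain ⟨D, hD, V, hV, h, -, hp⟩ := isValuation_empty.adjoin hS hZ (empty_mem hS) (empty_mem hS)
    (q := memCode 0) (.inr (.inr (.inr (.inr (.inl ⟨0, rfl⟩)))))
  exact ⟨D, hD, V, hV, h, hp, h.defines_memCode hS hp⟩

/-- The definition has no parameters, so any assignment of length `b + 1` can serve for them. -/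
theorem arithmeticalIn_of_defines (h : IsValuation Z D V) (hD : D ∈ S) (hV : V ∈ S) {p b : N}
    {G : Set N} (hp : p ∈ D) (hG : Defines V p b G) : ArithmeticalIn S G Z := by
  obtain ⟨s, hs⟩ := exists_seq_const hS (b + 1)
  refine ⟨D, hD, V, hV, h, p, hp, s, fun x => ?_⟩
  constructor
  · intro hx
    obtain ⟨t, ht, htx⟩ := exists_variant hS hs (i := 0)
      (add_pos_of_nonneg_of_pos zero_le one_pos) x
    exact ⟨t, ht, htx, (hG t _ x (ht.seqLen hS hs) le_self_add htx).2 hx⟩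
  · rintro ⟨t, ht, htx, hpt⟩
    exact (hG t _ x (ht.seqLen hS hs) le_self_add htx).1 hpt

/-- A set that is arithmetical in `Z` in the standard sense is arithmetically reducible to `Z`
inside the model. -/
theorem arithmeticalIn_of_mem_arClosure (hZ : Z ∈ S) {G : Set N} (hG : G ∈ arClosure {Z}) :
    ArithmeticalIn S G Z := by
  obtain ⟨m, k, φ, v, A, hφ, hA, hG⟩ := Ar.exists_formula_of_unary (P := fun x => x ∈ G) hG
  obtain ⟨D, hD, V, hV, h, hp, -⟩ := exists_isValuation_memCode hS hZ
  obtain ⟨E, hE, U, hU, h', hDE, hφE⟩ := extends_fmCode hS hZ (B := {memCode 0}) φ hφ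
    (fun _ => memCode 0) (fun _ => rfl) (fun i : Fin (m + 1) => (i : ℕ)) (m + 1) D hD V hV h
    (Set.singleton_subset_iff.2 hp)
  have hdef := h'.defines_memCode hS (hDE hp)
  obtain ⟨b, hb⟩ := fmCode_sound hS φ hφ (fun _ => memCode 0) (fun i : Fin (m + 1) => (i : ℕ))
    (m + 1) (fun i => i.2) (Nat.succ_pos m)
  obtain ⟨s, hs, hr⟩ := exists_reads hS (Fin.cons 0 v : Fin (m + 1) → N)
    (L := numeral (max b (m + 1))) (numeral_le_numeral.2 (le_max_right _ _))
  have key : ∀ t x, Variant 0 s t → Entry t 0 x →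
      (pair (fmCode φ (fun _ => memCode 0) (fun i : Fin (m + 1) => (i : ℕ)) (m + 1)) t ∈ U ↔
        x ∈ G) := by
    intro t x ht hx
    rw [hb Z E U A 0 t _ _ S h' hφE (fun j => by rwa [hA j]) (ht.seqLen hS hs)
      (numeral_le_numeral.2 (le_max_left _ _)) zero_le (hr.variant_zero hS ht hx), hG]
  refine ⟨E, hE, U, hU, h', _, hφE, s, fun x => ?_⟩
  constructor
  · intro hx
    obtain ⟨t, ht, htx⟩ := exists_variant hS hs (i := 0)
      (numeral_lt_numeral (a := 0).2 (lt_max_of_lt_right (Nat.succ_pos m))) x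
    exact ⟨t, ht, htx, (key t x ht htx).2 hx⟩
  · rintro ⟨t, ht, htx, hpt⟩
    exact (key t x ht htx).1 hpt

end Reducibility

/-! ### A tree that decides the existence of valuations -/

section TreeDefs

variable {N : Type u} [Zero N] [One N] [Add N] [Mul N] [LT N]

/-- Where a column stores whether `n ∈ Z`. -/
def zPos (n : N) : N := pair 0 n
/-- Where a column stores whether `p ∈ D`. -/
def dPos (p : N) : N := pair 1 p
/-- Where a column stores whether `(p, s) ∈ V`, or a witness for `(p, s) ∉ V`. -/
def vPos (p s : N) : N := pair (1 + 1) (pair p s)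

instance {m : ℕ} {t : (Fin m → N) → N} [IsTerm t] : IsTerm fun v => zPos (t v) := by
  unfold zPos; infer_instance

instance {m : ℕ} {t : (Fin m → N) → N} [IsTerm t] : IsTerm fun v => dPos (t v) := by
  unfold dPos; infer_instance

instance {m : ℕ} {t r : (Fin m → N) → N} [IsTerm t] [IsTerm r] :
    IsTerm fun v => vPos (t v) (r v) := by
  unfold vPos; infer_instance

/-- `p` is the code of an atomic formula other than `v_i ∈ Z`. -/
def IsAtom (p : N) : Prop :=
  (∃ i j, p = eqCode i j) ∨ (∃ i j, p = ltCode i j) ∨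
    (∃ i j k, p = addCode i j k) ∨ (∃ i j k, p = mulCode i j k)

instance {C : Set (Set N)} {k m : ℕ} {p : (Fin m → N) → N} [IsTerm p] :
    Ar C fun (_ : Fin k → Set N) v => IsAtom (p v) :=
  Ar.rel₁ (by unfold IsAtom; infer_instance) _

set_option synthInstance.maxSize 1000 in
instance {C : Set (Set N)} {k m : ℕ} {p s : (Fin m → N) → N} [IsTerm p] [IsTerm s] :
    Ar C fun (_ : Fin k → Set N) v => Tarski ∅ ∅ (p v) (s v) :=
  Ar.rel₂ (by unfold Tarski; infer_instance) _ _

/-- `D` and `V` are a valuation for a set `Z` that agrees with `X` on `R`, and `e` is a pair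
`(p, s)` such that `p ∈ D` is true under `s`. -/
def Solves (R X : Set N) (e : N) (Z D V : Set N) : Prop :=
  IsValuation Z D V ∧ (∀ n ∈ R, n ∈ Z ↔ n ∈ X) ∧
    ∃ p s l, e = pair p s ∧ SeqLen s l ∧ p ∈ D ∧ pair p s ∈ V

/-- The partial function `g` is consistent with coding sets `Z`, `D` and `V` such that
`Solves R X e Z D V`, together with witnesses for universal formulas that are false. -/
structure ColumnCond (R X : Set N) (e : N) (g : N → N → Prop) : Prop where
  root : ∃ p s l, e = pair p s ∧ SeqLen s l
  root_dom : ∀ p s, e = pair p s → ∀ y, g (dPos p) y → y = 0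
  root_val : ∀ p s, e = pair p s → ∀ y, g (vPos p s) y → y = 0
  agree : ∀ n ∈ R, ∀ y, g (zPos n) y → (y = 0 ↔ n ∈ X)
  shape : ∀ p, g (dPos p) 0 → IsAtom p ∨ (∃ i, p = memCode i) ∨ (∃ q, p = negCode q) ∨
    (∃ q r, p = andCode q r) ∨ ∃ i q, p = allCode i q
  dom_neg : ∀ p, g (dPos (negCode p)) 0 → ∀ y, g (dPos p) y → y = 0
  dom_and_left : ∀ p q, g (dPos (andCode p q)) 0 → ∀ y, g (dPos p) y → y = 0
  dom_and_right : ∀ p q, g (dPos (andCode p q)) 0 → ∀ y, g (dPos q) y → y = 0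
  dom_all : ∀ i p, g (dPos (allCode i p)) 0 → ∀ y, g (dPos p) y → y = 0
  atom : ∀ p s l, IsAtom p → SeqLen s l → g (dPos p) 0 → ∀ y, g (vPos p s) y →
    (y = 0 ↔ Tarski ∅ ∅ p s)
  mem : ∀ i s l, SeqLen s l → g (dPos (memCode i)) 0 → ∀ y, g (vPos (memCode i) s) y →
    ((∀ a, ¬ Entry s i a) → y ≠ 0) ∧ ∀ a, Entry s i a → ∀ y', g (zPos a) y' → (y = 0 ↔ y' = 0)
  neg : ∀ p s l, SeqLen s l → g (dPos (negCode p)) 0 → ∀ y, g (vPos (negCode p) s) y →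
    ∀ y', g (vPos p s) y' → (y = 0 ↔ y' ≠ 0)
  and : ∀ p q s l, SeqLen s l → g (dPos (andCode p q)) 0 → ∀ y, g (vPos (andCode p q) s) y →
    ∀ y', g (vPos p s) y' → ∀ y'', g (vPos q s) y'' → (y = 0 ↔ y' = 0 ∧ y'' = 0)
  all_true : ∀ i p s l, SeqLen s l → g (dPos (allCode i p)) 0 → g (vPos (allCode i p) s) 0 →
    ∀ t, Variant i s t → ∀ y, g (vPos p t) y → y = 0
  all_false : ∀ i p s l, SeqLen s l → g (dPos (allCode i p)) 0 →
    ∀ t, g (vPos (allCode i p) s) (t + 1) → Variant i s t ∧ ∀ y, g (vPos p t) y → y ≠ 0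

/-- Instance search for arithmetical definability works on the conjunction, not on the structure. -/
theorem columnCond_iff {R X : Set N} {e : N} {g : N → N → Prop} : ColumnCond R X e g ↔
    (∃ p s l, e = pair p s ∧ SeqLen s l) ∧
    (∀ p s, e = pair p s → ∀ y, g (dPos p) y → y = 0) ∧
    (∀ p s, e = pair p s → ∀ y, g (vPos p s) y → y = 0) ∧
    (∀ n ∈ R, ∀ y, g (zPos n) y → (y = 0 ↔ n ∈ X)) ∧
    (∀ p, g (dPos p) 0 → IsAtom p ∨ (∃ i, p = memCode i) ∨ (∃ q, p = negCode q) ∨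
      (∃ q r, p = andCode q r) ∨ ∃ i q, p = allCode i q) ∧
    (∀ p, g (dPos (negCode p)) 0 → ∀ y, g (dPos p) y → y = 0) ∧
    (∀ p q, g (dPos (andCode p q)) 0 → ∀ y, g (dPos p) y → y = 0) ∧
    (∀ p q, g (dPos (andCode p q)) 0 → ∀ y, g (dPos q) y → y = 0) ∧
    (∀ i p, g (dPos (allCode i p)) 0 → ∀ y, g (dPos p) y → y = 0) ∧
    (∀ p s l, IsAtom p → SeqLen s l → g (dPos p) 0 → ∀ y, g (vPos p s) y →
      (y = 0 ↔ Tarski ∅ ∅ p s)) ∧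
    (∀ i s l, SeqLen s l → g (dPos (memCode i)) 0 → ∀ y, g (vPos (memCode i) s) y →
      ((∀ a, ¬ Entry s i a) → y ≠ 0) ∧
        ∀ a, Entry s i a → ∀ y', g (zPos a) y' → (y = 0 ↔ y' = 0)) ∧
    (∀ p s l, SeqLen s l → g (dPos (negCode p)) 0 → ∀ y, g (vPos (negCode p) s) y →
      ∀ y', g (vPos p s) y' → (y = 0 ↔ y' ≠ 0)) ∧
    (∀ p q s l, SeqLen s l → g (dPos (andCode p q)) 0 → ∀ y, g (vPos (andCode p q) s) y →
      ∀ y', g (vPos p s) y' → ∀ y'', g (vPos q s) y'' → (y = 0 ↔ y' = 0 ∧ y'' = 0)) ∧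
    (∀ i p s l, SeqLen s l → g (dPos (allCode i p)) 0 → g (vPos (allCode i p) s) 0 →
      ∀ t, Variant i s t → ∀ y, g (vPos p t) y → y = 0) ∧
    (∀ i p s l, SeqLen s l → g (dPos (allCode i p)) 0 →
      ∀ t, g (vPos (allCode i p) s) (t + 1) → Variant i s t ∧ ∀ y, g (vPos p t) y → y ≠ 0) :=
  ⟨fun ⟨h₁, h₂, h₃, h₄, h₅, h₆, h₇, h₈, h₉, h₁₀, h₁₁, h₁₂, h₁₃, h₁₄, h₁₅⟩ =>
      ⟨h₁, h₂, h₃, h₄, h₅, h₆, h₇, h₈, h₉, h₁₀, h₁₁, h₁₂, h₁₃, h₁₄, h₁₅⟩,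
    fun ⟨h₁, h₂, h₃, h₄, h₅, h₆, h₇, h₈, h₉, h₁₀, h₁₁, h₁₂, h₁₃, h₁₄, h₁₅⟩ =>
      ⟨h₁, h₂, h₃, h₄, h₅, h₆, h₇, h₈, h₉, h₁₀, h₁₁, h₁₂, h₁₃, h₁₄, h₁₅⟩⟩

/-- The `e`-th column of a partial function `f`. -/
def column (f : N → N → Prop) (e : N) : N → N → Prop := fun j y => f (pair e (j + 1 + 1)) y

/-- The partial function `f` stores the set `X`, and its `e`-th column satisfies `ColumnCond`
whenever the value of `f` at `(e, 0)` is `0`. -/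
def TreeCond (R X : Set N) (f : N → N → Prop) : Prop :=
  -- Layout of a branch: `(x, 1)` stores `X`, `(e, 0)` is the flag of `e`, and `(e, j + 2)` is entry
  -- `j` of its column. Pairing increases in the second argument, so the flag precedes the column.
  (∀ x y, f (pair x 1) y → (y = 0 ↔ x ∈ X)) ∧
    ∀ e, f (pair e 0) 0 → ColumnCond R X e (column f e)

/-- The tree of the finite sequences that satisfy `TreeCond`. -/
def valuationTree (R X : Set N) : Set N := {σ | (∃ l, SeqLen σ l) ∧ TreeCond R X (Entry σ)}

set_option synthInstance.maxSize 2000 in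
set_option synthInstance.maxHeartbeats 400000 in
instance {C : Set (Set N)} {k m : ℕ} {R X : Set N} [Fact (R ∈ C)] [Fact (X ∈ C)]
    {σ : (Fin m → N) → N} [IsTerm σ] :
    Ar C fun (_ : Fin k → Set N) v => TreeCond R X (Entry (σ v)) :=
  Ar.rel₁ (R := fun s => TreeCond R X (Entry s))
    (by simp only [TreeCond, columnCond_iff, column]; infer_instance) _

/-- Values of the partial function occur only as hypotheses, so forgetting some of them preserves
every clause. This makes the set of good sequences a tree. -/
theorem ColumnCond.anti {R X : Set N} {e : N} {g g' : N → N → Prop} (h : ColumnCond R X e g')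
    (hg : ∀ j y, g j y → g' j y) : ColumnCond R X e g where
  root := h.root
  root_dom p s he y hy := h.root_dom p s he y (hg _ _ hy)
  root_val p s he y hy := h.root_val p s he y (hg _ _ hy)
  agree n hn y hy := h.agree n hn y (hg _ _ hy)
  shape p hp := h.shape p (hg _ _ hp)
  dom_neg p hp y hy := h.dom_neg p (hg _ _ hp) y (hg _ _ hy)
  dom_and_left p q hp y hy := h.dom_and_left p q (hg _ _ hp) y (hg _ _ hy)
  dom_and_right p q hp y hy := h.dom_and_right p q (hg _ _ hp) y (hg _ _ hy)
  dom_all i p hp y hy := h.dom_all i p (hg _ _ hp) y (hg _ _ hy)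
  atom p s l hp hs hd y hy := h.atom p s l hp hs (hg _ _ hd) y (hg _ _ hy)
  mem i s l hs hd y hy := ⟨(h.mem i s l hs (hg _ _ hd) y (hg _ _ hy)).1,
    fun a ha y' hy' => (h.mem i s l hs (hg _ _ hd) y (hg _ _ hy)).2 a ha y' (hg _ _ hy')⟩
  neg p s l hs hd y hy y' hy' := h.neg p s l hs (hg _ _ hd) y (hg _ _ hy) y' (hg _ _ hy')
  and p q s l hs hd y hy y' hy' y'' hy'' :=
    h.and p q s l hs (hg _ _ hd) y (hg _ _ hy) y' (hg _ _ hy') y'' (hg _ _ hy'')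
  all_true i p s l hs hd hv t ht y hy :=
    h.all_true i p s l hs (hg _ _ hd) (hg _ _ hv) t ht y (hg _ _ hy)
  all_false i p s l hs hd t ht :=
    ⟨(h.all_false i p s l hs (hg _ _ hd) t (hg _ _ ht)).1,
      fun y hy => (h.all_false i p s l hs (hg _ _ hd) t (hg _ _ ht)).2 y (hg _ _ hy)⟩

theorem TreeCond.anti {R X : Set N} {f f' : N → N → Prop} (h : TreeCond R X f')
    (hf : ∀ j y, f j y → f' j y) : TreeCond R X f :=
  ⟨fun x y hy => h.1 x y (hf _ _ hy), fun e he => (h.2 e (hf _ _ he)).anti fun _ _ => hf _ _⟩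

theorem isTree_valuationTree {R X : Set N} : IsTree (valuationTree R X) :=
  ⟨fun _ hs => hs.1, fun _ hs _ ht => ⟨ht.1, hs.2.anti ht.2.2⟩⟩

end TreeDefs

/-! ### Branches of the tree of valuations -/

section Tree

variable {N : Type u} [CommSemiring N] [LinearOrder N] [IsStrictOrderedRing N]
  [CanonicallyOrderedAdd N]

/-- Each clause inspects at most four positions. The witnesses for failing universal formulas are
what makes the quantifier clause local in this sense. -/
theorem ColumnCond.of_local {R X : Set N} {e : N} {g : N → N → Prop}
    (h : ∀ n, ∃ g', ColumnCond R X e g' ∧ ∀ j < n, ∀ y, g j y → g' j y) :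
    ColumnCond R X e g := by
  have h₃ : ∀ a b c d : N, ∃ g', ColumnCond R X e g' ∧ (∀ y, g a y → g' a y) ∧
      (∀ y, g b y → g' b y) ∧ (∀ y, g c y → g' c y) ∧ ∀ y, g d y → g' d y := by
    intro a b c d
    obtain ⟨g', h', hg⟩ := h (a + b + c + d + 1)
    have ha : (0 : N) ≤ a := zero_le
    have hb : (0 : N) ≤ b := zero_le
    have hc : (0 : N) ≤ c := zero_le
    have hd : (0 : N) ≤ d := zero_le
    have h₁ : (0 : N) < 1 := one_pos
    exact ⟨g', h', hg a (by grind), hg b (by grind), hg c (by grind), hg d (by grind)⟩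
  constructor
  · obtain ⟨g', h', -⟩ := h₃ 0 0 0 0
    exact h'.root
  · intro p s he y hy
    obtain ⟨g', h', h₁, -⟩ := h₃ (dPos p) 0 0 0
    exact h'.root_dom p s he y (h₁ _ hy)
  · intro p s he y hy
    obtain ⟨g', h', h₁, -⟩ := h₃ (vPos p s) 0 0 0
    exact h'.root_val p s he y (h₁ _ hy)
  · intro n hn y hy
    obtain ⟨g', h', h₁, -⟩ := h₃ (zPos n) 0 0 0
    exact h'.agree n hn y (h₁ _ hy)
  · intro p hp
    obtain ⟨g', h', h₁, -⟩ := h₃ (dPos p) 0 0 0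
    exact h'.shape p (h₁ _ hp)
  · intro p hp y hy
    obtain ⟨g', h', h₁, h₂, -⟩ := h₃ (dPos (negCode p)) (dPos p) 0 0
    exact h'.dom_neg p (h₁ _ hp) y (h₂ _ hy)
  · intro p q hp y hy
    obtain ⟨g', h', h₁, h₂, -⟩ := h₃ (dPos (andCode p q)) (dPos p) 0 0
    exact h'.dom_and_left p q (h₁ _ hp) y (h₂ _ hy)
  · intro p q hp y hy
    obtain ⟨g', h', h₁, h₂, -⟩ := h₃ (dPos (andCode p q)) (dPos q) 0 0
    exact h'.dom_and_right p q (h₁ _ hp) y (h₂ _ hy)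
  · intro i p hp y hy
    obtain ⟨g', h', h₁, h₂, -⟩ := h₃ (dPos (allCode i p)) (dPos p) 0 0
    exact h'.dom_all i p (h₁ _ hp) y (h₂ _ hy)
  · intro p s l hp hs hd y hy
    obtain ⟨g', h', h₁, h₂, -⟩ := h₃ (dPos p) (vPos p s) 0 0
    exact h'.atom p s l hp hs (h₁ _ hd) y (h₂ _ hy)
  · intro i s l hs hd y hy
    refine ⟨?_, fun a ha y' hy' => ?_⟩
    · obtain ⟨g', h', h₁, h₂, -⟩ := h₃ (dPos (memCode i)) (vPos (memCode i) s) 0 0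
      exact (h'.mem i s l hs (h₁ _ hd) y (h₂ _ hy)).1
    · obtain ⟨g', h', h₁, h₂, h₃, -⟩ := h₃ (dPos (memCode i)) (vPos (memCode i) s) (zPos a) 0
      exact (h'.mem i s l hs (h₁ _ hd) y (h₂ _ hy)).2 a ha y' (h₃ _ hy')
  · intro p s l hs hd y hy y' hy'
    obtain ⟨g', h', h₁, h₂, h₃, -⟩ := h₃ (dPos (negCode p)) (vPos (negCode p) s) (vPos p s) 0
    exact h'.neg p s l hs (h₁ _ hd) y (h₂ _ hy) y' (h₃ _ hy')
  · intro p q s l hs hd y hy y' hy' y'' hy''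
    obtain ⟨g', h', h₁, h₂, h₃, h₄⟩ :=
      h₃ (dPos (andCode p q)) (vPos (andCode p q) s) (vPos p s) (vPos q s)
    exact h'.and p q s l hs (h₁ _ hd) y (h₂ _ hy) y' (h₃ _ hy') y'' (h₄ _ hy'')
  · intro i p s l hs hd hv t ht y hy
    obtain ⟨g', h', h₁, h₂, h₃, -⟩ := h₃ (dPos (allCode i p)) (vPos (allCode i p) s) (vPos p t) 0
    exact h'.all_true i p s l hs (h₁ _ hd) (h₂ _ hv) t ht y (h₃ _ hy)
  · intro i p s l hs hd t ht
    refine ⟨?_, fun y hy => ?_⟩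
    · obtain ⟨g', h', h₁, h₂, -⟩ := h₃ (dPos (allCode i p)) (vPos (allCode i p) s) 0 0
      exact (h'.all_false i p s l hs (h₁ _ hd) t (h₂ _ ht)).1
    · obtain ⟨g', h', h₁, h₂, h₃, -⟩ :=
        h₃ (dPos (allCode i p)) (vPos (allCode i p) s) (vPos p t) 0
      exact (h'.all_false i p s l hs (h₁ _ hd) t (h₂ _ ht)).2 y (h₃ _ hy)

variable {S : Set (Set N)} (hS : ModelsACA₀ S) {R X : Set N}
include hS

theorem TreeCond.of_local {f : N → N → Prop}
    (h : ∀ n, ∃ f', TreeCond R X f' ∧ ∀ j < n, ∀ y, f j y → f' j y) : TreeCond R X f := by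
  refine ⟨fun x y hy => ?_, fun e he => .of_local fun n => ?_⟩
  · obtain ⟨f', h', hf⟩ := h (pair x 1 + 1)
    exact h'.1 x y (hf _ (lt_add_one _) y hy)
  · obtain ⟨f', h', hf⟩ := h (pair e (n + 1 + 1))
    have h0 : (0 : N) < n + 1 + 1 := add_pos_of_nonneg_of_pos zero_le one_pos
    exact ⟨column f' e, h'.2 e (hf _ (pair_lt_pair_right hS h0) _ he), fun j hj y hy =>
      hf _ (pair_lt_pair_right hS (by grind)) y hy⟩

/-- The condition is local, so it holds for a function once it holds for all its initial segments.
-/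
theorem isBranch_valuationTree {F : Set N} (hF : F ∈ S) : IsBranch (valuationTree R X) F ↔
    IsFunction F ∧ TreeCond R X fun x y => pair x y ∈ F := by
  refine and_congr_right fun hfun => ⟨fun h => ?_, fun h n => ?_⟩
  · refine .of_local hS fun n => ?_
    obtain ⟨s, ⟨-, hs⟩, hsn, h⟩ := h n
    refine ⟨Entry s, hs, fun j hj y hy => ?_⟩
    obtain ⟨z, hz, hz'⟩ := h j hj
    rwa [(hfun j).unique hy hz']
  · obtain ⟨s, hs, h'⟩ := exists_seq_of_isFunction hS hF hfun n
    refine ⟨s, ⟨⟨n, hs⟩, h.anti fun j y hy => ((h' j y).1 hy).2⟩, hs, fun i hi => ?_⟩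
    obtain ⟨y, hy⟩ := exists_entry hS hs hi
    exact ⟨y, hy, ((h' i y).1 hy).2⟩

/-- Uniformization of an arithmetical relation. -/
theorem exists_isFunction (Q : N → N → Prop)
    [hQ : Ar S fun (_ : Fin 0 → Set N) (v : Fin 2 → N) => Q (v 0) (v 1)] (h : ∀ x, ∃ y, Q x y) :
    ∃ F ∈ S, IsFunction F ∧ ∀ x y, pair x y ∈ F → Q x y := by
  have := fun m (t r : (Fin m → N) → N) [IsTerm t] [IsTerm r] => Ar.rel₂ (k := 0) hQ t r
  let F : Set N := {z | ∃ x y, z = pair x y ∧ Q x y ∧ ∀ y' < y, ¬ Q x y'}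
  have hF : ∀ x y, pair x y ∈ F ↔ Q x y ∧ ∀ y' < y, ¬ Q x y' := by
    intro x y
    constructor
    · rintro ⟨x', y', e, h⟩
      obtain ⟨rfl, rfl⟩ := (pair_inj hS).1 e
      exact h
    · exact fun h => ⟨x, y, rfl, h⟩
  refine ⟨F, hS.setOf_mem _, fun x => ?_, fun x y hy => ((hF x y).1 hy).1⟩
  obtain ⟨y, hy⟩ := h x
  obtain ⟨z, hz, hz'⟩ := exists_least hS (P := fun y => Q x y) hy
  refine ⟨z, (hF x z).2 ⟨hz, hz'⟩, fun w hw => ?_⟩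
  replace hw := (hF x w).1 hw
  exact le_antisymm (not_lt.1 fun h => hw.2 z h hz) (not_lt.1 fun h => hz' w h hw.1)

end Tree

/-! ### Decoding and encoding columns -/

section Columns

variable {N : Type u} [Zero N] [One N] [Add N] [Mul N] [LT N]

/-- The set `Z` stored in the `e`-th column of `F`. -/
def zSet (F : Set N) (e : N) : Set N := {n | pair (pair e (zPos n + 1 + 1)) 0 ∈ F}
/-- The set of formulas stored in the `e`-th column of `F`. -/
def dSet (F : Set N) (e : N) : Set N := {p | pair (pair e (dPos p + 1 + 1)) 0 ∈ F}
/-- The valuation stored in the `e`-th column of `F`. -/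
def vSet (F : Set N) (e : N) : Set N :=
  {z | ∃ p s, z = pair p s ∧ pair (pair e (vPos p s + 1 + 1)) 0 ∈ F}

instance {C : Set (Set N)} {k m : ℕ} {F : Set N} [Fact (F ∈ C)] {e : (Fin m → N) → N}
    [he : IsTerm e] : ArSet C fun (_ : Fin k → Set N) v => zSet F (e v) :=
  have := he.rename Fin.succ
  ⟨Ar.rel₂ (R := fun e x => x ∈ zSet F e) (by unfold zSet; infer_instance) _ fun w => w 0⟩

instance {C : Set (Set N)} {k m : ℕ} {F : Set N} [Fact (F ∈ C)] {e : (Fin m → N) → N}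
    [he : IsTerm e] : ArSet C fun (_ : Fin k → Set N) v => dSet F (e v) :=
  have := he.rename Fin.succ
  ⟨Ar.rel₂ (R := fun e x => x ∈ dSet F e) (by unfold dSet; infer_instance) _ fun w => w 0⟩

instance {C : Set (Set N)} {k m : ℕ} {F : Set N} [Fact (F ∈ C)] {e : (Fin m → N) → N}
    [he : IsTerm e] : ArSet C fun (_ : Fin k → Set N) v => vSet F (e v) :=
  have := he.rename Fin.succ
  ⟨Ar.rel₂ (R := fun e x => x ∈ vSet F e) (by unfold vSet; infer_instance) _ fun w => w 0⟩

/-- The value `y` at position `j` is correct for a column that stores `Z`, `D` and `V`. -/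
def ColumnValue (Z D V : Set N) (j y : N) : Prop :=
  (∀ n, j = zPos n → (y = 0 ↔ n ∈ Z)) ∧ (∀ p, j = dPos p → (y = 0 ↔ p ∈ D)) ∧
    ∀ p s, j = vPos p s → (y = 0 ↔ pair p s ∈ V) ∧
      ∀ i q u l, p = allCode i q → y = u + 1 → SeqLen s l → p ∈ D → Variant i s u ∧ pair q u ∉ V

instance {C : Set (Set N)} {k m : ℕ} {Z D V : Set N} [Fact (Z ∈ C)] [Fact (D ∈ C)] [Fact (V ∈ C)]
    {j y : (Fin m → N) → N} [IsTerm j] [IsTerm y] :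
    Ar C fun (_ : Fin k → Set N) v => ColumnValue Z D V (j v) (y v) :=
  Ar.rel₂ (by unfold ColumnValue; infer_instance) _ _

end Columns

/-! ### Flags of a leftmost branch -/

section Leftmost

variable {N : Type u} [CommSemiring N] [LinearOrder N] [IsStrictOrderedRing N]
  [CanonicallyOrderedAdd N] {S : Set (Set N)} (hS : ModelsACA₀ S) {R X : Set N}
include hS

theorem mem_vSet {F : Set N} {e p s : N} :
    pair p s ∈ vSet F e ↔ pair (pair e (vPos p s + 1 + 1)) 0 ∈ F := by
  constructor
  · rintro ⟨p', s', h, h'⟩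
    obtain ⟨rfl, rfl⟩ := (pair_inj hS).1 h
    exact h'
  · exact fun h => ⟨p, s, rfl, h⟩

theorem zPos_inj {a b : N} : zPos a = zPos b ↔ a = b := by simp [zPos, pair_inj hS]

theorem dPos_inj {a b : N} : dPos a = dPos b ↔ a = b := by simp [dPos, pair_inj hS]

theorem vPos_inj {a b c d : N} : vPos a b = vPos c d ↔ a = c ∧ b = d := by
  simp [vPos, pair_inj hS]

theorem zPos_ne_dPos {a b : N} : zPos a ≠ dPos b := by simp [zPos, dPos, pair_inj hS]

theorem zPos_ne_vPos {a b c : N} : zPos a ≠ vPos b c := fun h =>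
  hS.add_one_ne_zero _ ((pair_inj hS).1 h).1.symm

theorem dPos_ne_vPos {a b c : N} : dPos a ≠ vPos b c := by simp [vPos, dPos, pair_inj hS]

/-- A column of a branch yields a valuation. -/
theorem ColumnCond.solves {F : Set N} (hF : IsFunction F) {e : N}
    (h : ColumnCond R X e (column (fun x y => pair x y ∈ F) e)) :
    Solves R X e (zSet F e) (dSet F e) (vSet F e) := by
  set g := column (fun x y => pair x y ∈ F) e with hg
  have htot : ∀ j, ∃ y, g j y ∧ (g j 0 ↔ y = 0) := fun j => by
    obtain ⟨y, hy, hu⟩ := hF (pair e (j + 1 + 1))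
    refine ⟨y, hy, fun h => (hu _ h).symm, ?_⟩
    rintro rfl
    exact hy
  have hzero : ∀ j, (∀ y, g j y → y = 0) → g j 0 := fun j h => by
    obtain ⟨y, hy, h'⟩ := htot j
    exact h'.2 (h y hy)
  have hv : ∀ p s, pair p s ∈ vSet F e ↔ g (vPos p s) 0 := fun p s => mem_vSet hS
  refine ⟨⟨fun p hp => ?_, fun i j hp s l hs => ?_, fun i j hp s l hs => ?_,
    fun i j k hp s l hs => ?_, fun i j k hp s l hs => ?_, fun i hp s l hs => ?_,
    fun p hp s l hs => ?_, fun p q hp s l hs => ?_, fun i p hp s l hs => ?_⟩, fun n hn => ?_, ?_⟩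
  · rcases h.shape p hp with (h | h | h | h) | h | ⟨q, rfl⟩ | ⟨q, r, rfl⟩ | ⟨i, q, rfl⟩
    · exact .inl h
    · exact .inr (.inl h)
    · exact .inr (.inr (.inl h))
    · exact .inr (.inr (.inr (.inl h)))
    · exact .inr (.inr (.inr (.inr (.inl h))))
    · exact .inr (.inr (.inr (.inr (.inr (.inl ⟨q, hzero _ (h.dom_neg q hp), rfl⟩)))))
    · exact .inr (.inr (.inr (.inr (.inr (.inr (.inl ⟨q, hzero _ (h.dom_and_left q r hp), r,
        hzero _ (h.dom_and_right q r hp), rfl⟩))))))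
    · exact .inr (.inr (.inr (.inr (.inr (.inr (.inr ⟨i, q, hzero _ (h.dom_all i q hp), rfl⟩))))))
  · obtain ⟨y, hy, hy₀⟩ := htot (vPos (eqCode i j) s)
    rw [hv, hy₀, h.atom _ s l (.inl ⟨i, j, rfl⟩) hs hp y hy, tarski_eqCode hS]
  · obtain ⟨y, hy, hy₀⟩ := htot (vPos (ltCode i j) s)
    rw [hv, hy₀, h.atom _ s l (.inr (.inl ⟨i, j, rfl⟩)) hs hp y hy, tarski_ltCode hS]
  · obtain ⟨y, hy, hy₀⟩ := htot (vPos (addCode i j k) s)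
    rw [hv, hy₀, h.atom _ s l (.inr (.inr (.inl ⟨i, j, k, rfl⟩))) hs hp y hy, tarski_addCode hS]
  · obtain ⟨y, hy, hy₀⟩ := htot (vPos (mulCode i j k) s)
    rw [hv, hy₀, h.atom _ s l (.inr (.inr (.inr ⟨i, j, k, rfl⟩))) hs hp y hy, tarski_mulCode hS]
  · obtain ⟨y, hy, hy₀⟩ := htot (vPos (memCode i) s)
    obtain ⟨h₁, h₂⟩ := h.mem i s l hs hp y hy
    rw [hv, hy₀]
    constructor
    · intro hy'
      by_contra! hno
      refine h₁ (fun a ha => hno a ha ?_) hy'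
      obtain ⟨z, hz, hz₀⟩ := htot (zPos a)
      exact hz₀.2 ((h₂ a ha z hz).1 hy')
    · rintro ⟨a, ha, ha'⟩
      exact (h₂ a ha 0 ha').2 rfl
  · obtain ⟨y, hy, hy₀⟩ := htot (vPos (negCode p) s)
    obtain ⟨z, hz, hz₀⟩ := htot (vPos p s)
    rw [hv, hv, hy₀, hz₀, h.neg p s l hs hp y hy z hz]
  · obtain ⟨y, hy, hy₀⟩ := htot (vPos (andCode p q) s)
    obtain ⟨z, hz, hz₀⟩ := htot (vPos p s)
    obtain ⟨w, hw, hw₀⟩ := htot (vPos q s)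
    rw [hv, hv, hv, hy₀, hz₀, hw₀, h.and p q s l hs hp y hy z hz w hw]
  · simp only [hv]
    constructor
    · exact fun hy t ht => hzero _ (h.all_true i p s l hs hp hy t ht)
    · intro hall
      obtain ⟨y, hy, hy₀⟩ := htot (vPos (allCode i p) s)
      rw [hy₀]
      -- A nonzero entry is `t + 1` for a variant `t` that falsifies the body, contrary to `hall`.
      rcases eq_zero_or_eq_add_one hS y with rfl | ⟨t, rfl⟩
      · rfl
      · obtain ⟨ht, ht'⟩ := h.all_false i p s l hs hp t hy
        exact absurd rfl (ht' 0 (hall t ht))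
  · obtain ⟨y, hy, hy₀⟩ := htot (zPos n)
    exact hy₀.trans (h.agree n hn y hy)
  · obtain ⟨p, s, l, he, hs⟩ := h.root
    exact ⟨p, s, l, he, hs, hzero _ (h.root_dom p s he), (hv p s).2 (hzero _ (h.root_val p s he))⟩

/-- Membership is stored as `0` and non-membership as `1`, except that a false universal formula in
`D` stores the successor of a falsifying variant. -/
theorem exists_columnValue (Z : Set N) {D V : Set N} (h : IsValuation Z D V) (j : N) :
    ∃ y, ColumnValue Z D V j y := by
  classical
  by_cases h₁ : ∃ n, j = zPos n
  · obtain ⟨n, rfl⟩ := h₁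
    refine ⟨if n ∈ Z then 0 else 1, fun m hm => ?_, fun p hp => (zPos_ne_dPos hS hp).elim,
      fun p s hp => (zPos_ne_vPos hS hp).elim⟩
    obtain rfl := (zPos_inj hS).1 hm
    split_ifs <;> simp [*]
  by_cases h₂ : ∃ p, j = dPos p
  · obtain ⟨n, rfl⟩ := h₂
    refine ⟨if n ∈ D then 0 else 1, fun m hm => (zPos_ne_dPos hS hm.symm).elim, fun p hp => ?_,
      fun p s hp => (dPos_ne_vPos hS hp).elim⟩
    obtain rfl := (dPos_inj hS).1 hp
    split_ifs <;> simp [*]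
  by_cases h₃ : ∃ p s, j = vPos p s
  · obtain ⟨p, s, rfl⟩ := h₃
    suffices ∃ y : N, (y = 0 ↔ pair p s ∈ V) ∧ ∀ i q u l, p = allCode i q → y = u + 1 →
        SeqLen s l → p ∈ D → Variant i s u ∧ pair q u ∉ V by
      obtain ⟨y, hy⟩ := this
      refine ⟨y, fun m hm => (zPos_ne_vPos hS hm.symm).elim,
        fun p hp => (dPos_ne_vPos hS hp.symm).elim, fun p' s' hp => ?_⟩
      obtain ⟨rfl, rfl⟩ := (vPos_inj hS).1 hp
      exact hy
    by_cases hV : pair p s ∈ V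
    · exact ⟨0, by simp [hV], fun i q u l _ h => (hS.add_one_ne_zero _ h.symm).elim⟩
    by_cases hw : ∃ i q l, p = allCode i q ∧ SeqLen s l ∧ p ∈ D
    · obtain ⟨i, q, l, rfl, hs, hp⟩ := hw
      rw [h.all_iff i q hp s l hs] at hV
      push Not at hV
      obtain ⟨t, ht, ht'⟩ := hV
      refine ⟨t + 1, ?_, fun i' q' u l' e hu _ _ => ?_⟩
      · rw [h.all_iff i q hp s l hs]
        refine iff_of_false (hS.add_one_ne_zero _) fun h => ht' (h t ht)
      · obtain ⟨-, e⟩ := (pair_inj hS).1 e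
        obtain ⟨rfl, rfl⟩ := (pair_inj hS).1 e
        obtain rfl := hS.add_one_inj _ _ hu
        exact ⟨ht, ht'⟩
    · refine ⟨1, by simp [hV], fun i q u l e _ hs hp => (hw ⟨i, q, l, e, hs, hp⟩).elim⟩
  · exact ⟨0, fun n hn => (h₁ ⟨n, hn⟩).elim, fun p hp => (h₂ ⟨p, hp⟩).elim,
      fun p s hp => (h₃ ⟨p, s, hp⟩).elim⟩

/-- A valuation yields a column of a branch. -/
theorem Solves.columnCond {e : N} {Z D V : Set N} (h : Solves R X e Z D V) {g : N → N → Prop}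
    (hg : ∀ j y, g j y → ColumnValue Z D V j y) : ColumnCond R X e g := by
  obtain ⟨hval, hR, p₀, s₀, l₀, he, hs₀, hp₀, hV₀⟩ := h
  have hz : ∀ {n y}, g (zPos n) y → (y = 0 ↔ n ∈ Z) := fun h => (hg _ _ h).1 _ rfl
  have hd : ∀ {p y}, g (dPos p) y → (y = 0 ↔ p ∈ D) := fun h => (hg _ _ h).2.1 _ rfl
  have hd₀ : ∀ {p}, g (dPos p) 0 → p ∈ D := fun h => (hd h).1 rfl
  have hv : ∀ {p s y}, g (vPos p s) y → (y = 0 ↔ pair p s ∈ V) := fun h =>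
    ((hg _ _ h).2.2 _ _ rfl).1
  refine ⟨⟨p₀, s₀, l₀, he, hs₀⟩, fun p s he' y hy => ?_, fun p s he' y hy => ?_,
    fun n hn y hy => (hz hy).trans (hR n hn), fun p hp => ?_,
    fun p hp y hy => (hd hy).2 (hval.of_negCode hS (hd₀ hp)),
    fun p q hp y hy => (hd hy).2 (hval.of_andCode hS (hd₀ hp)).1,
    fun p q hp y hy => (hd hy).2 (hval.of_andCode hS (hd₀ hp)).2,
    fun i p hp y hy => (hd hy).2 (hval.of_allCode hS (hd₀ hp)), fun p s l hp hs hpd y hy => ?_,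
    fun i s l hs hpd y hy => ?_, fun p s l hs hpd y hy y' hy' => ?_,
    fun p q s l hs hpd y hy y' hy' y'' hy'' => ?_, fun i p s l hs hpd hy t ht y hy' => ?_,
    fun i p s l hs hpd t ht => ?_⟩
  · obtain ⟨rfl, rfl⟩ := (pair_inj hS).1 (he.symm.trans he')
    exact (hd hy).2 hp₀
  · obtain ⟨rfl, rfl⟩ := (pair_inj hS).1 (he.symm.trans he')
    exact (hv hy).2 hV₀
  · rcases hval.closed p (hd₀ hp) with h | h | h | h | h | ⟨q, -, rfl⟩ | ⟨q, -, r, -, rfl⟩ |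
      ⟨i, q, -, rfl⟩
    · exact .inl (.inl h)
    · exact .inl (.inr (.inl h))
    · exact .inl (.inr (.inr (.inl h)))
    · exact .inl (.inr (.inr (.inr h)))
    · exact .inr (.inl h)
    · exact .inr (.inr (.inl ⟨q, rfl⟩))
    · exact .inr (.inr (.inr (.inl ⟨q, r, rfl⟩)))
    · exact .inr (.inr (.inr (.inr ⟨i, q, rfl⟩)))
  · rw [hv hy]
    rcases hp with ⟨i, j, rfl⟩ | ⟨i, j, rfl⟩ | ⟨i, j, k, rfl⟩ | ⟨i, j, k, rfl⟩
    · rw [tarski_eqCode hS, hval.eq_iff i j (hd₀ hpd) s l hs]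
    · rw [tarski_ltCode hS, hval.lt_iff i j (hd₀ hpd) s l hs]
    · rw [tarski_addCode hS, hval.add_iff i j k (hd₀ hpd) s l hs]
    · rw [tarski_mulCode hS, hval.mul_iff i j k (hd₀ hpd) s l hs]
  · rw [Ne, hv hy, hval.mem_iff i (hd₀ hpd) s l hs]
    refine ⟨?_, fun a ha y' hy' => ?_⟩
    · rintro h ⟨a, ha, -⟩
      exact h a ha
    · rw [hz hy']
      constructor
      · rintro ⟨a', ha', h⟩
        rwa [ha.unique hS ha']
      · exact fun h => ⟨a, ha, h⟩
  · rw [Ne, hv hy, hv hy', hval.neg_iff p (hd₀ hpd) s l hs]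
  · rw [hv hy, hv hy', hv hy'', hval.and_iff p q (hd₀ hpd) s l hs]
  · exact (hv hy').2 ((hval.all_iff i p (hd₀ hpd) s l hs).1 ((hv hy).1 rfl) t ht)
  · obtain ⟨h₁, h₂⟩ := ((hg _ _ ht).2.2 _ _ rfl).2 i p t l rfl rfl hs (hd₀ hpd)
    exact ⟨h₁, fun y hy => fun h => h₂ ((hv hy).1 h)⟩

/-- With all flags equal to `1` no column is constrained. -/
theorem exists_branch_valuationTree (hX : X ∈ S) :
    ∃ H ∈ S, IsBranch (valuationTree R X) H := by
  have := Fact.mk hX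
  obtain ⟨H, hH, hfun, h⟩ := exists_isFunction hS
    (fun n y => (∀ x, n = pair x 1 → (y = 0 ↔ x ∈ X)) ∧ ∀ x, n = pair x 0 → y = 1) fun n => by
      by_cases hn : ∃ x ∈ X, n = pair x 1
      · obtain ⟨x, hx, rfl⟩ := hn
        refine ⟨0, fun x' h => ?_, fun x' h => ?_⟩
        · obtain ⟨rfl, -⟩ := (pair_inj hS).1 h
          simpa using hx
        · exact absurd ((pair_inj hS).1 h).2 one_ne_zero
      · refine ⟨1, fun x h => ?_, fun _ _ => rfl⟩
        simpa using fun hx => hn ⟨x, hx, h⟩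
  refine ⟨H, hH, (isBranch_valuationTree hS hH).2 ⟨hfun, fun x y hy => (h _ _ hy).1 x rfl,
    fun e he => ?_⟩⟩
  exact absurd ((h _ _ he).2 e rfl) zero_ne_one

/-- Replacing a column of a branch by a solution gives a branch to the left. -/
theorem exists_branch_left {F : Set N} (hF : F ∈ S) (hfun : IsFunction F)
    (hcond : TreeCond R X fun x y => pair x y ∈ F) {e : N} (he : pair (pair e 0) 0 ∉ F)
    {Z D V : Set N} (hZ : Z ∈ S) (hD : D ∈ S) (hV : V ∈ S) (h : Solves R X e Z D V) :
    ∃ G ∈ S, IsBranch (valuationTree R X) G ∧ LeftOf G F := by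
  have := Fact.mk hF
  have := Fact.mk hZ
  have := Fact.mk hD
  have := Fact.mk hV
  obtain ⟨G, hG, hGfun, hQ⟩ := exists_isFunction hS
    -- The flag of `e` becomes `0`, its column stores the solution, and all other positions are
    -- copied from `F`.
    (fun x y => (x = pair e 0 → y = 0) ∧ (∀ j, x = pair e (j + 1 + 1) → ColumnValue Z D V j y) ∧
      (x ≠ pair e 0 → (∀ j, x ≠ pair e (j + 1 + 1)) → pair x y ∈ F)) fun x => by
      by_cases h₁ : x = pair e 0
      · refine ⟨0, fun _ => rfl, fun j hj => ?_, fun h => (h h₁).elim⟩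
        rw [h₁] at hj
        exact absurd ((pair_inj hS).1 hj).2.symm (hS.add_one_ne_zero _)
      by_cases h₂ : ∃ j, x = pair e (j + 1 + 1)
      · obtain ⟨j, rfl⟩ := h₂
        obtain ⟨y, hy⟩ := exists_columnValue hS Z h.1 j
        refine ⟨y, fun h => (h₁ h).elim, fun j' hj => ?_, fun _ h => (h j rfl).elim⟩
        obtain rfl := hS.add_one_inj _ _ (hS.add_one_inj _ _ ((pair_inj hS).1 hj).2)
        exact hy
      · obtain ⟨y, hy⟩ := (hfun x).exists
        exact ⟨y, fun h => (h₁ h).elim, fun j hj => (h₂ ⟨j, hj⟩).elim, fun _ _ => hy⟩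
  have hother : ∀ e' j y, e' ≠ e → pair (pair e' j) y ∈ G → pair (pair e' j) y ∈ F :=
    fun e' j y he' hy => (hQ _ _ hy).2.2 (fun h => he' ((pair_inj hS).1 h).1)
      fun j h => he' ((pair_inj hS).1 h).1
  refine ⟨G, hG, (isBranch_valuationTree hS hG).2 ⟨hGfun, fun x y hy => ?_, fun e' he' => ?_⟩, ?_⟩
  · refine hcond.1 x y ((hQ _ _ hy).2.2 (fun h => ?_) fun j h => ?_)
    · exact one_ne_zero ((pair_inj hS).1 h).2
    · refine hS.add_one_ne_zero j (hS.add_one_inj _ _ ?_)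
      rw [zero_add]
      exact ((pair_inj hS).1 h).2.symm
  · by_cases hee : e' = e
    · subst hee
      exact h.columnCond hS fun j y hy => (hQ _ _ hy).2.1 j rfl
    · exact (hcond.2 e' (hother _ _ _ hee he')).anti fun j y hy => hother _ _ _ hee hy
  · obtain ⟨b, hb⟩ := (hfun (pair e 0)).exists
    obtain ⟨a, ha⟩ := (hGfun (pair e 0)).exists
    obtain rfl := (hQ _ _ ha).1 rfl
    have hb₀ : b ≠ 0 := by
      rintro rfl
      exact he hb
    -- The altered column lies entirely beyond the flag, so the flag is the first difference.
    have hlow : ∀ i < pair e 0, ∀ y, pair i y ∈ G → pair i y ∈ F := fun i hi y hy =>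
      (hQ _ _ hy).2.2 hi.ne fun j h => by
        rw [h] at hi
        exact absurd hi (pair_lt_pair_right hS
          (add_pos_of_nonneg_of_pos zero_le one_pos)).not_gt
    refine ⟨pair e 0, 0, b, ha, hb, pos_iff_ne_zero.2 hb₀, fun i hi y =>
      ⟨hlow i hi y, fun hy => ?_⟩⟩
    obtain ⟨z, hz⟩ := (hGfun i).exists
    rwa [(hfun i).unique hy (hlow i hi z hz)]

/-- The arithmetical leftmost path principle, applied to the tree of valuations. -/
theorem ALPP.exists_leftmost (hA : ALPP S) (hR : R ∈ S) (hX : X ∈ S) : ∃ F ∈ S, ∃ T ∈ S,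
    (∀ x, x ∈ X ↔ pair (pair x 1) 0 ∈ F) ∧
    (∀ e, pair (pair e 0) 0 ∈ F → Solves R X e (zSet F e) (dSet F e) (vSet F e)) ∧
    ∀ S', ModelsACA₀ S' → F ∈ S' → S' ⊆ S → (∀ G ∈ S', ArithmeticalIn S G (join T F)) →
      ∀ e, ∀ Z ∈ S', ∀ D ∈ S', ∀ V ∈ S', Solves R X e Z D V → pair (pair e 0) 0 ∈ F := by
  have := Fact.mk hR
  have := Fact.mk hX
  have hT : valuationTree R X ∈ S :=
    hS.setOf_mem fun s => (∃ l, SeqLen s l) ∧ TreeCond R X (Entry s)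
  obtain ⟨F, hF, hbr, hleft⟩ := hA _ hT isTree_valuationTree (exists_branch_valuationTree hS hX)
  obtain ⟨hfun, hcond⟩ := (isBranch_valuationTree hS hF).1 hbr
  refine ⟨F, hF, _, hT, fun x => ?_, fun e he => (hcond.2 e he).solves hS hfun, ?_⟩
  · obtain ⟨y, hy, hu⟩ := hfun (pair x 1)
    have := hcond.1 x y hy
    constructor
    · intro hx
      rwa [this.2 hx] at hy
    · intro h
      exact this.1 (hu _ h).symm
  · intro S' hS' hFS' hsub harith e Z hZ D hD V hV h
    by_contra he
    -- The new branch is built inside `S'`, so it is arithmetically reducible to `T ⊕ F` and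
    -- contradicts the choice of `F`.
    obtain ⟨G, hG, hGb, hGl⟩ := exists_branch_left hS' hFS' hfun hcond he hZ hD hV h
    exact hleft ⟨G, hsub hG, hGb, hGl, harith G hG⟩

end Leftmost

/-! ### An ω-model of the arithmetically definable sets -/

section DefinableDefs

variable {N : Type u} [Zero N] [One N] [Add N] [Mul N] [LT N]

theorem sect_mem {S : Set (Set N)} (hS : ModelsACA₀ S) {W : Set N} (hW : W ∈ S) (n : N) :
    sect W n ∈ S := by
  have := Fact.mk hW
  exact hS.setOf_mem fun x => x ∈ sect W n

theorem codedModel_subset {S : Set (Set N)} (hS : ModelsACA₀ S) {W : Set N} (hW : W ∈ S) :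
    codedModel W ⊆ S := by
  rintro _ ⟨n, rfl⟩
  exact sect_mem hS hW n

theorem join_mem {S : Set (Set N)} (hS : ModelsACA₀ S) {T F : Set N} (hT : T ∈ S) (hF : F ∈ S) :
    join T F ∈ S := by
  have := Fact.mk hT
  have := Fact.mk hF
  exact hS.setOf_mem fun x => x ∈ join T F

end DefinableDefs

section Definable

variable {N : Type u} [CommSemiring N] [LinearOrder N] [IsStrictOrderedRing N]
  [CanonicallyOrderedAdd N]

/-- The sets that are defined over `X`, without parameters, by a formula for which there is a
valuation in `S`. -/
def definableSets (S : Set (Set N)) (X : Set N) : Set (Set N) :=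
  {G | ∃ D ∈ S, ∃ V ∈ S, IsValuation X D V ∧ ∃ p ∈ D, ∃ b, Defines V p b G}

/-- The set of all `x` such that `p` is true under some assignment of length at least `b` that
gives the value `x` to `v_0`. -/
def truthSet (V : Set N) (p b : N) : Set N :=
  {x | ∃ s l, SeqLen s l ∧ b ≤ l ∧ Entry s 0 x ∧ pair p s ∈ V}

variable {S : Set (Set N)} (hS : ModelsACA₀ S) {X F : Set N}

instance {C : Set (Set N)} {k m : ℕ} [Fact (F ∈ C)] {e p b x : (Fin m → N) → N} [IsTerm e]
    [IsTerm p] [IsTerm b] [IsTerm x] :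
    Ar C fun (_ : Fin k → Set N) v => x v ∈ truthSet (vSet F (e v)) (p v) (b v) :=
  have h : Ar C fun (_ : Fin 0 → Set N) (v : Fin 4 → N) =>
      v 3 ∈ truthSet (vSet F (v 0)) (v 1) (v 2) := by
    show Ar C fun (_ : Fin 0 → Set N) (v : Fin 4 → N) =>
      ∃ s l, SeqLen s l ∧ v 2 ≤ l ∧ Entry s 0 (v 3) ∧ pair (v 1) s ∈ vSet F (v 0)
    infer_instance
  h.rel (F := Fin.elim0) (fun j => j.elim0) (σ := ![e, p, b, x]) (by simp [Fin.forall_fin_succ, *])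

theorem Defines.mono {V : Set N} {p b b' : N} {G : Set N} (h : Defines V p b G) (hb : b ≤ b') :
    Defines V p b' G :=
  fun s l x hs hl hx => h s l x hs (hb.trans hl) hx

theorem Defines.congr {D V V' : Set N} {p b : N} {G : Set N} (h : Defines V p b G)
    (hV : AgreeOn D V V') (hp : p ∈ D) : Defines V' p b G :=
  fun s l x hs hl hx => (hV p hp s l hs).symm.trans (h s l x hs hl hx)

include hS

theorem double_ne_double_add_one (x y : N) : x + x ≠ y + y + 1 := by
  rcases le_or_gt x y with h | h
  · exact ((add_le_add h h).trans_lt (lt_add_one _)).ne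
  · have h' := (add_one_le_iff_lt hS).2 h
    refine (lt_of_lt_of_le ?_ (add_le_add h' h')).ne'
    rw [show y + 1 + (y + 1) = y + y + 1 + 1 by ring]
    exact lt_add_one _

omit hS in
theorem double_inj {x y : N} : x + x = y + y ↔ x = y := by
  refine ⟨fun h => ?_, fun h => by rw [h]⟩
  rcases lt_trichotomy x y with h' | h' | h'
  · exact absurd h (add_lt_add h' h').ne
  · exact h'
  · exact absurd h (add_lt_add h' h').ne'

theorem mem_join_left {T F : Set N} {x : N} : x + x ∈ join T F ↔ x ∈ T := by
  constructor
  · rintro (⟨y, hy, h⟩ | ⟨y, hy, h⟩)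
    · rwa [double_inj.1 h]
    · exact absurd h (double_ne_double_add_one hS x y)
  · exact fun h => .inl ⟨x, h, rfl⟩

theorem mem_join_right {T F : Set N} {x : N} : x + x + 1 ∈ join T F ↔ x ∈ F := by
  constructor
  · rintro (⟨y, hy, h⟩ | ⟨y, hy, h⟩)
    · exact absurd h.symm (double_ne_double_add_one hS y x)
    · rwa [double_inj.1 (add_right_cancel h)]
  · exact fun h => .inr ⟨x, h, rfl⟩

theorem Defines.eq_truthSet {V : Set N} {p b : N} {G : Set N} (h : Defines V p b G) :
    truthSet V p b = G := by
  ext x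
  constructor
  · rintro ⟨s, l, hs, hl, hx, hp⟩
    exact (h s l x hs hl hx).1 hp
  · intro hx
    obtain ⟨s, hs⟩ := exists_seq_const hS (b + 1)
    obtain ⟨t, ht, htx⟩ := exists_variant hS hs (i := 0)
      (add_pos_of_nonneg_of_pos zero_le one_pos) x
    exact ⟨t, _, ht.seqLen hS hs, le_self_add, htx,
      (h t _ x (ht.seqLen hS hs) le_self_add htx).2 hx⟩

/-- Standardly many definable sets are defined over one valuation. -/
theorem exists_common_valuation {k : ℕ} (A : Fin k → Set N)
    (hA : ∀ j, A j ∈ definableSets S X) : ∃ D ∈ S, ∃ V ∈ S, IsValuation X D V ∧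
      ∃ b, ∀ j, ∃ p ∈ D, Defines V p b (A j) := by
  induction k with
  | zero => exact ⟨∅, empty_mem hS, ∅, empty_mem hS, isValuation_empty, 0, fun j => j.elim0⟩
  | succ k ih =>
    obtain ⟨D, hD, V, hV, h, b, hb⟩ := ih (fun j => A j.succ) fun j => hA j.succ
    obtain ⟨D', hD', V', hV', h', p, hp, b', hb'⟩ := hA 0
    obtain ⟨E, hE, U, hU, hEU, hDE, hDE'⟩ := h.merge hS h' hD hV hD' hV'
    refine ⟨E, hE, U, hU, hEU, max b b', Fin.cases ⟨p, hDE' hp, ?_⟩ fun j => ?_⟩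
    · exact (hb'.congr (h'.agree hS hEU hD' hV' hE hU) ⟨hp, hDE' hp⟩).mono (le_max_right _ _)
    · obtain ⟨q, hq, hq'⟩ := hb j
      exact ⟨q, hDE hq, (hq'.congr (h.agree hS hEU hD hV hE hU) ⟨hq, hDE hq⟩).mono
        (le_max_left _ _)⟩

/-- Defining formulas are substituted for the set variables, after all of them have been brought
into one valuation. Number parameters are not covered here. -/
theorem setOf_realize_mem_definableSets (hX : X ∈ S) {k : ℕ} (φ : Formula 1 k)
    (hφ : φ.IsArithmetical) (A : Fin k → Set N) (hA : ∀ j, A j ∈ definableSets S X)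
    (T : Set (Set N)) : {x | φ.Realize T (fun _ => x) A} ∈ definableSets S X := by
  obtain ⟨D, hD, V, hV, h, b₀, hb₀⟩ := exists_common_valuation hS A hA
  choose P hP hPA using hb₀
  obtain ⟨E, hE, U, hU, h', hDE, hφE⟩ := extends_fmCode hS hX (B := Set.range P) φ hφ P
    (fun j => ⟨j, rfl⟩) (fun i : Fin 1 => (i : ℕ)) 1 D hD V hV h
    (Set.range_subset_iff.2 hP)
  obtain ⟨b, hb⟩ := fmCode_sound hS φ hφ P (fun i : Fin 1 => (i : ℕ)) 1 (fun i => i.2) one_pos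
  refine ⟨E, hE, U, hU, h', _, hφE, max (numeral b) b₀, fun s l x hs hl hx => ?_⟩
  refine hb X E U A b₀ s l _ T h' hφE (fun j => ?_) hs ((le_max_left _ _).trans hl)
    ((le_max_right _ _).trans hl) fun i => ?_
  · exact (hPA j).congr (h.agree hS h' hD hV hE hU) ⟨hP j, hDE (hP j)⟩
  · obtain rfl := Subsingleton.elim i 0
    exact hx

theorem empty_mem_definableSets (hX : X ∈ S) : ∅ ∈ definableSets S X := by
  convert setOf_realize_mem_definableSets hS hX (.neg (.eq (.var 0) (.var 0)))
    (by simp [Formula.IsArithmetical]) Fin.elim0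
    (fun j => j.elim0) ∅ using 1
  ext x
  simp [Formula.Realize]

theorem self_mem_definableSets (hX : X ∈ S) : X ∈ definableSets S X := by
  obtain ⟨D, hD, V, hV, h, hp, h'⟩ := exists_isValuation_memCode hS hX
  exact ⟨D, hD, V, hV, h, _, hp, 0, h'⟩

/-- If the definable sets are coded in the model, then they form a model of `ACA₀`. -/
theorem modelsACA₀_of_eq_definableSets (hX : X ∈ S) {W : Set N} (hW : W ∈ S)
    (h : codedModel W = definableSets S X) : ModelsACA₀ (codedModel W) := by
  have hWf := Fact.mk hW
  have hsingle : ∀ a : N, {a} ∈ codedModel W := by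
    suffices ∀ a : N, ∃ n, ∀ x, x ∈ sect W n ↔ x = a by
      intro a
      obtain ⟨n, hn⟩ := this a
      exact ⟨n, Set.ext hn⟩
    -- Standard numerals reach only standard numbers. The code `W` turns definability of `{a}` into
    -- an arithmetical statement, so induction inside the model reaches every `a`.
    refine hS.ind (P := fun a => ∃ n, ∀ x, x ∈ sect W n ↔ x = a) ?_ fun a ha => ?_
    · obtain ⟨n, hn⟩ := h.ge (setOf_realize_mem_definableSets hS hX (.eq (.var 0) .zero)
        (by simp [Formula.IsArithmetical]) Fin.elim0 (fun j => j.elim0) ∅)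
      exact ⟨n, fun x => by rw [hn]; rfl⟩
    · obtain ⟨m, hm⟩ := ha
      obtain ⟨n, hn⟩ := h.ge (setOf_realize_mem_definableSets hS hX
        (.neg (.allNum (.neg (.and (.mem (.var 0) 0) (.eq (.var 1) (.add (.var 0) .one))))))
        (by simp [Formula.IsArithmetical]) (fun _ : Fin 1 => sect W m) (fun _ => h.le ⟨m, rfl⟩) ∅)
      refine ⟨n, fun x => ?_⟩
      rw [hn]
      simp [Formula.Realize, NumTerm.val, hm]
  have hcomp : ∀ {m k : ℕ} (φ : Formula (m + 1) k), φ.IsArithmetical →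
      ∀ (v : Fin m → N) (A : Fin k → Set N), (∀ j, A j ∈ codedModel W) →
        {x : N | φ.Realize (codedModel W) (Fin.cons x v : Fin (m + 1) → N) A} ∈ codedModel W := by
    intro m
    induction m with
    | zero =>
      intro k φ hφ v A hA
      rw [h] at hA
      convert h.ge (setOf_realize_mem_definableSets hS hX φ hφ A hA (codedModel W)) using 5
      rename_i x i
      exact Fin.cases rfl (fun i => i.elim0) i
    | succ m ih =>
      intro k φ hφ v A hA
      -- The number parameter `v 0` is traded for the set parameter `{v 0}`: the formula says that
      -- `φ` holds for every element of it. The swap restores the order of the first two variables.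
      convert ih (.allNum (.neg (.and (.mem (.var 0) 0)
        (.neg (φ.rename (Equiv.swap 0 1) Fin.succ))))) 
        (by simpa [Formula.IsArithmetical] using hφ.rename _ _) (Fin.tail v)
        (Fin.cons {v 0} A) (Fin.cases (hsingle _) hA) using 3 with x
      have hswap : (fun i => (Fin.cons (v 0) (Fin.cons x (Fin.tail v) : Fin (m + 1) → N) :
          Fin (m + 2) → N) (Equiv.swap 0 1 i)) = Fin.cons x v := by
        funext i
        refine Fin.cases (by simp) (fun i => Fin.cases (by simp) (fun i => ?_) i) i
        rw [Equiv.swap_apply_of_ne_of_ne (by simp) (by simp [Fin.ext_iff])]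
        simp [Fin.tail]
      simp [Formula.Realize, NumTerm.val, Formula.realize_rename, hswap]
  exact {
    add_one_ne_zero := hS.add_one_ne_zero
    add_one_inj := hS.add_one_inj
    add_zero := hS.add_zero
    add_succ := hS.add_succ
    mul_zero := hS.mul_zero
    mul_succ := hS.mul_succ
    not_lt_zero := hS.not_lt_zero
    lt_succ := hS.lt_succ
    induction := fun Y hY => hS.induction Y (codedModel_subset hS hW hY)
    comprehension := hcomp }

/-- A set that decides which valuations exist yields a code for the definable sets. -/
theorem exists_codedModel_eq_definableSets (hX : X ∈ S) (hF : F ∈ S)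
    (hF₁ : ∀ e, pair (pair e 0) 0 ∈ F →
      Solves Set.univ X e (zSet F e) (dSet F e) (vSet F e))
    (hF₂ : ∀ e, ∀ D ∈ S, ∀ V ∈ S, Solves Set.univ X e X D V → pair (pair e 0) 0 ∈ F) :
    ∃ W ∈ S, codedModel W = definableSets S X := by
  have hFf := Fact.mk hF
  have hd : ∀ e, dSet F e ∈ S := fun e => hS.setOf_mem fun x => x ∈ dSet F e
  have hv : ∀ e, vSet F e ∈ S := fun e => hS.setOf_mem fun x => x ∈ vSet F e
  have hval : ∀ e, pair (pair e 0) 0 ∈ F → IsValuation X (dSet F e) (vSet F e) := fun e he => by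
    obtain ⟨h, hz, -⟩ := hF₁ e he
    rwa [show zSet F e = X from Set.ext fun n => hz n trivial] at h
  -- An index `(e, p, b)` is good if the flag of `e` is `0` and, in column `e`, the truth of `p`
  -- depends only on the value of `v_0` for assignments of length at least `b`. Bad indices get the
  -- empty section.
  let Q : N → N → N → N → Prop := fun x e p b => (pair (pair e 0) 0 ∈ F ∧ p ∈ dSet F e ∧
    ∀ s l x, SeqLen s l → b ≤ l → Entry s 0 x →
      (pair p s ∈ vSet F e ↔ x ∈ truthSet (vSet F e) p b)) ∧ x ∈ truthSet (vSet F e) p b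
  let W : Set N := {w | ∃ x e p b, w = pair x (pair e (pair p b)) ∧ Q x e p b}
  have hW : W ∈ S := hS.setOf_mem fun w => ∃ x e p b, w = pair x (pair e (pair p b)) ∧ Q x e p b
  have hmem : ∀ x e p b, x ∈ sect W (pair e (pair p b)) ↔ Q x e p b := by
    intro x e p b
    constructor
    · rintro ⟨x', e', p', b', h, h'⟩
      simp only [pair_inj hS] at h
      obtain ⟨rfl, rfl, rfl, rfl⟩ := h
      exact h'
    · exact fun h => ⟨x, e, p, b, rfl, h⟩
  refine ⟨W, hW, Set.Subset.antisymm ?_ ?_⟩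
  · rintro _ ⟨n, rfl⟩
    by_cases hn : ∃ x, x ∈ sect W n
    · obtain ⟨x, x', e, p, b, hn, hQ⟩ := hn
      obtain ⟨-, rfl⟩ := (pair_inj hS).1 hn
      refine ⟨_, hd e, _, hv e, hval e hQ.1.1, p, hQ.1.2.1, b, ?_⟩
      convert (show Defines (vSet F e) p b _ from hQ.1.2.2) using 1
      ext y
      rw [hmem]
      exact and_iff_right hQ.1
    · convert empty_mem_definableSets hS hX
      ext x
      simpa using fun hx => hn ⟨x, hx⟩
  · rintro G ⟨D, hD, V, hV, h, p, hp, b, hb⟩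
    -- Flags speak of true formulas only, and `p` need not be true. The tautology `¬(p ∧ ¬p)` is
    -- true under the empty assignment and has `p` as a subformula, so its flag leads to a stored
    -- valuation for `p`.
    obtain ⟨D₁, hD₁, V₁, hV₁, h₁, hDD₁, hτ⟩ := Extends.neg hS hX (.and hS hX
      (.of_mem (Set.mem_singleton p)) (.neg hS hX (.of_mem (Set.mem_singleton p)))) D hD V hV h
      (Set.singleton_subset_iff.2 hp)
    set τ := negCode (andCode p (negCode p)) with hτ_def
    have hs₀ : SeqLen (pair 0 (pair 0 0) : N) 0 := ⟨0, 0, rfl⟩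
    have htrue : pair τ (pair 0 (pair 0 0)) ∈ V₁ := by
      have h₂ := h₁.of_negCode hS hτ
      have h₃ := (h₁.of_andCode hS h₂).2
      rw [h₁.neg_iff _ hτ _ _ hs₀, h₁.and_iff _ _ h₂ _ _ hs₀, h₁.neg_iff _ h₃ _ _ hs₀]
      exact fun h => h.2 h.1
    have he := hF₂ _ D₁ hD₁ V₁ hV₁ ⟨h₁, fun _ _ => Iff.rfl, τ, _, _, rfl, hs₀, hτ, htrue⟩
    obtain ⟨-, -, p', s', l', hps, -, hτ', -⟩ := hF₁ _ he
    obtain ⟨rfl, -⟩ := (pair_inj hS).1 hps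
    generalize pair τ (pair 0 (pair 0 0)) = e at he hτ'
    have hval := hval e he
    have hpe := (hval.of_andCode hS (hval.of_negCode hS hτ')).1
    have hdef : Defines (vSet F e) p b G :=
      hb.congr (h.agree hS hval hD hV (hd e) (hv e)) ⟨hp, hpe⟩
    refine ⟨pair e (pair p b), Set.ext fun x => ?_⟩
    rw [hmem]
    simp only [Q, hdef.eq_truthSet hS]
    exact and_iff_right ⟨he, hpe, hdef⟩

end Definable

/-! ### From the leftmost path principle to ω-models -/

section OmegaModels

variable {N : Type u} [CommSemiring N] [LinearOrder N] [IsStrictOrderedRing N]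
  [CanonicallyOrderedAdd N] {S : Set (Set N)} (hS : ModelsACA₀ S) {X : Set N}
include hS

theorem right_mem_of_join_mem {T F : Set N} (h : join T F ∈ S) : F ∈ S := by
  obtain ⟨J, hJ⟩ : ∃ J, J = join T F := ⟨_, rfl⟩
  have := Fact.mk (hJ ▸ h)
  convert hS.setOf_mem fun x => x + x + 1 ∈ J using 1
  ext x
  rw [hJ]
  exact (mem_join_right hS).symm

/-- Every set belongs to a coded ω-model of `ACA₀` whose members are arithmetically reducible
to it. -/
theorem ALPP.exists_codedModel (hA : ALPP S) (hX : X ∈ S) : ∃ W ∈ S, X ∈ codedModel W ∧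
    ModelsACA₀ (codedModel W) ∧ ∀ G ∈ codedModel W, ArithmeticalIn S G X := by
  obtain ⟨F, hF, T, hT, hXF, hF₁, hF₂⟩ := hA.exists_leftmost hS (R := Set.univ)
    (hS.setOf_mem fun _ => True) hX
  have hJ := join_mem hS hT hF
  have hJS : {join T F} ⊆ S := Set.singleton_subset_iff.2 hJ
  -- The flags are right about the sets arithmetical in `T ⊕ F`, and `F` is one of them. Definable
  -- sets are therefore taken relative to this smaller model.
  have hS' := modelsACA₀_arClosure hS hJS
  have hsub := arClosure_subset hS hJS
  have hF' : F ∈ arClosure {join T F} := right_mem_of_join_mem hS' (subset_arClosure rfl)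
  have := Fact.mk hF'
  have hX' : X ∈ arClosure {join T F} := by
    simpa only [← hXF, Set.ofPred_mem_eq] using hS'.setOf_mem fun x => pair (pair x 1) 0 ∈ F
  obtain ⟨W, hW, h⟩ := exists_codedModel_eq_definableSets hS' hX' hF' hF₁
    fun e D hD V hV => hF₂ _ hS' hF' hsub
      (fun G hG => arithmeticalIn_of_mem_arClosure hS hJ hG) e X hX' D hD V hV
  refine ⟨W, hsub hW, h.ge (self_mem_definableSets hS' hX'),
    modelsACA₀_of_eq_definableSets hS' hX' hW h, fun G hG => ?_⟩
  obtain ⟨D, hD, V, hV, hval, p, hp, b, hb⟩ := h.le hG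
  exact arithmeticalIn_of_defines hS hval (hsub hD) (hsub hV) hp hb

/-- A code of an arithmetical formula in two set variables, which are interpreted by the halves
of one set. -/
theorem exists_code_of_halves {m : ℕ} (φ : Formula (m + 1) 2) (hφ : φ.IsArithmetical) :
    ∃ (p : N) (b : ℕ), ∀ Z ∈ S, ∀ D ∈ S, ∀ V ∈ S, IsValuation Z D V →
      ∃ E ∈ S, ∃ U ∈ S, IsValuation Z E U ∧ D ⊆ E ∧ p ∈ E ∧
        ∀ s l v T, SeqLen s l → numeral b ≤ l → Reads s (fun i : Fin (m + 1) => (i : ℕ)) v →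
          (pair p s ∈ U ↔ φ.Realize T v
            (Fin.cons {y | y + y + 1 ∈ Z} fun _ => {y | y + y ∈ Z} : Fin 2 → Set N)) := by
  let φ₀ : Formula 1 1 := .mem (.add (.add (.var 0) (.var 0)) .one) 0
  let φ₁ : Formula 1 1 := .mem (.add (.var 0) (.var 0)) 0
  have hφ₀ : φ₀.IsArithmetical := trivial
  have hφ₁ : φ₁.IsArithmetical := trivial
  let ν : Fin 1 → ℕ := fun i => i
  let P : Fin 1 → N := fun _ => memCode 0
  let p₀ : N := fmCode φ₀ P ν 1
  let p₁ : N := fmCode φ₁ P ν 1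
  let Q : Fin 2 → N := Fin.cons p₀ fun _ => p₁
  obtain ⟨b₀, hb₀⟩ := fmCode_sound hS φ₀ hφ₀ P ν 1 (fun i => i.2) one_pos
  obtain ⟨b₁, hb₁⟩ := fmCode_sound hS φ₁ hφ₁ P ν 1 (fun i => i.2) one_pos
  obtain ⟨b, hb⟩ := fmCode_sound hS φ hφ Q (fun i => (i : ℕ)) (m + 1) (fun i => i.2)
    (Nat.succ_pos m)
  refine ⟨fmCode φ Q (fun i => (i : ℕ)) (m + 1), max b (max b₀ b₁), fun Z hZ D hD V hV h => ?_⟩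
  obtain ⟨D₁, hD₁, V₁, hV₁, h₁, hDD₁, hm₁⟩ := h.adjoin hS hZ hD hV
    (q := memCode 0) (.inr (.inr (.inr (.inr (.inl ⟨0, rfl⟩)))))
  obtain ⟨D₂, hD₂, V₂, hV₂, h₂, hDD₂, hp₀⟩ := extends_fmCode hS hZ φ₀ hφ₀ P
    (B := {memCode 0}) (fun _ => rfl) ν 1 D₁ hD₁ V₁ hV₁ h₁ (Set.singleton_subset_iff.2 hm₁)
  obtain ⟨D₃, hD₃, V₃, hV₃, h₃, hDD₃, hp₁⟩ := extends_fmCode hS hZ φ₁ hφ₁ P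
    (B := {memCode 0}) (fun _ => rfl) ν 1 D₂ hD₂ V₂ hV₂ h₂
    (Set.singleton_subset_iff.2 (hDD₂ hm₁))
  obtain ⟨E, hE, U, hU, h', hDE, hp⟩ := extends_fmCode hS hZ φ hφ Q (B := Set.range Q)
    (fun j => ⟨j, rfl⟩) (fun i => (i : ℕ)) (m + 1) D₃ hD₃ V₃ hV₃ h₃ (by
      rintro _ ⟨j, rfl⟩
      exact Fin.cases (hDD₃ hp₀) (fun _ => hp₁) j)
  refine ⟨E, hE, U, hU, h', hDD₁.trans (hDD₂.trans (hDD₃.trans hDE)), hp,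
    fun s l v T hs hl hv => ?_⟩
  have hmem : ∀ j, Defines U (P j) 0 Z := fun _ =>
    h'.defines_memCode hS (hDE (hDD₃ (hDD₂ hm₁)))
  have hread : ∀ {s x : N}, Entry s 0 x → Reads s ν fun _ => x := fun hx i => by
    obtain rfl := Subsingleton.elim i 0
    exact hx
  have hdef : ∀ j, Defines U (Q j) (numeral (max b₀ b₁))
      ((Fin.cons {y | y + y + 1 ∈ Z} fun _ => {y | y + y ∈ Z} : Fin 2 → Set N) j) := by
    refine Fin.cases ?_ fun _ => ?_
    · intro s l x hs hl hx
      exact hb₀ Z E U (fun _ => Z) 0 s l (fun _ => x) ∅ h' (hDE (hDD₃ hp₀)) hmem hs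
        ((numeral_le_numeral.2 (le_max_left _ _)).trans hl) zero_le (hread hx)
    · intro s l x hs hl hx
      exact hb₁ Z E U (fun _ => Z) 0 s l (fun _ => x) ∅ h' (hDE hp₁) hmem hs
        ((numeral_le_numeral.2 (le_max_right _ _)).trans hl) zero_le (hread hx)
  exact hb Z E U _ _ s l v T h' hp hdef hs ((numeral_le_numeral.2 (le_max_left _ _)).trans hl)
    ((numeral_le_numeral.2 (le_max_right _ _)).trans hl) hv

/-- The leftmost branch `F` decides `Σ¹₁` statements about `X` for any ω-model of `ACA₀` that
contains `F` and has only members arithmetically reducible to `T ⊕ F`. -/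
theorem ALPP.pseudoPi11CA (hA : ALPP S) : PseudoPi11CA S := by
  intro X hX
  set R : Set N := {n | ∃ x, n = x + x} with hR
  have hRS : R ∈ S := hS.setOf_mem _
  -- Only the even half of `Z` is prescribed, namely as `X`; the odd half is free and plays the
  -- existentially quantified set.
  obtain ⟨F, hF, T, hT, hXF, hF₁, hF₂⟩ := hA.exists_leftmost hS hRS (join_mem hS hX (empty_mem hS))
  obtain ⟨W, hW, hJM, hM, harith⟩ := hA.exists_codedModel hS (join_mem hS hT hF)
  have hsub := codedModel_subset hS hW
  have hFM : F ∈ codedModel W := right_mem_of_join_mem hM hJM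
  have hFf := Fact.mk hFM
  have hXM : X ∈ codedModel W := by
    simpa only [← hXF, mem_join_left hS, Set.ofPred_mem_eq] using
      hM.setOf_mem fun x => pair (pair (x + x) 1) 0 ∈ F
  refine ⟨W, hW, hXM, hM, ?_⟩
  rintro m _ ⟨θ, hθ, rfl⟩ v
  obtain ⟨p, b, hp⟩ := exists_code_of_halves hM (.neg θ) hθ
  obtain ⟨s, hs, hv⟩ := exists_reads hM (Fin.cons 0 v : Fin (m + 1) → N)
    (L := numeral (max b (m + 1))) (numeral_le_numeral.2 (le_max_right _ _))
  -- Here `p` codes the negation of `θ`, so flag `0` at `(p, t)` says that some `Y` in the ω-model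
  -- refutes `θ` at `x`. This is arithmetical in `F`, a member of that model.
  convert hM.setOf_mem fun x =>
    ¬ ∃ t, Variant 0 s t ∧ Entry t 0 x ∧ pair (pair (pair p t) 0) 0 ∈ F using 1
  ext x
  simp only [Set.mem_ofPred_eq, Formula.Realize]
  rw [← not_iff_not, not_not]
  push Not
  constructor
  · rintro ⟨Y, hY, h⟩
    obtain ⟨E, hE, U, hU, hval, -, hpE, hpU⟩ := hp _ (join_mem hM hXM hY) _ (empty_mem hM) _
      (empty_mem hM) isValuation_empty
    obtain ⟨t, ht, htx⟩ := exists_variant hM hs (i := 0)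
      (numeral_lt_numeral (a := 0).2 (lt_max_of_lt_right (Nat.succ_pos m))) x
    refine ⟨t, ht, htx, hF₂ _ hM hFM hsub harith _ _ (join_mem hM hXM hY) _ hE _ hU
      ⟨hval, ?_, p, t, _, rfl, ht.seqLen hM hs, hpE, ?_⟩⟩
    · rintro _ ⟨y, rfl⟩
      rw [mem_join_left hM, mem_join_left hM]
    · refine (hpU t _ _ (codedModel W) (ht.seqLen hM hs)
        (numeral_le_numeral.2 (le_max_left _ _)) (hv.variant_zero hM ht htx)).2 ?_
      simpa only [mem_join_left hM, mem_join_right hM, Set.ofPred_mem_eq, Formula.Realize] using h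
  · rintro ⟨t, ht, htx, he⟩
    -- The column is computed from `F`, so the solution and its odd half `Y` lie in the ω-model.
    have hval := hF₁ _ he
    have hZ : zSet F (pair p t) ∈ codedModel W := hM.setOf_mem fun x => x ∈ zSet F (pair p t)
    have hD : dSet F (pair p t) ∈ codedModel W := hM.setOf_mem fun x => x ∈ dSet F (pair p t)
    have hV : vSet F (pair p t) ∈ codedModel W := hM.setOf_mem fun x => x ∈ vSet F (pair p t)
    generalize zSet F (pair p t) = Z at *
    generalize dSet F (pair p t) = D at *
    generalize vSet F (pair p t) = V at *
    obtain ⟨hval, hagree, p', t', l, hpt, -, hpD, hpV⟩ := hval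
    obtain ⟨rfl, rfl⟩ := (pair_inj hM).1 hpt
    obtain ⟨E, hE, U, hU, hval', hDE, -, hpU⟩ := hp Z hZ D hD V hV hval
    have hpU' := (hval.agree hM hval' hD hV hE hU p ⟨hpD, hDE hpD⟩ t _ (ht.seqLen hM hs)).1 hpV
    have := Fact.mk hZ
    refine ⟨{y | y + y + 1 ∈ Z}, hM.setOf_mem fun y => y + y + 1 ∈ Z, ?_⟩
    have hX' : {y | y + y ∈ Z} = X := by
      ext y
      rw [Set.mem_ofPred_eq, hagree _ ⟨y, rfl⟩, mem_join_left hM]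
    have := (hpU t _ _ (codedModel W) (ht.seqLen hM hs)
        (numeral_le_numeral.2 (le_max_left _ _)) (hv.variant_zero hM ht htx)).1 hpU'
    rwa [hX'] at this

end OmegaModels

/-! ### From ω-models to the leftmost path principle -/

section LeftmostPath

variable {N : Type u} [CommSemiring N] [LinearOrder N] [IsStrictOrderedRing N]
  [CanonicallyOrderedAdd N] {S : Set (Set N)} (hS : ModelsACA₀ S) {T B W : Set N}

/-- `σ` is a sequence of length `n` outside of `B`, and each of its entries is least possible for
sequences outside of `B`, given the previous entries. -/
def IsLeftmost (B : Set N) (σ n : N) : Prop :=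
  SeqLen σ n ∧ σ ∉ B ∧ ∀ i τ, τ ∉ B → (∀ j < i, ∀ y, Entry τ j y ↔ Entry σ j y) →
    ∀ a b, Entry τ i a → Entry σ i b → b ≤ a

instance {C : Set (Set N)} {k m : ℕ} [Fact (B ∈ C)] {σ n : (Fin m → N) → N} [IsTerm σ]
    [IsTerm n] : Ar C fun (_ : Fin k → Set N) v => IsLeftmost B (σ v) (n v) :=
  Ar.rel₂ (by unfold IsLeftmost; infer_instance) _ _

/-- `G` is a branch of `T` that extends the sequence coded by `σ`. -/
def IsBranchThrough (T G : Set N) (σ : N) : Prop :=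
  IsBranch T G ∧ ∀ i y, Entry σ i y → pair i y ∈ G

include hS

theorem left_mem_of_join_mem {T F : Set N} (h : join T F ∈ S) : T ∈ S := by
  obtain ⟨J, hJ⟩ : ∃ J, J = join T F := ⟨_, rfl⟩
  have := Fact.mk (hJ ▸ h)
  convert hS.setOf_mem fun x => x + x ∈ J using 1
  ext x
  rw [hJ]
  exact (mem_join_left hS).symm

/-- At the first possible disagreement each sequence competes with the other, so each of the two
entries is at most the other. -/
theorem IsLeftmost.entry_iff {σ n τ m : N} (h : IsLeftmost B σ n)
    (h' : IsLeftmost B τ m) : ∀ i, i < n → i < m → ∀ y, Entry σ i y ↔ Entry τ i y := by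
  refine strong_ind hS (P := fun i => i < n → i < m → ∀ y, Entry σ i y ↔ Entry τ i y)
    fun i ih hn hm y => ?_
  have hlow : ∀ j < i, ∀ y, Entry σ j y ↔ Entry τ j y := fun j hj =>
    ih j hj (hj.trans hn) (hj.trans hm)
  obtain ⟨a, ha⟩ := exists_entry hS h.1 hn
  obtain ⟨b, hb⟩ := exists_entry hS h'.1 hm
  have hab : a = b := le_antisymm
    (h.2.2 i τ h'.2.1 (fun j hj y => (hlow j hj y).symm) b a hb ha)
    (h'.2.2 i σ h.2.1 hlow a b ha hb)
  subst hab
  constructor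
  · intro hy
    rwa [hy.unique hS ha]
  · intro hy
    rwa [hy.unique hS hb]

/-- If `B` is the set of the sequences that do not lie on a branch in the model, then there is a
leftmost branch. -/
theorem exists_leftmost_branch (hBS : B ∈ S)
    (hB : ∀ σ, σ ∉ B ↔ ∃ G ∈ S, IsBranchThrough T G σ) (hT : ∃ H ∈ S, IsBranch T H) :
    ∃ F ∈ S, IsBranch T F ∧ ¬ ∃ G ∈ S, IsBranch T G ∧ LeftOf G F := by
  have hBf := Fact.mk hBS
  have hsegment : ∀ G ∈ S, IsBranch T G → ∀ n, ∃ s, SeqLen s n ∧ s ∉ B ∧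
      ∀ i y, Entry s i y ↔ i < n ∧ pair i y ∈ G := fun G hG h n => by
    obtain ⟨s, hs, h'⟩ := exists_seq_of_isFunction hS hG h.1 n
    exact ⟨s, hs, (hB s).2 ⟨G, hG, h, fun i y hy => ((h' i y).1 hy).2⟩, h'⟩
  have hex : ∀ n, ∃ σ, IsLeftmost B σ n := by
    refine hS.ind (P := fun n => ∃ σ, IsLeftmost B σ n) ?_ fun n hn => ?_
    · obtain ⟨H, hH, h⟩ := hT
      obtain ⟨s, hs, hsB, h'⟩ := hsegment H hH h 0
      exact ⟨s, hs, hsB, fun i τ _ _ a b _ hb => absurd ((h' i b).1 hb).1 (hS.not_lt_zero i)⟩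
    · obtain ⟨σ, hσ, hσB, hmin⟩ := hn
      have hstep : ∃ a τ, τ ∉ B ∧ (∀ j < n, ∀ y, Entry τ j y ↔ Entry σ j y) ∧ Entry τ n a := by
        obtain ⟨G, hG, hbr, hGσ⟩ := (hB σ).1 hσB
        obtain ⟨s, hs, hsB, h'⟩ := hsegment G hG hbr (n + 1)
        obtain ⟨a, ha⟩ := exists_entry hS hs (lt_add_one n)
        refine ⟨a, s, hsB, fun j hj y => ?_, ha⟩
        obtain ⟨z, hz⟩ := exists_entry hS hσ hj
        rw [h']
        constructor
        · intro h
          rwa [(hbr.1 j).unique h.2 (hGσ j z hz)]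
        · exact fun h => ⟨hj.trans (lt_add_one n), hGσ j y h⟩
      obtain ⟨a₀, ha₀⟩ := hstep
      obtain ⟨a, ⟨τ, hτ, hτσ, hτa⟩, hleast⟩ := exists_least hS
        (P := fun a => ∃ τ, τ ∉ B ∧ (∀ j < n, ∀ y, Entry τ j y ↔ Entry σ j y) ∧ Entry τ n a) ha₀
      -- The length of `τ` is unknown; the segment of length `n + 1` of a branch through `τ`
      -- replaces it.
      obtain ⟨G, hG, hbr, hGτ⟩ := (hB τ).1 hτ
      obtain ⟨s, hs, hsB, h'⟩ := hsegment G hG hbr (n + 1)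
      have hsσ : ∀ j < n, ∀ y, Entry s j y ↔ Entry σ j y := fun j hj y => by
        obtain ⟨z, hz⟩ := exists_entry hS hσ hj
        rw [h', ← hτσ j hj]
        rw [← hτσ j hj] at hz
        constructor
        · intro h
          rwa [(hbr.1 j).unique h.2 (hGτ j z hz)]
        · exact fun h => ⟨hj.trans (lt_add_one n), hGτ j y h⟩
      refine ⟨s, hs, hsB, fun i ρ hρ hlow c b hc hb => ?_⟩
      rcases (hS.lt_succ i n).1 ((h' i b).1 hb).1 with hi | rfl
      · exact hmin i ρ hρ (fun j hj y => (hlow j hj y).trans (hsσ j (hj.trans hi) y)) c b hc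
          ((hsσ i hi b).1 hb)
      · rw [(hbr.1 i).unique ((h' i b).1 hb).2 (hGτ i a hτa)]
        exact not_lt.1 fun hca => hleast c hca
          ⟨ρ, hρ, fun j hj y => (hlow j hj y).trans (hsσ j hj y), hc⟩
  let F : Set N := {z | ∃ i y, z = pair i y ∧ ∃ σ n, IsLeftmost B σ n ∧ Entry σ i y}
  have hF : ∀ i y, pair i y ∈ F ↔ ∃ σ n, IsLeftmost B σ n ∧ Entry σ i y := by
    intro i y
    constructor
    · rintro ⟨i', y', e, h⟩
      obtain ⟨rfl, rfl⟩ := (pair_inj hS).1 e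
      exact h
    · exact fun h => ⟨i, y, rfl, h⟩
  have hfun : IsFunction F := by
    intro i
    obtain ⟨σ, hσ⟩ := hex (i + 1)
    obtain ⟨y, hy⟩ := exists_entry hS hσ.1 (lt_add_one i)
    refine ⟨y, (hF i y).2 ⟨σ, _, hσ, hy⟩, fun z hz => ?_⟩
    obtain ⟨τ, m, hτ, hz⟩ := (hF i z).1 hz
    exact ((hσ.entry_iff hS hτ i (lt_add_one i) (hz.lt hS hτ.1) z).2 hz).unique hS hy
  refine ⟨F, hS.setOf_mem _, ⟨hfun, fun n => ?_⟩, ?_⟩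
  -- The leftmost sequence of length `n` lies on a branch `G` of `T`, whose node of that length
  -- codes the same sequence as the segment of `F`.
  · obtain ⟨σ, hσ⟩ := hex n
    obtain ⟨G, hG, hbr, hGσ⟩ := (hB σ).1 hσ.2.1
    obtain ⟨s, hs, hsn, h⟩ := hbr.2 n
    refine ⟨s, hs, hsn, fun i hi => ?_⟩
    obtain ⟨y, hy, hyG⟩ := h i hi
    obtain ⟨z, hz⟩ := exists_entry hS hσ.1 hi
    obtain rfl := (hbr.1 i).unique hyG (hGσ i z hz)
    exact ⟨y, hy, (hF i y).2 ⟨σ, n, hσ, hz⟩⟩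
  · rintro ⟨G, hG, hbr, n, a, b, ha, hb, hab, hlow⟩
    obtain ⟨σ, m, hσ, hσb⟩ := (hF n b).1 hb
    -- A branch to the left of `F` would have a segment outside `B` with an entry smaller than the
    -- least possible one.
    obtain ⟨s, hs, hsB, h'⟩ := hsegment G hG hbr (n + 1)
    refine absurd (hσ.2.2 n s hsB (fun j hj y => ?_) a b ((h' n a).2 ⟨lt_add_one n, ha⟩) hσb)
      hab.not_ge
    obtain ⟨z, hz⟩ := exists_entry hS hσ.1 (hj.trans (hσb.lt hS hσ.1))
    have hzF := (hF j z).2 ⟨σ, m, hσ, hz⟩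
    rw [h', hlow j hj]
    constructor
    · intro h
      rwa [(hfun j).unique h.2 hzF]
    · intro h
      rw [h.unique hS hz]
      exact ⟨hj.trans (lt_add_one n), hzF⟩

/-- A coded ω-model of `ACA₀` is closed under arithmetical reducibility in the sense of the ambient
model. -/
theorem mem_codedModel_of_arithmeticalIn (hW : W ∈ S) (hM : ModelsACA₀ (codedModel W)) {Z G : Set N}
    (hZ : Z ∈ codedModel W) (hG : ArithmeticalIn S G Z) : G ∈ codedModel W := by
  obtain ⟨D, hD, V, hV, h, p, hp, s, hs⟩ := hG
  have := Fact.mk hW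
  have := Fact.mk hD
  have := Fact.mk hV
  have := Fact.mk hZ
  -- The valuation `V` itself need not belong to the ω-model. The claim for one formula is
  -- arithmetical in `W`, `D` and `V`, so it is proved by induction in `S`, with one use of
  -- comprehension in the ω-model per connective.
  have key : ∀ p, p ∈ D → ∃ n, ∀ s l, SeqLen s l → (s ∈ sect W n ↔ pair p s ∈ V) := by
    refine strong_ind hS
      (P := fun p => p ∈ D → ∃ n, ∀ s l, SeqLen s l → (s ∈ sect W n ↔ pair p s ∈ V))
      fun p ih hp => ?_
    suffices ∃ Y ∈ codedModel W, ∀ s l, SeqLen s l → (s ∈ Y ↔ pair p s ∈ V) by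
      obtain ⟨_, ⟨n, rfl⟩, hn⟩ := this
      exact ⟨n, hn⟩
    have ih' : ∀ q, q ∈ {q ∈ D | q < p} →
        ∃ Y ∈ codedModel W, ∀ s l, SeqLen s l → (s ∈ Y ↔ pair q s ∈ V) := fun q hq => by
      obtain ⟨n, hn⟩ := ih q hq.2 hq.1
      exact ⟨_, ⟨n, rfl⟩, hn⟩
    have hlt := Shape.below hS (h.closed p hp)
    clear ih
    rcases hlt with ⟨i, j, rfl⟩ | ⟨i, j, rfl⟩ | ⟨i, j, k, rfl⟩ | ⟨i, j, k, rfl⟩ | ⟨i, rfl⟩ |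
      ⟨q, hq, rfl⟩ | ⟨q, hq, r, hr, rfl⟩ | ⟨i, q, hq, rfl⟩
    · exact ⟨_, hM.setOf_mem fun s => ∃ a, Entry s i a ∧ Entry s j a,
        fun s l hs => (h.eq_iff i j hp s l hs).symm⟩
    · exact ⟨_, hM.setOf_mem fun s => ∃ a b, Entry s i a ∧ Entry s j b ∧ a < b,
        fun s l hs => (h.lt_iff i j hp s l hs).symm⟩
    · exact ⟨_, hM.setOf_mem fun s => ∃ a b, Entry s i a ∧ Entry s j b ∧ Entry s k (a + b),
        fun s l hs => (h.add_iff i j k hp s l hs).symm⟩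
    · exact ⟨_, hM.setOf_mem fun s => ∃ a b, Entry s i a ∧ Entry s j b ∧ Entry s k (a * b),
        fun s l hs => (h.mul_iff i j k hp s l hs).symm⟩
    · exact ⟨_, hM.setOf_mem fun s => ∃ a, Entry s i a ∧ a ∈ Z,
        fun s l hs => (h.mem_iff i hp s l hs).symm⟩
    · obtain ⟨Y, hY, hYq⟩ := ih' q hq
      have := Fact.mk hY
      exact ⟨_, hM.setOf_mem fun s => s ∉ Y, fun s l hs =>
        (not_congr (hYq s l hs)).trans (h.neg_iff q hp s l hs).symm⟩
    · obtain ⟨Y, hY, hYq⟩ := ih' q hq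
      obtain ⟨Y', hY', hYr⟩ := ih' r hr
      have := Fact.mk hY
      have := Fact.mk hY'
      exact ⟨_, hM.setOf_mem fun s => s ∈ Y ∧ s ∈ Y', fun s l hs =>
        (and_congr (hYq s l hs) (hYr s l hs)).trans (h.and_iff q r hp s l hs).symm⟩
    · obtain ⟨Y, hY, hYq⟩ := ih' q hq
      have := Fact.mk hY
      exact ⟨_, hM.setOf_mem fun s => ∀ t, Variant i s t → t ∈ Y, fun s l hs =>
        (forall_congr' fun t => forall_congr' fun ht => hYq t l (ht.seqLen hS hs)).trans
          (h.all_iff i q hp s l hs).symm⟩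
  obtain ⟨n, hn⟩ := key p hp
  have := Fact.mk (show sect W n ∈ codedModel W from ⟨n, rfl⟩)
  obtain ⟨Y, hY⟩ : ∃ Y, Y = sect W n := ⟨_, rfl⟩
  have := Fact.mk (show Y ∈ codedModel W from ⟨n, hY.symm⟩)
  convert hM.setOf_mem fun x => ∃ t, Variant 0 s t ∧ Entry t 0 x ∧ t ∈ Y using 1
  ext x
  rw [hs, hY]
  refine exists_congr fun t => and_congr_right fun ht => and_congr_right fun _ => ?_
  obtain ⟨l, -, hl⟩ := ht.1
  exact (hn t l hl).symm

/-- A branch that is leftmost within the ω-model suffices, because that model contains everything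
arithmetically reducible to its members. -/
theorem PseudoPi11CA.alpp (hA : PseudoPi11CA S) : ALPP S := by
  rintro T hT - ⟨H, hH, hbr⟩
  -- Including `H` ensures that `T` still has a branch in the ω-model.
  obtain ⟨W, hW, hX, hM, hPi⟩ := hA _ (join_mem hS hT hH)
  have hXM : {join T H} ⊆ codedModel W := Set.singleton_subset_iff.2 hX
  have hTC : T ∈ arClosure {join T H} :=
    left_mem_of_join_mem (modelsACA₀_arClosure hM hXM) (subset_arClosure rfl)
  have hTar := fun k m => arSet_of_mem_arClosure hTC (k := k) (m := m)
  have hP : Ar {join T H} fun (A : Fin 1 → Set N) (v : Fin 1 → N) =>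
      ¬ IsBranchThrough T (A 0) (v 0) := by
    unfold IsBranchThrough
    infer_instance
  obtain ⟨m, θ, v, hθ, h⟩ := hP.exists_uniform_formula
  have hB := hPi (.allSet θ) ⟨θ, hθ, rfl⟩ v
  obtain ⟨F, hF, hFT, hleft⟩ := exists_leftmost_branch hM hB (T := T) (fun σ => by
    simp [Formula.Realize, h]) ⟨H, right_mem_of_join_mem hM hX, hbr⟩
  refine ⟨F, codedModel_subset hS hW hF, hFT, ?_⟩
  rintro ⟨G, -, hGT, hGF, hG⟩
  exact hleft ⟨G, mem_codedModel_of_arithmeticalIn hS hW hM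
    (join_mem hM (left_mem_of_join_mem hM hX) hF) hG, hGT, hGF⟩

end LeftmostPath

end SecondOrderArithmetic

/-- `ACA₀` proves that `Π¹₁-CA^ε` and `ALPP` are equivalent: the equivalence holds in all models of
`ACA₀`, including those with nonstandard first-order part. -/
theorem corollary2p2 {N : Type u} [Zero N] [One N] [Add N] [Mul N] [LT N]
    (S : Set (Set N)) (hS : SecondOrderArithmetic.ModelsACA₀ S) :
    SecondOrderArithmetic.PseudoPi11CA S ↔ SecondOrderArithmetic.ALPP S := by
  -- These instances are built on the given operations and order, so both principles keep their
  -- meaning.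
  let _ := hS.commSemiring
  let _ := hS.linearOrder
  have := hS.canonicallyOrderedAdd
  have := hS.isStrictOrderedRing
  exact ⟨SecondOrderArithmetic.PseudoPi11CA.alpp hS, SecondOrderArithmetic.ALPP.pseudoPi11CA hS⟩
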